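/- **Setting.** For $k\ge 1$ let $I_j=((j-1)/k,\,j/k]$, $1\le j\le k$, and let $f_\theta=k\sum_{j=1}^k\theta_j 1_{I_j}$ for $\theta$ in the simplex $\{\theta\in\mathbb R^k:\theta_j\ge 0,\ \sum_j\theta_j=1\}$. Let $\Pi(\cdot\mid k)$ be the Dirichlet prior on $\theta$ with parameter $(\alpha_k,\dots,\alpha_k)$, where $a k^{-H}\le\alpha_k\le A$ for all $k\ge 1$, with constants $a>0$, $A$, $H$ independent of $k$ (for instance $\alpha_k=\alpha>0$ fixed). The observations $\mathbf x_n=(x_1,\dots,x_n)$ are i.i.d. from a continuous density $f_0$ on $[0,1]$ with $0<c_0\le f_0\le C_0$. Put $h(f,g)^2=\int_0^1(\sqrt f-\sqrt g)^2\,dx$ and $$b(k)^2=\sum_{j=1}^k\int_{I_j}\big(\sqrt{f_0}-k\tilde\eta_j\big)^2dx,\qquad \tilde\eta_j=\int_{I_j}\sqrt{f_0}\,dx .$$ Fix $K>0$ and let $$\epsilon_n(k)=\inf\{\epsilon\ge 0:\ \Pi(h(f_0,f_\theta)\le K\epsilon\mid k)\ge e^{-n\epsilon^2}\}.$$ Let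 $\Lambda_n=\{1,\dots,k_n\}$ with $k_n\ge 1$ and $k_n=O(n/\log n)$. For a sequence $m_n\to\infty$ put $$\epsilon_{n,0}^2=\inf\{\epsilon_n(k)^2:\ k\in\Lambda_n,\ \epsilon_n(k)^2\ge m_n\log n/n\}\ \vee\ m_n\log n/n,$$ read as $m_n\log n/n$ if no $k\in\Lambda_n$ satisfies the constraint. Let $\hat k_n$ be any maximizer over $k\in\Lambda_n$ of the marginal likelihood $\int\prod_{i=1}^n f_\theta(x_i)\,d\Pi(\theta\mid k)$, and let $\Pi(\cdot\mid\mathbf x_n,k)$ be the posterior distribution given $k$. **Proposition.** 1. For all $n\ge 1$ and $k\ge 2$, $\epsilon_n(k)$ is the unique $\epsilon\ge 0$ with $\Pi(h(f_0,f_\theta)\le K\epsilon\mid k)=e^{-n\epsilon^2}$. 2. There are constants $c,C>0$, not depending on $n$ and $k$, such that for all $n$ large enough and all $k\in\Lambda_n$ $$c\Big(b(k)^2+\frac{k\log(n/k)}{n}\Big)\le\epsilon_n(k)^2\le C\Big(b(k)^2+\frac{k\log n}{n}\Big),$$ where for $k=1$ the lower bound is claimed only if $f_0\not\equiv 1$.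 3. Suppose moreover that $|f_0(x)-f_0(y)|\le L|x-y|^\beta$ for all $x,y\in[0,1]$, with $L>0$ and $\beta\in(0,1]$. - (a) If $(n/\log n)^{1/(2\beta+1)}=O(k_n)$ and $m_n\to\infty$ with $m_n=o\big((n/\log n)^{1/(2\beta+1)}\big)$, then there is a constant $C>0$ with $\epsilon_{n,0}\le C(n/\log n)^{-\beta/(2\beta+1)}$ for all $n$ large enough. - (b) For all $m_n\to\infty$ and $M_n\to\infty$, $\Pi\big(h(f_0,f_\theta)\le M_n\epsilon_{n,0}\mid\mathbf x_n,\hat k_n\big)\to 1$ in probability under the law of $\mathbf x_n$. - (c) If $(n/\log n)^{1/(2\beta+1)}=O(k_n)$, then for all $M_n\to\infty$, $\Pi\big(h(f_0,f_\theta)\le M_n(n/\log n)^{-\beta/(2\beta+1)}\mid\mathbf x_n,\hat k_n\big)\to 1$ in probability under the law of $\mathbf x_n$. -/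

import Mathlib

open MeasureTheory ProbabilityTheory Filter Topology Asymptotics Set

namespace RandomHistogram

noncomputable section

/-- The bin `I_j = ((j-1)/k, j/k]`, with the index `j` running over `0, …, k-1`. -/
def bin (k : ℕ) (j : Fin k) : Set ℝ :=
  Ioc ((j : ℝ) / k) (((j : ℝ) + 1) / k)

/-- The histogram `f_θ = k ∑_j θ_j 1_{I_j}`. -/
def hist {k : ℕ} (θ : Fin k → ℝ) (x : ℝ) : ℝ :=
  k * ∑ j, (bin k j).indicator (fun _ => θ j) x

/-- The Dirichlet distribution with parameter `(a, …, a)` on the simplex of `ℝ^k`: the law of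
`(γ_1, …, γ_k) / (γ_1 + ⋯ + γ_k)` for independent `γ_j` with the Gamma distribution of shape `a`
and rate `1`. -/
def symmDirichlet (k : ℕ) (a : ℝ) : Measure (Fin k → ℝ) :=
  (Measure.pi fun _ : Fin k => gammaMeasure a 1).map fun γ j => γ j / ∑ i, γ i

/-- The Hellinger distance between densities on `[0,1]`. -/
def hellinger (f g : ℝ → ℝ) : ℝ :=
  √(∫ x in Icc (0 : ℝ) 1, (√(f x) - √(g x)) ^ 2)

/-- `b(k)²`, the squared `L²` error of the projection of `√f₀` on the histograms with `k` bins. -/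
def biasSq (f₀ : ℝ → ℝ) (k : ℕ) : ℝ :=
  ∑ j : Fin k, ∫ x in bin k j, (√(f₀ x) - (∫ y in bin k j, √(f₀ y)) * k) ^ 2

/-- The set of parameters in the closed Hellinger ball of radius `r` about `f₀`. -/
def hellingerBall (f₀ : ℝ → ℝ) (k : ℕ) (r : ℝ) : Set (Fin k → ℝ) :=
  {θ | hellinger f₀ (hist θ) ≤ r}

/-- The radius `ε_n(k)` solving `Π(h(f₀, f_θ) ≤ K ε | k) = exp (-n ε²)`, written as a generalized
inverse so that it also makes sense for `k = 1`, where the prior is a point mass and the equation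
need not have a solution. -/
def epsRadius (f₀ : ℝ → ℝ) (α : ℕ → ℝ) (K : ℝ) (n k : ℕ) : ℝ :=
  sInf {ε : ℝ | 0 ≤ ε ∧
    Real.exp (-(n * ε ^ 2)) ≤ (symmDirichlet k (α k)).real (hellingerBall f₀ k (K * ε))}

/-- The oracle rate `ε_{n,0}`, where
`ε_{n,0}² = inf {ε_n(k)² : k ∈ {1, …, kₙ}, ε_n(k)² ≥ m_n log n / n} ∨ m_n log n / n`.
If no `k` satisfies the constraint, the value is `m_n log n / n` (the real infimum of the empty
set is `0`). -/
def epsOracle (f₀ : ℝ → ℝ) (α : ℕ → ℝ) (K : ℝ) (kn : ℕ → ℕ) (m : ℕ → ℝ) (n : ℕ) : ℝ :=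
  √(max
    (sInf ((fun k => epsRadius f₀ α K n k ^ 2) ''
      {k | k ∈ Finset.Icc 1 (kn n) ∧ m n * Real.log n / n ≤ epsRadius f₀ α K n k ^ 2}))
    (m n * Real.log n / n))

/-- The probability measure on `[0,1]` with density `f₀`. -/
def trueLaw (f₀ : ℝ → ℝ) : Measure ℝ :=
  (volume.restrict (Icc (0 : ℝ) 1)).withDensity fun x => ENNReal.ofReal (f₀ x)

/-- The law of `n` independent observations with density `f₀`. -/
def sampleLaw (f₀ : ℝ → ℝ) (n : ℕ) : Measure (Fin n → ℝ) :=
  Measure.pi fun _ => trueLaw f₀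

/-- The likelihood of `θ` at the sample `x`. -/
def likelihood {n k : ℕ} (x : Fin n → ℝ) (θ : Fin k → ℝ) : ENNReal :=
  ∏ i, ENNReal.ofReal (hist θ (x i))

/-- The marginal likelihood of the number of bins `k`. -/
def marginal (α : ℕ → ℝ) {n : ℕ} (x : Fin n → ℝ) (k : ℕ) : ENNReal :=
  ∫⁻ θ, likelihood x θ ∂symmDirichlet k (α k)

/-- The posterior distribution of `θ` given the sample `x` and the number of bins `k`. -/
def posterior (α : ℕ → ℝ) {n : ℕ} (x : Fin n → ℝ) (k : ℕ) : Measure (Fin k → ℝ) :=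
  (marginal α x k)⁻¹ • (symmDirichlet k (α k)).withDensity (likelihood x)

/-- `khat` is a maximum marginal likelihood estimator over `{1, …, kₙ}`, for every sample size
(ties are broken arbitrarily). -/
def IsMMLE (α : ℕ → ℝ) (kn : ℕ → ℕ) (khat : ∀ n : ℕ, (Fin n → ℝ) → ℕ) : Prop :=
  ∀ (n : ℕ) (x : Fin n → ℝ), khat n x ∈ Finset.Icc 1 (kn n) ∧
    ∀ k ∈ Finset.Icc 1 (kn n), marginal α x k ≤ marginal α x (khat n x)

/-- The empirical Bayes posterior probability of the Hellinger ball of radius `r n` about `f₀`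
tends to `1` in probability under the law of the sample. -/
def ContractsAt (f₀ : ℝ → ℝ) (α : ℕ → ℝ) (khat : ∀ n : ℕ, (Fin n → ℝ) → ℕ) (r : ℕ → ℝ) : Prop :=
  ∀ δ : ℝ, 0 < δ →
    Tendsto (fun n : ℕ => sampleLaw f₀ n
      {x | δ ≤ |(posterior α x (khat n x)).real (hellingerBall f₀ (khat n x) (r n)) - 1|})
      atTop (𝓝 0)

end

end RandomHistogram

/-! Square roots of histograms lie in a `k`-dimensional subspace of L², in which the projection of
`√f` has the coordinates `rootMass`. Pythagoras gives h² = b(k)² + Σ (√θ_j - v_j)² with v =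
`rootMass` (`hellinger_sq_eq_biasSq_add`), so Hellinger balls are Euclidean balls in the square
roots of a Dirichlet vector, that is, of a normalized vector of independent Gamma variables.

Defining equation. The prior mass of the ball is nondecreasing in ε and exp(-nε²) is strictly
decreasing, so there is at most one solution. One exists by the intermediate value theorem, because
for k ≥ 2 the prior charges no Hellinger sphere (`gammaProd_level_null`).

Bounds for the radius. No histogram is closer to f than b(k), which gives the bias term of the lower
bound. For the other term, a ball of radius r forces three quarters of the √θ_j to lie within
relative error O(r) of v_j. Gamma densities of bounded shape are uniformly bounded with respect to
dy/y, so each ratio γ_j/γ_{j₀} does this with probability O(r), and the ball has mass at most 2^k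
(Gr)^(k/4). For the upper bound, the vectors with θ_j ≥ (1 - 1/n) p_j, p the cell masses, are within
squared distance 2b(k)² + 2/n of f and have prior mass at least exp(-Bk log n)
(`exists_le_symmDirichlet`).

Contraction. Two events of high probability suffice. (i) Some good l has evidence at least exp(-B(n
b(l)² + l log n) - 2 - t) times the true likelihood (`exists_marginal_lower`): histograms with θ ≥
(1 - 1/n) p have, for every sample, almost the likelihood of the histogram of p, and the latter is
compared with f by Markov's inequality and a chi-square bound. (ii) For every k at once, the
evidence that comes from outside the ball of radius r is exponentially small in nr²
(`exists_sampleLaw_compl_ball_le`). If nr² exceeds a multiple of k log(n/k), this follows from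
brackets and Markov's inequality for square roots of likelihood ratios. Otherwise it follows outside
a larger ball, and that ball itself has negligible prior mass. Since the evidence of the maximizer
is at least that of l, comparing (i) and (ii) bounds its posterior; the position of the maximizer
need not be located.

The bounds for the radius match only where log(n/k) is comparable with log n. Hölder smoothness
closes the gap: a k larger than n^(1/(2β+1)) can be replaced by that number of bins
(`exists_bins_le_epsRadius_sq`). The rate of the oracle comes from balancing k^(-2β) with k log n /
n, and the last claim combines the two preceding ones. -/

namespace RandomHistogram

noncomputable section

/-- A continuous probability density on `[0,1]`, extended continuously to `ℝ`, with values between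
two positive constants. -/
structure BoundedDensity (f : ℝ → ℝ) (c C : ℝ) : Prop where
  continuous : Continuous f
  pos : 0 < c
  lower : ∀ x, c ≤ f x
  upper : ∀ x, f x ≤ C
  integral_eq_one : ∫ x in Icc (0 : ℝ) 1, f x = 1

/-! ### Bins -/

theorem measurableSet_bin (k : ℕ) (j : Fin k) : MeasurableSet (bin k j) := measurableSet_Ioc

theorem natCast_pos_of_fin {k : ℕ} (j : Fin k) : (0 : ℝ) < k := by
  exact_mod_cast j.pos

theorem mem_bin_iff {k : ℕ} {j : Fin k} {x : ℝ} :
    x ∈ bin k j ↔ (j : ℝ) < k * x ∧ k * x ≤ j + 1 := by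
  have hk := natCast_pos_of_fin j
  rw [bin, mem_Ioc, div_lt_iff₀ hk, le_div_iff₀ hk, mul_comm x]

theorem volume_bin {k : ℕ} (j : Fin k) : volume (bin k j) = ENNReal.ofReal (1 / k) := by
  rw [bin, Real.volume_Ioc]; congr 1; ring

theorem volume_real_bin {k : ℕ} (j : Fin k) : volume.real (bin k j) = 1 / k := by
  rw [measureReal_def, volume_bin, ENNReal.toReal_ofReal (by positivity)]

theorem bin_subset {k : ℕ} (j : Fin k) : bin k j ⊆ Ioc 0 1 := by
  intro x hx
  have hk := natCast_pos_of_fin j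
  rw [mem_bin_iff] at hx
  have hj : (j : ℝ) + 1 ≤ k := by exact_mod_cast j.2
  have hj0 : (0 : ℝ) ≤ j := by positivity
  constructor
  · by_contra! h
    nlinarith [hx.1]
  · by_contra! h
    nlinarith [hx.2]

theorem bin_inj {k : ℕ} {i j : Fin k} {x : ℝ} (hi : x ∈ bin k i) (hj : x ∈ bin k j) : i = j := by
  rw [mem_bin_iff] at hi hj
  have h1 : (i : ℝ) < j + 1 := by linarith
  have h2 : (j : ℝ) < i + 1 := by linarith
  have h1 : (i : ℕ) < j + 1 := by exact_mod_cast h1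
  have h2 : (j : ℕ) < i + 1 := by exact_mod_cast h2
  exact Fin.ext (by omega)

theorem iUnion_bin {k : ℕ} (hk : 1 ≤ k) : ⋃ j : Fin k, bin k j = Ioc 0 1 := by
  refine Subset.antisymm (iUnion_subset bin_subset) fun x hx => ?_
  have hk' : (0 : ℝ) < k := by exact_mod_cast hk
  have hpos : 0 < k * x := mul_pos hk' hx.1
  have h1 : 0 < ⌈k * x⌉₊ := Nat.ceil_pos.2 hpos
  have h2 : ⌈k * x⌉₊ ≤ k := Nat.ceil_le.2 (by nlinarith [hx.2])
  -- Bins are closed on the right and numbered from zero, hence the ceiling minus one.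
  refine mem_iUnion.2 ⟨⟨⌈k * x⌉₊ - 1, by omega⟩, ?_⟩
  rw [mem_bin_iff]
  have h3 : ((⌈k * x⌉₊ - 1 : ℕ) : ℝ) = ⌈k * x⌉₊ - 1 := by
    rw [Nat.cast_sub h1]; simp
  simp only [h3]
  constructor
  · have := Nat.ceil_lt_add_one hpos.le
    linarith
  · have := Nat.le_ceil (k * x)
    linarith

theorem restrict_Icc_eq_sum {k : ℕ} (hk : 1 ≤ k) :
    volume.restrict (Icc (0 : ℝ) 1) = ∑ j : Fin k, volume.restrict (bin k j) := by
  rw [← restrict_Ioc_eq_restrict_Icc, ← iUnion_bin hk, Measure.restrict_iUnion _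
    (measurableSet_bin k), Measure.sum_fintype]
  intro i j hij
  exact disjoint_left.2 fun x hi hj => hij (bin_inj hi hj)

theorem integral_Icc_eq_sum {k : ℕ} (hk : 1 ≤ k) {g : ℝ → ℝ}
    (hg : ∀ j : Fin k, IntegrableOn g (bin k j)) :
    ∫ x in Icc (0 : ℝ) 1, g x = ∑ j : Fin k, ∫ x in bin k j, g x := by
  rw [restrict_Icc_eq_sum hk, integral_finsetSum_measure fun j _ => hg j]

theorem lintegral_Icc_eq_sum {k : ℕ} (hk : 1 ≤ k) (g : ℝ → ENNReal) :
    ∫⁻ x in Icc (0 : ℝ) 1, g x = ∑ j : Fin k, ∫⁻ x in bin k j, g x := by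
  rw [restrict_Icc_eq_sum hk, lintegral_finsetSum_measure]

theorem hist_of_mem {k : ℕ} (θ : Fin k → ℝ) {j : Fin k} {x : ℝ} (hx : x ∈ bin k j) :
    hist θ x = k * θ j := by
  rw [hist, Finset.sum_eq_single j, indicator_of_mem hx]
  · intro i _ hij
    exact indicator_of_notMem (fun hi => hij (bin_inj hi hx)) _
  · simp

theorem integrableOn_bin {g : ℝ → ℝ} (hg : Continuous g) {k : ℕ} (j : Fin k) :
    IntegrableOn g (bin k j) :=
  (hg.integrableOn_Icc (a := (0 : ℝ)) (b := 1)).mono_set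
    ((bin_subset j).trans Ioc_subset_Icc_self)

theorem setIntegral_bin_const {k : ℕ} (j : Fin k) (c : ℝ) : ∫ _ in bin k j, c = c / k := by
  rw [setIntegral_const, volume_real_bin, smul_eq_mul]; ring

/-! ### Projections on histograms -/

/-- The coefficient of `√f` in the orthonormal basis of normalized bin indicators. -/
def rootMass (f : ℝ → ℝ) (k : ℕ) (j : Fin k) : ℝ := √k * ∫ y in bin k j, √(f y)

/-- The mass of a bin. -/
def cellMass (f : ℝ → ℝ) (k : ℕ) (j : Fin k) : ℝ := ∫ y in bin k j, f y

theorem integral_sub_const_sq {g : ℝ → ℝ} (hg : Continuous g) {k : ℕ} (j : Fin k) (c : ℝ) :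
    ∫ x in bin k j, (g x - c) ^ 2 =
      (∫ x in bin k j, g x ^ 2) - 2 * c * (∫ x in bin k j, g x) + c ^ 2 / k := by
  have h1 : ∀ x, (g x - c) ^ 2 = g x ^ 2 - 2 * c * g x + c ^ 2 := fun x => by ring
  simp_rw [h1]
  rw [integral_add, integral_sub, integral_const_mul, setIntegral_bin_const]
  · exact integrableOn_bin (hg.pow 2) j
  · exact integrableOn_bin (continuous_const.mul hg) j
  · exact integrableOn_bin ((hg.pow 2).sub (continuous_const.mul hg)) j
  · exact integrableOn_bin continuous_const j

/-- The mean minimizes the mean squared error. -/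
theorem integral_sub_mean_sq_le {g : ℝ → ℝ} (hg : Continuous g) {k : ℕ} (j : Fin k) (c : ℝ) :
    ∫ x in bin k j, (g x - (∫ y in bin k j, g y) * k) ^ 2 ≤ ∫ x in bin k j, (g x - c) ^ 2 := by
  rw [integral_sub_const_sq hg, integral_sub_const_sq hg]
  have hk := natCast_pos_of_fin j
  set I := ∫ y in bin k j, g y
  have : c ^ 2 / k - 2 * c * I - ((I * k) ^ 2 / k - 2 * (I * k) * I) = (c - I * k) ^ 2 / k := by
    field_simp; ring
  have h2 : 0 ≤ (c - I * k) ^ 2 / k := by positivity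
  linarith

theorem biasSq_nonneg (f : ℝ → ℝ) (k : ℕ) : 0 ≤ biasSq f k :=
  Finset.sum_nonneg fun _ _ => integral_nonneg fun _ => sq_nonneg _

variable {f : ℝ → ℝ} {c C : ℝ}

namespace BoundedDensity

theorem nonneg (hf : BoundedDensity f c C) (x : ℝ) : 0 ≤ f x := hf.pos.le.trans (hf.lower x)

theorem posAt (hf : BoundedDensity f c C) (x : ℝ) : 0 < f x := hf.pos.trans_le (hf.lower x)

theorem sqrt_continuous (hf : BoundedDensity f c C) : Continuous fun x => √(f x) :=
  hf.continuous.sqrt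

theorem upper_pos (hf : BoundedDensity f c C) : 0 < C :=
  hf.pos.trans_le ((hf.lower 0).trans (hf.upper 0))

theorem sum_cellMass (hf : BoundedDensity f c C) {k : ℕ} (hk : 1 ≤ k) :
    ∑ j, cellMass f k j = 1 := by
  simp only [cellMass]
  rw [← hf.integral_eq_one, integral_Icc_eq_sum hk fun j => integrableOn_bin hf.continuous j]

theorem cellMass_ge (hf : BoundedDensity f c C) {k : ℕ} (j : Fin k) :
    c / k ≤ cellMass f k j := by
  rw [← setIntegral_bin_const j c]
  exact integral_mono (integrableOn_bin continuous_const j) (integrableOn_bin hf.continuous j)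
    hf.lower

theorem cellMass_pos (hf : BoundedDensity f c C) {k : ℕ} (j : Fin k) : 0 < cellMass f k j :=
  (div_pos hf.pos (natCast_pos_of_fin j)).trans_le (hf.cellMass_ge j)

theorem cellMass_mem_stdSimplex (hf : BoundedDensity f c C) {k : ℕ} (hk : 1 ≤ k) :
    cellMass f k ∈ stdSimplex ℝ (Fin k) :=
  ⟨fun j => (hf.cellMass_pos j).le, hf.sum_cellMass hk⟩

theorem rootMass_pos (hf : BoundedDensity f c C) {k : ℕ} (j : Fin k) : 0 < rootMass f k j := by
  have hk := natCast_pos_of_fin j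
  refine mul_pos (Real.sqrt_pos.2 hk) ((div_pos (Real.sqrt_pos.2 hf.pos) hk).trans_le ?_)
  rw [← setIntegral_bin_const j (√c)]
  exact integral_mono (integrableOn_bin continuous_const j) (integrableOn_bin hf.sqrt_continuous j)
    fun x => Real.sqrt_le_sqrt (hf.lower x)

theorem rootMass_sq_ge (hf : BoundedDensity f c C) {k : ℕ} (j : Fin k) :
    c / k ≤ rootMass f k j ^ 2 := by
  have hk := natCast_pos_of_fin j
  have h1 : √c / k ≤ ∫ y in bin k j, √(f y) := by
    rw [← setIntegral_bin_const j (√c)]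
    exact integral_mono (integrableOn_bin continuous_const j)
      (integrableOn_bin hf.sqrt_continuous j) fun x => Real.sqrt_le_sqrt (hf.lower x)
  have h2 : (√c / k) ^ 2 ≤ (∫ y in bin k j, √(f y)) ^ 2 := by gcongr
  rw [rootMass, mul_pow, Real.sq_sqrt hk.le]
  calc c / k = k * (√c / k) ^ 2 := by rw [div_pow, Real.sq_sqrt hf.pos.le]; field_simp
    _ ≤ _ := by gcongr

theorem integral_sqrt_sub_mean_sq (hf : BoundedDensity f c C) {k : ℕ} (j : Fin k) :
    ∫ x in bin k j, (√(f x) - (∫ y in bin k j, √(f y)) * k) ^ 2 =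
      cellMass f k j - rootMass f k j ^ 2 := by
  have hk := natCast_pos_of_fin j
  rw [integral_sub_const_sq hf.sqrt_continuous, rootMass, cellMass, mul_pow (√k),
    Real.sq_sqrt hk.le]
  simp_rw [Real.sq_sqrt (hf.nonneg _)]
  field_simp
  ring

theorem rootMass_sq_le (hf : BoundedDensity f c C) {k : ℕ} (j : Fin k) :
    rootMass f k j ^ 2 ≤ cellMass f k j := by
  rw [← sub_nonneg, ← hf.integral_sqrt_sub_mean_sq j]
  exact integral_nonneg fun _ => sq_nonneg _

theorem biasSq_eq (hf : BoundedDensity f c C) {k : ℕ} (hk : 1 ≤ k) :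
    biasSq f k = 1 - ∑ j, rootMass f k j ^ 2 := by
  rw [biasSq, Finset.sum_congr rfl fun j _ => hf.integral_sqrt_sub_mean_sq j,
    Finset.sum_sub_distrib, hf.sum_cellMass hk]

theorem sum_rootMass_sq_le (hf : BoundedDensity f c C) {k : ℕ} (hk : 1 ≤ k) :
    ∑ j, rootMass f k j ^ 2 ≤ 1 := by
  have := biasSq_nonneg f k
  rw [hf.biasSq_eq hk] at this
  linarith

/-- Stated for every vector, not only on the simplex (`√` vanishes at negative arguments): the
explicit formula yields measurability of the distance on the whole parameter space. -/
theorem hellinger_sq_integral (hf : BoundedDensity f c C) {k : ℕ} (hk : 1 ≤ k) (θ : Fin k → ℝ) :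
    ∫ x in Icc (0 : ℝ) 1, (√(f x) - √(hist θ x)) ^ 2 =
      1 - 2 * ∑ j, rootMass f k j * √(θ j) + ∑ j, √(θ j) ^ 2 := by
  have hk' : (0 : ℝ) < k := by exact_mod_cast hk
  have hcongr : ∀ j : Fin k, EqOn (fun x => (√(f x) - √(k * θ j)) ^ 2)
      (fun x => (√(f x) - √(hist θ x)) ^ 2) (bin k j) := fun j x hx => by
    simp only [hist_of_mem θ hx]
  rw [integral_Icc_eq_sum hk]
  · rw [← hf.sum_cellMass hk, Finset.mul_sum, ← Finset.sum_sub_distrib, ← Finset.sum_add_distrib]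
    refine Finset.sum_congr rfl fun j _ => ?_
    rw [← setIntegral_congr_fun (measurableSet_bin k j) (hcongr j),
      integral_sub_const_sq hf.sqrt_continuous, cellMass, rootMass, Real.sqrt_mul hk'.le, mul_pow,
      Real.sq_sqrt hk'.le]
    simp_rw [Real.sq_sqrt (hf.nonneg _)]
    field_simp
  · intro j
    refine IntegrableOn.congr_fun ?_ (hcongr j) (measurableSet_bin k j)
    exact integrableOn_bin ((hf.sqrt_continuous.sub continuous_const).pow 2) j

theorem hellinger_hist (hf : BoundedDensity f c C) {k : ℕ} (hk : 1 ≤ k) (θ : Fin k → ℝ) :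
    hellinger f (hist θ) = √(1 - 2 * ∑ j, rootMass f k j * √(θ j) + ∑ j, √(θ j) ^ 2) := by
  rw [hellinger, hf.hellinger_sq_integral hk]

theorem measurable_hellinger_hist (hf : BoundedDensity f c C) {k : ℕ} (hk : 1 ≤ k) :
    Measurable fun θ : Fin k → ℝ => hellinger f (hist θ) := by
  simp_rw [hf.hellinger_hist hk]
  fun_prop

theorem measurableSet_hellingerBall (hf : BoundedDensity f c C) {k : ℕ} (hk : 1 ≤ k) (r : ℝ) :
    MeasurableSet (hellingerBall f k r) :=
  measurableSet_le (hf.measurable_hellinger_hist hk) measurable_const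

theorem hellinger_sq (hf : BoundedDensity f c C) {k : ℕ} (hk : 1 ≤ k) {θ : Fin k → ℝ}
    (hθ : θ ∈ stdSimplex ℝ (Fin k)) :
    hellinger f (hist θ) ^ 2 = 2 - 2 * ∑ j, rootMass f k j * √(θ j) := by
  have h0 : 0 ≤ ∫ x in Icc (0 : ℝ) 1, (√(f x) - √(hist θ x)) ^ 2 :=
    integral_nonneg fun _ => sq_nonneg _
  rw [hellinger, Real.sq_sqrt h0, hf.hellinger_sq_integral hk]
  simp_rw [Real.sq_sqrt (hθ.1 _), hθ.2]
  ring

theorem hellinger_nonneg (f g : ℝ → ℝ) : 0 ≤ hellinger f g := Real.sqrt_nonneg _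

/-- Pythagoras: the square root of a histogram lies in the subspace onto which `√f` is projected. -/
theorem hellinger_sq_eq_biasSq_add (hf : BoundedDensity f c C) {k : ℕ} (hk : 1 ≤ k)
    {θ : Fin k → ℝ} (hθ : θ ∈ stdSimplex ℝ (Fin k)) :
    hellinger f (hist θ) ^ 2 = biasSq f k + ∑ j, (√(θ j) - rootMass f k j) ^ 2 := by
  have h : ∀ j, (√(θ j) - rootMass f k j) ^ 2 =
      θ j - 2 * (rootMass f k j * √(θ j)) + rootMass f k j ^ 2 := fun j => by
    rw [sub_sq, Real.sq_sqrt (hθ.1 j)]; ring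
  simp_rw [h]
  rw [hf.hellinger_sq hk hθ, hf.biasSq_eq hk, Finset.sum_add_distrib, Finset.sum_sub_distrib,
    ← Finset.mul_sum, hθ.2]
  ring

theorem biasSq_le_hellinger_sq (hf : BoundedDensity f c C) {k : ℕ} (hk : 1 ≤ k)
    {θ : Fin k → ℝ} (hθ : θ ∈ stdSimplex ℝ (Fin k)) :
    biasSq f k ≤ hellinger f (hist θ) ^ 2 := by
  rw [hf.hellinger_sq_eq_biasSq_add hk hθ]
  exact le_add_of_nonneg_right (Finset.sum_nonneg fun _ _ => sq_nonneg _)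

theorem hellinger_sq_le_two (hf : BoundedDensity f c C) {k : ℕ} (hk : 1 ≤ k)
    {θ : Fin k → ℝ} (hθ : θ ∈ stdSimplex ℝ (Fin k)) :
    hellinger f (hist θ) ^ 2 ≤ 2 := by
  rw [hf.hellinger_sq hk hθ]
  have : 0 ≤ ∑ j, rootMass f k j * √(θ j) :=
    Finset.sum_nonneg fun j _ => mul_nonneg (hf.rootMass_pos j).le (Real.sqrt_nonneg _)
  linarith

/-- A histogram that is not much smaller than the histogram of cell masses is Hellinger close. -/
theorem hellinger_sq_le_of_cellMass_le (hf : BoundedDensity f c C) {k : ℕ} (hk : 1 ≤ k)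
    {θ : Fin k → ℝ} (hθ : θ ∈ stdSimplex ℝ (Fin k)) {δ : ℝ} (h0 : 0 ≤ δ) (h1 : δ ≤ 1)
    (h : ∀ j, (1 - δ) * cellMass f k j ≤ θ j) :
    hellinger f (hist θ) ^ 2 ≤ 2 * biasSq f k + 2 * δ := by
  have hδ : (1 - δ) ≤ √(1 - δ) := Real.le_sqrt_of_sq_le (by nlinarith)
  -- On the simplex the squared distance is two minus twice the affinity, so a lower bound for the
  -- affinity is enough and large coordinates do no harm.
  have h3 : (1 - δ) * ∑ j, rootMass f k j ^ 2 ≤ ∑ j, rootMass f k j * √(θ j) := by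
    rw [Finset.mul_sum]
    refine Finset.sum_le_sum fun j _ => ?_
    have h4 : (1 - δ) * rootMass f k j ≤ √(θ j) := by
      refine le_trans ?_ (Real.sqrt_le_sqrt (h j))
      rw [Real.sqrt_mul (by linarith)]
      refine mul_le_mul hδ (Real.le_sqrt_of_sq_le (hf.rootMass_sq_le j)) (hf.rootMass_pos j).le
        (Real.sqrt_nonneg _)
    nlinarith [hf.rootMass_pos j]
  have h5 := hf.sum_rootMass_sq_le hk
  rw [hf.hellinger_sq hk hθ, hf.biasSq_eq hk]
  nlinarith

/-- The chi-square distance to the histogram of cell masses is of the order of the bias. -/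
theorem sum_integral_sub_mean_sq_le (hf : BoundedDensity f c C) (k : ℕ) :
    ∑ j, ∫ x in bin k j, (f x - cellMass f k j * k) ^ 2 ≤ 4 * C * biasSq f k := by
  rw [biasSq, Finset.mul_sum]
  refine Finset.sum_le_sum fun j _ => ?_
  have hk := natCast_pos_of_fin j
  set t := (∫ y in bin k j, √(f y)) * k
  have ht0 : 0 ≤ t := mul_nonneg (integral_nonneg fun _ => Real.sqrt_nonneg _) hk.le
  have htC : t ≤ √C := by
    have : ∫ y in bin k j, √(f y) ≤ √C / k := by
      rw [← setIntegral_bin_const j (√C)]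
      exact integral_mono (integrableOn_bin hf.sqrt_continuous j)
        (integrableOn_bin continuous_const j) fun x => Real.sqrt_le_sqrt (hf.upper x)
    calc t ≤ √C / k * k := mul_le_mul_of_nonneg_right this hk.le
      _ = √C := by field_simp
  -- The mean of f is the best constant, so it may be replaced by the square of the mean t of `√f`.
  -- Then f - t² = (√f - t)(√f + t) reduces the error to that of `√f`.
  refine (integral_sub_mean_sq_le hf.continuous j (t ^ 2)).trans ?_
  rw [← integral_const_mul]
  refine integral_mono (integrableOn_bin ((hf.continuous.sub continuous_const).pow 2) j)
    (integrableOn_bin (continuous_const.mul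
      ((hf.sqrt_continuous.sub continuous_const).pow 2)) j) fun x => ?_
  have h1 : f x - t ^ 2 = (√(f x) - t) * (√(f x) + t) := by
    have := Real.sq_sqrt (hf.nonneg x)
    linarith
  have h2 : √(f x) ≤ √C := Real.sqrt_le_sqrt (hf.upper x)
  have h3 : (√(f x) + t) ^ 2 ≤ (√C + √C) ^ 2 := by gcongr
  have h4 : (√C + √C) ^ 2 = 4 * C := by
    rw [← two_mul, mul_pow, Real.sq_sqrt hf.upper_pos.le]; norm_num
  simp only
  rw [h1, mul_pow, mul_comm]
  rw [h4] at h3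
  gcongr

/-- The bias for Hölder densities. -/
theorem biasSq_le_of_holder (hf : BoundedDensity f c C) {β L : ℝ} (hβ : 0 < β) (hL : 0 < L)
    (hH : ∀ x ∈ Icc (0 : ℝ) 1, ∀ y ∈ Icc (0 : ℝ) 1, |f x - f y| ≤ L * |x - y| ^ β)
    {k : ℕ} (hk : 1 ≤ k) : biasSq f k ≤ L ^ 2 / c * (k : ℝ) ^ (-(2 * β)) := by
  have hk' : (0 : ℝ) < k := by exact_mod_cast hk
  have hmain : ∀ j : Fin k, ∫ x in bin k j, (√(f x) - (∫ y in bin k j, √(f y)) * k) ^ 2 ≤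
      L ^ 2 / c * (k : ℝ) ^ (-(2 * β)) / k := fun j => by
    set y : ℝ := ((j : ℝ) + 1) / k
    have hyb : y ∈ bin k j := ⟨by simp only [y]; gcongr; linarith, le_rfl⟩
    refine (integral_sub_mean_sq_le hf.sqrt_continuous j (√(f y))).trans ?_
    rw [← setIntegral_bin_const j]
    refine setIntegral_mono_on
      (integrableOn_bin ((hf.sqrt_continuous.sub continuous_const).pow 2) j)
      (integrableOn_bin continuous_const j) (measurableSet_bin k j) fun x hx => ?_
    have h1 := hH x (Ioc_subset_Icc_self (bin_subset j hx)) y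
      (Ioc_subset_Icc_self (bin_subset j hyb))
    have h2 : |x - y| ≤ 1 / k := by
      have h3 : y = j / k + 1 / k := by simp only [y]; ring
      rw [abs_le]; constructor <;> linarith [hx.1, hx.2]
    have h3 : |f x - f y| ≤ L * (k : ℝ) ^ (-β) := by
      refine h1.trans ?_
      rw [Real.rpow_neg hk'.le, ← Real.inv_rpow hk'.le, ← one_div]
      gcongr
    have h4 : |f x - f y| = |√(f x) - √(f y)| * (√(f x) + √(f y)) := by
      have h5 := Real.sq_sqrt (hf.nonneg x)
      have h6 := Real.sq_sqrt (hf.nonneg y)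
      rw [← abs_of_nonneg (add_nonneg (Real.sqrt_nonneg (f x)) (Real.sqrt_nonneg (f y))),
        ← abs_mul]
      congr 1
      linarith
    have h5 : √c ≤ √(f x) + √(f y) :=
      (Real.sqrt_le_sqrt (hf.lower x)).trans (le_add_of_nonneg_right (Real.sqrt_nonneg _))
    have h6 : |√(f x) - √(f y)| * √c ≤ L * (k : ℝ) ^ (-β) :=
      (mul_le_mul_of_nonneg_left h5 (abs_nonneg _)).trans (h4 ▸ h3)
    have h7 : (|√(f x) - √(f y)| * √c) ^ 2 ≤ (L * (k : ℝ) ^ (-β)) ^ 2 := by gcongr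
    rw [mul_pow, sq_abs, Real.sq_sqrt hf.pos.le, mul_pow, ← Real.rpow_natCast (_ ^ (-β)),
      ← Real.rpow_mul hk'.le] at h7
    rw [div_mul_eq_mul_div, le_div_iff₀ hf.pos]
    have h8 : -(2 * β) = -β * (2 : ℕ) := by push_cast; ring
    rw [h8]
    exact h7
  calc biasSq f k ≤ ∑ j : Fin k, L ^ 2 / c * (k : ℝ) ^ (-(2 * β)) / k :=
        Finset.sum_le_sum fun j _ => hmain j
    _ = _ := by simp; field_simp

end BoundedDensity

/-! ### The Gamma distribution -/

theorem gammaMeasure_absolutelyContinuous (a r : ℝ) : gammaMeasure a r ≪ volume :=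
  withDensity_absolutelyContinuous _ _

theorem ae_pos_gammaMeasure (a r : ℝ) : ∀ᵐ x ∂gammaMeasure a r, 0 < x := by
  have h0 : ∀ᵐ x ∂gammaMeasure a r, x ≠ 0 :=
    (gammaMeasure_absolutelyContinuous a r).ae_le (Measure.ae_ne volume 0)
  have h1 : ∀ᵐ x ∂gammaMeasure a r, 0 ≤ x := by
    rw [ae_iff]
    have : {x : ℝ | ¬ 0 ≤ x} = Iio 0 := by ext; simp
    rw [this, gammaMeasure, withDensity_apply _ measurableSet_Iio]
    exact lintegral_gammaPDF_of_nonpos le_rfl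
  filter_upwards [h0, h1] with x hx0 hx1
  exact lt_of_le_of_ne hx1 hx0.symm

/-- The shapes `α k` may tend to zero, where the Gamma function has a pole. Γ(a + 1) = a Γ(a) has no
such problem, by compactness. -/
theorem exists_bounds_Gamma_add_one (A : ℝ) :
    ∃ g G : ℝ, 0 < g ∧ 0 < G ∧ ∀ a, 0 < a → a ≤ A →
      g ≤ Real.Gamma (a + 1) ∧ Real.Gamma (a + 1) ≤ G := by
  rcases le_or_gt A 0 with hA | hA
  · exact ⟨1, 1, one_pos, one_pos, fun a h0 h1 => absurd (h0.trans_le h1) hA.not_gt⟩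
  have hcont : ContinuousOn Real.Gamma (Icc 1 (A + 1)) := fun x hx =>
    (Real.differentiableAt_Gamma fun m => by
      have : (0 : ℝ) ≤ m := m.cast_nonneg
      linarith [hx.1]).continuousAt.continuousWithinAt
  have hne : (Icc 1 (A + 1)).Nonempty := ⟨1, by simp [hA.le]⟩
  obtain ⟨x, hx, hmin⟩ := isCompact_Icc.exists_isMinOn hne hcont
  obtain ⟨y, hy, hmax⟩ := isCompact_Icc.exists_isMaxOn hne hcont
  refine ⟨Real.Gamma x, Real.Gamma y, Real.Gamma_pos_of_pos (by linarith [hx.1]),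
    Real.Gamma_pos_of_pos (by linarith [hy.1]), fun a h0 h1 => ?_⟩
  have hm : a + 1 ∈ Icc 1 (A + 1) := ⟨by linarith, by linarith⟩
  exact ⟨hmin hm, hmax hm⟩

theorem gammaPDFReal_one_eq {a y : ℝ} (ha : 0 < a) (hy : 0 < y) :
    gammaPDFReal a 1 y = a / Real.Gamma (a + 1) * y ^ (a - 1) * Real.exp (-y) := by
  rw [gammaPDFReal, if_pos hy.le, Real.one_rpow, one_mul, Real.Gamma_add_one ha.ne']
  have := Real.Gamma_pos_of_pos ha
  field_simp

/-- With respect to `dy / y` the Gamma densities of bounded shape are uniformly bounded. -/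
theorem exists_gammaPDFReal_le (A : ℝ) :
    ∃ G : ℝ, 0 < G ∧ ∀ a, 0 < a → a ≤ A → ∀ y, 0 < y → gammaPDFReal a 1 y ≤ G / y := by
  obtain ⟨g, _, hg, _, hgG⟩ := exists_bounds_Gamma_add_one A
  set m := ⌈A⌉₊
  refine ⟨(|A| + 1) / g * (1 + m.factorial), by positivity, fun a ha haA y hy => ?_⟩
  rw [gammaPDFReal_one_eq ha hy, le_div_iff₀ hy]
  -- An integer exponent m ≥ A serves all shapes at once, and y^m exp(-y) ≤ m!.
  have h1 : y ^ a ≤ 1 + y ^ m := by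
    rcases le_total y 1 with h | h
    · have := Real.rpow_le_one hy.le h ha.le
      have := pow_pos hy m
      linarith
    · have : y ^ a ≤ y ^ (m : ℝ) :=
        Real.rpow_le_rpow_of_exponent_le h (haA.trans (Nat.le_ceil A))
      rw [Real.rpow_natCast] at this
      linarith
  have h2 : y ^ a * Real.exp (-y) ≤ 1 + m.factorial := by
    have h3 := Real.pow_div_factorial_le_exp y hy.le m
    rw [div_le_iff₀ (by positivity)] at h3
    have h4 : (1 : ℝ) ≤ Real.exp y := Real.one_le_exp hy.le
    rw [Real.exp_neg, ← div_eq_mul_inv, div_le_iff₀ (Real.exp_pos _)]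
    nlinarith
  have h5 : y ^ (a - 1) * y = y ^ a := by
    rw [← Real.rpow_add_one hy.ne']; ring_nf
  have h6 : a / Real.Gamma (a + 1) ≤ (|A| + 1) / g := by
    have := (hgG a ha haA).1
    have : a ≤ |A| + 1 := by linarith [le_abs_self A]
    gcongr
  calc a / Real.Gamma (a + 1) * y ^ (a - 1) * Real.exp (-y) * y
      = a / Real.Gamma (a + 1) * (y ^ (a - 1) * y * Real.exp (-y)) := by ring
    _ = a / Real.Gamma (a + 1) * (y ^ a * Real.exp (-y)) := by rw [h5]
    _ ≤ _ := by gcongr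

/-- The bound depends on the ratio of the endpoints only. This scale invariance is what lets windows
be placed relative to another random variable. -/
theorem gammaMeasure_Icc_le {a G : ℝ} (hG : 0 < G)
    (h : ∀ y, 0 < y → gammaPDFReal a 1 y ≤ G / y) {l u : ℝ} (hl : 0 < l) :
    gammaMeasure a 1 (Icc l u) ≤ ENNReal.ofReal (G * (u / l - 1)) := by
  rw [gammaMeasure, withDensity_apply _ measurableSet_Icc]
  calc ∫⁻ x in Icc l u, gammaPDF a 1 x ≤ ∫⁻ _ in Icc l u, ENNReal.ofReal (G / l) :=
        setLIntegral_mono measurable_const fun x hx =>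
          ENNReal.ofReal_le_ofReal ((h x (hl.trans_le hx.1)).trans (by gcongr; exact hx.1))
    _ = ENNReal.ofReal (G * (u / l - 1)) := by
        rw [setLIntegral_const, Real.volume_Icc, ← ENNReal.ofReal_mul (by positivity)]
        congr 1; field_simp

theorem le_gammaMeasure_Icc {a A G : ℝ} (ha : 0 < a) (haA : a ≤ A)
    (hG : Real.Gamma (a + 1) ≤ G) {l u : ℝ} (hl : 0 < l) (hu : u ≤ 1) :
    ENNReal.ofReal ((u - l) * (a / G * l ^ A * Real.exp (-1))) ≤ gammaMeasure a 1 (Icc l u) := by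
  have hG0 := Real.Gamma_pos_of_pos (add_pos ha one_pos)
  have hGpos : 0 < G := hG0.trans_le hG
  rw [gammaMeasure, withDensity_apply _ measurableSet_Icc]
  calc _ = ∫⁻ _ in Icc l u, ENNReal.ofReal (a / G * l ^ A * Real.exp (-1)) := by
        rw [setLIntegral_const, Real.volume_Icc, ← ENNReal.ofReal_mul (by positivity), mul_comm]
    _ ≤ ∫⁻ x in Icc l u, gammaPDF a 1 x := by
        refine setLIntegral_mono (measurable_gammaPDFReal a 1).ennreal_ofReal fun x hx =>
          ENNReal.ofReal_le_ofReal ?_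
        have hx0 : 0 < x := hl.trans_le hx.1
        have hx1 : x ≤ 1 := hx.2.trans hu
        rw [gammaPDFReal_one_eq ha hx0]
        have h1 : l ^ A ≤ x ^ (a - 1) :=
          (Real.rpow_le_rpow hl.le hx.1 (ha.le.trans haA)).trans
            (Real.rpow_le_rpow_of_exponent_ge hx0 hx1 (by linarith))
        gcongr

/-! ### The Dirichlet distribution -/

/-- The independent Gamma variables that are normalized to a Dirichlet vector. -/
abbrev gammaProd (k : ℕ) (a : ℝ) : Measure (Fin k → ℝ) :=
  Measure.pi fun _ : Fin k => gammaMeasure a 1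

theorem measurable_normalize (k : ℕ) :
    Measurable fun (γ : Fin k → ℝ) (j : Fin k) => γ j / ∑ i, γ i := by
  fun_prop

theorem isProbabilityMeasure_gammaProd (k : ℕ) {a : ℝ} (ha : 0 < a) :
    IsProbabilityMeasure (gammaProd k a) := by
  have := isProbabilityMeasure_gammaMeasure ha one_pos
  infer_instance

theorem isProbabilityMeasure_symmDirichlet (k : ℕ) {a : ℝ} (ha : 0 < a) :
    IsProbabilityMeasure (symmDirichlet k a) := by
  have := isProbabilityMeasure_gammaProd k ha
  exact Measure.isProbabilityMeasure_map (measurable_normalize k).aemeasurable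

theorem ae_pos_gammaProd (k : ℕ) {a : ℝ} (ha : 0 < a) :
    ∀ᵐ γ ∂gammaProd k a, ∀ j, 0 < γ j := by
  have := isProbabilityMeasure_gammaMeasure ha one_pos
  rw [ae_all_iff]
  intro j
  exact Measure.tendsto_eval_ae_ae.eventually (ae_pos_gammaMeasure a 1)

theorem normalize_mem_stdSimplex {k : ℕ} (hk : 1 ≤ k) {γ : Fin k → ℝ} (h : ∀ j, 0 < γ j) :
    (fun j => γ j / ∑ i, γ i) ∈ stdSimplex ℝ (Fin k) := by
  have hne : (Finset.univ : Finset (Fin k)).Nonempty := ⟨⟨0, hk⟩, Finset.mem_univ _⟩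
  have hS : 0 < ∑ i, γ i := Finset.sum_pos (fun i _ => h i) hne
  refine ⟨fun j => div_nonneg (h j).le hS.le, ?_⟩
  rw [← Finset.sum_div, div_self hS.ne']

theorem ae_mem_stdSimplex {k : ℕ} (hk : 1 ≤ k) {a : ℝ} (ha : 0 < a) :
    ∀ᵐ θ ∂symmDirichlet k a, θ ∈ stdSimplex ℝ (Fin k) := by
  rw [symmDirichlet, ae_map_iff (p := fun θ => θ ∈ stdSimplex ℝ (Fin k))
    (measurable_normalize k).aemeasurable (isClosed_stdSimplex ℝ (Fin k)).measurableSet]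
  filter_upwards [ae_pos_gammaProd k ha] with γ hγ
  exact normalize_mem_stdSimplex hk hγ

theorem symmDirichlet_apply {k : ℕ} {a : ℝ} {S : Set (Fin k → ℝ)} (hS : MeasurableSet S) :
    symmDirichlet k a S = gammaProd k a {γ | (fun j => γ j / ∑ i, γ i) ∈ S} := by
  rw [symmDirichlet, Measure.map_apply (measurable_normalize k) hS]; rfl

/-- A level set of a positive linear form in the square roots of a Dirichlet vector is a null set. -/
theorem gammaProd_level_null {k : ℕ} (hk : 2 ≤ k) {a : ℝ} (ha : 0 < a) {v : Fin k → ℝ}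
    (hv : ∀ j, 0 < v j) (s : ℝ) :
    gammaProd k a {γ | (∀ j, 0 < γ j) ∧ ∑ j, v j * √(γ j / ∑ i, γ i) = s} = 0 := by
  obtain ⟨n, rfl⟩ : ∃ n, k = n + 2 := ⟨k - 2, by omega⟩
  have := isProbabilityMeasure_gammaMeasure ha one_pos
  set E : Set (Fin (n + 2) → ℝ) :=
    {γ | (∀ j, 0 < γ j) ∧ ∑ j, v j * √(γ j / ∑ i, γ i) = s}
  have hE : MeasurableSet E := by
    have h1 : MeasurableSet {γ : Fin (n + 2) → ℝ | ∑ j, v j * √(γ j / ∑ i, γ i) = s} :=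
      measurableSet_eq_fun (by fun_prop) measurable_const
    have h0 : MeasurableSet {γ : Fin (n + 2) → ℝ | ∀ j, 0 < γ j} := by
      rw [ofPred_forall]
      exact MeasurableSet.iInter fun j => measurableSet_lt measurable_const (measurable_pi_apply j)
    exact h0.inter h1
  have hmp := measurePreserving_piFinSuccAbove (fun _ : Fin (n + 2) => gammaMeasure a 1) 0
  set e := MeasurableEquiv.piFinSuccAbove (fun _ : Fin (n + 2) => ℝ) 0
  have hE' : MeasurableSet (e.symm ⁻¹' E) := e.symm.measurable hE
  have h1 := hmp.measure_preimage hE'.nullMeasurableSet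
  have h2 : e ⁻¹' (e.symm ⁻¹' E) = E := by ext; simp
  rw [gammaProd, ← h2, h1, Measure.prod_apply_symm hE', lintegral_eq_zero_iff']
  swap
  · exact (measurable_measure_prodMk_right hE').aemeasurable
  -- With the other variables fixed, only finitely many values of the first one are in the level
  -- set.
  refine Eventually.of_forall fun y => ?_
  have hsub : ((fun x => (x, y)) ⁻¹' (e.symm ⁻¹' E)).Finite := by
    by_cases hy : ∀ i, 0 < y i
    swap
    · convert Set.finite_empty
      refine eq_empty_of_forall_notMem fun x hx => hy fun i => ?_
      have := hx.1 (Fin.succAbove 0 i)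
      simpa [e, MeasurableEquiv.piFinSuccAbove] using this
    set S := ∑ i, y i
    set B := ∑ i, v (Fin.succ i) * √(y i)
    have hS : 0 < S := Finset.sum_pos (fun i _ => hy i) ⟨0, Finset.mem_univ _⟩
    have hB : 0 < B := Finset.sum_pos
      (fun i _ => mul_pos (hv _) (Real.sqrt_pos.2 (hy i))) ⟨0, Finset.mem_univ _⟩
    -- The equation reads v₀√x + B = s√(x + S); squared, it is a polynomial equation in √x. Its
    -- linear coefficient 2v₀B is positive even if the leading one vanishes. This is where a second
    -- bin is needed.
    let p : Polynomial ℝ := Polynomial.C (v 0 ^ 2 - s ^ 2) * Polynomial.X ^ 2 +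
      Polynomial.C (2 * v 0 * B) * Polynomial.X + Polynomial.C (B ^ 2 - s ^ 2 * S)
    have hp : p ≠ 0 := fun h => by
      have : p.coeff 1 = 2 * v 0 * B := by
        simp [p, Polynomial.coeff_C, Polynomial.coeff_X_pow, -map_sub, -map_mul, -map_pow]
      rw [h, Polynomial.coeff_zero] at this
      have := mul_pos (mul_pos two_pos (hv 0)) hB
      linarith
    refine ((Polynomial.finite_setOfPred_isRoot hp).image fun t => t ^ 2).subset fun x hx => ?_
    have hx0 : 0 < x := by
      have := hx.1 0
      simpa [e, MeasurableEquiv.piFinSuccAbove] using this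
    have hx1 : v 0 * √(x / (x + S)) + ∑ i, v (Fin.succ i) * √(y i / (x + S)) = s := by
      have := hx.2
      simpa [e, MeasurableEquiv.piFinSuccAbove, Fin.sum_univ_succ (n := n + 1), S] using this
    refine ⟨√x, ?_, Real.sq_sqrt hx0.le⟩
    have hxS : 0 < x + S := by linarith
    have hR : 0 < √(x + S) := Real.sqrt_pos.2 hxS
    have hx2 : v 0 * √x + B = s * √(x + S) := by
      rw [← hx1, add_mul, Finset.sum_mul, Real.sqrt_div hx0.le]
      congr 1
      · field_simp
      · refine Finset.sum_congr rfl fun i _ => ?_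
        rw [Real.sqrt_div (hy i).le]
        field_simp
    have hx3 : (v 0 * √x + B) ^ 2 = s ^ 2 * (x + S) := by
      rw [hx2, mul_pow, Real.sq_sqrt hxS.le]
    have hx4 := Real.sq_sqrt hx0.le
    have : p.eval √x = 0 := by
      simp only [p, Polynomial.eval_add, Polynomial.eval_mul, Polynomial.eval_C,
        Polynomial.eval_pow, Polynomial.eval_X]
      rw [add_sq, mul_pow] at hx3
      rw [hx4] at hx3 ⊢
      linarith
    exact this
  exact gammaMeasure_absolutelyContinuous a 1 (hsub.measure_zero volume)

theorem symmDirichlet_hellinger_level_null {f : ℝ → ℝ} {c C : ℝ} (hf : BoundedDensity f c C)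
    {k : ℕ} (hk : 2 ≤ k) {a : ℝ} (ha : 0 < a) (r : ℝ) :
    symmDirichlet k a {θ | hellinger f (hist θ) = r} = 0 := by
  have hk1 : 1 ≤ k := by omega
  rw [symmDirichlet_apply (measurableSet_eq_fun (hf.measurable_hellinger_hist hk1)
    measurable_const)]
  refine measure_mono_null_ae ?_
    (gammaProd_level_null hk ha (hf.rootMass_pos (k := k)) (1 - r ^ 2 / 2))
  filter_upwards [ae_pos_gammaProd k ha] with γ hγ h
  refine ⟨hγ, ?_⟩
  have h1 := hf.hellinger_sq hk1 (normalize_mem_stdSimplex hk1 hγ)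
  have h2 : hellinger f (hist fun j => γ j / ∑ i, γ i) = r := h
  rw [h2] at h1
  linarith

/-! ### Lower bounds for the prior mass -/

/-- Count of the powers of 1/n: two from the length p/n ≥ c/n² of the interval, |H| from the lower
bound on the shape, A from the density at the left end, and one more absorbs the constant. -/
theorem le_gammaMeasure_rpow {a G A H α c : ℝ} (ha : 0 < a) (hA : 0 < A) (hG : 0 < G) (hc : 0 < c)
    {n k : ℕ} (hk : 1 ≤ k) (hkn : k ≤ n) (hn : 2 ≤ n)
    (hκ : (c * (a / G) * (c / 2) ^ A * Real.exp (-1))⁻¹ ≤ n)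
    (hα : a * (k : ℝ) ^ (-H) ≤ α) (hαA : α ≤ A) (hGα : Real.Gamma (α + 1) ≤ G) {p : ℝ}
    (hp : c / k ≤ p) (hp1 : p ≤ 1) :
    ENNReal.ofReal ((n : ℝ) ^ (-(3 + |H| + A))) ≤
      gammaMeasure α 1 (Icc ((1 - 1 / n) * p) p) := by
  have hk0 : (0 : ℝ) < k := by exact_mod_cast hk
  have hk1 : (1 : ℝ) ≤ k := by exact_mod_cast hk
  have hkn' : (k : ℝ) ≤ n := by exact_mod_cast hkn
  have hn2 : (2 : ℝ) ≤ n := by exact_mod_cast hn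
  have hn0 : (0 : ℝ) < n := by linarith
  have hαpos : 0 < α := (mul_pos ha (Real.rpow_pos_of_pos hk0 _)).trans_le hα
  have hcn : c / n ≤ p := le_trans (by gcongr) hp
  have hp0 : 0 < p := (div_pos hc hn0).trans_le hcn
  have hhalf : (1 : ℝ) / 2 ≤ 1 - 1 / n := by
    have : (1 : ℝ) / n ≤ 1 / 2 := by gcongr
    linarith
  have hl : c / 2 / n ≤ (1 - 1 / n) * p := by
    calc c / 2 / n = 1 / 2 * (c / n) := by ring
      _ ≤ _ := by gcongr
  have hl0 : 0 < (1 - 1 / (n : ℝ)) * p := (by positivity : 0 < c / 2 / n).trans_le hl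
  refine le_trans (ENNReal.ofReal_le_ofReal ?_) (le_gammaMeasure_Icc hαpos hαA hGα hl0 hp1)
  have h1 : c / n / n ≤ p - (1 - 1 / n) * p := by
    have : p - (1 - 1 / n) * p = p / n := by ring
    rw [this]; gcongr
  have h1' : 0 ≤ p - (1 - 1 / (n : ℝ)) * p := le_trans (by positivity) h1
  have h2 : a * (n : ℝ) ^ (-|H|) / G ≤ α / G := by
    refine div_le_div_of_nonneg_right (le_trans ?_ hα) hG.le
    gcongr a * ?_
    exact (Real.rpow_le_rpow_of_nonpos hk0 hkn' (by simp)).trans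
      (Real.rpow_le_rpow_of_exponent_le hk1 (by linarith [le_abs_self H]))
  have h3 : (c / 2) ^ A * (n : ℝ) ^ (-A) ≤ ((1 - 1 / n) * p) ^ A := by
    rw [Real.rpow_neg hn0.le, ← div_eq_mul_inv, ← Real.div_rpow (by positivity) hn0.le]
    exact Real.rpow_le_rpow (by positivity) hl hA.le
  have h4 : (n : ℝ) ^ (-(3 + |H| + A)) =
      (n : ℝ)⁻¹ * ((n : ℝ)⁻¹ * (n : ℝ)⁻¹ * (n : ℝ) ^ (-|H|) * (n : ℝ) ^ (-A)) := by
    have : (n : ℝ)⁻¹ = (n : ℝ) ^ (-1 : ℝ) := (Real.rpow_neg_one _).symm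
    rw [this, ← Real.rpow_add hn0, ← Real.rpow_add hn0, ← Real.rpow_add hn0, ← Real.rpow_add hn0]
    ring_nf
  calc (n : ℝ) ^ (-(3 + |H| + A))
      ≤ (c * (a / G) * (c / 2) ^ A * Real.exp (-1)) *
          ((n : ℝ)⁻¹ * (n : ℝ)⁻¹ * (n : ℝ) ^ (-|H|) * (n : ℝ) ^ (-A)) := by
        rw [h4]
        have := inv_le_of_inv_le₀ (by positivity) hκ
        gcongr
    _ = (c / n / n) *
          (a * (n : ℝ) ^ (-|H|) / G * ((c / 2) ^ A * (n : ℝ) ^ (-A)) * Real.exp (-1)) := by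
        field_simp
    _ ≤ _ := by gcongr

theorem measurableSet_le_coord {k : ℕ} (l : Fin k → ℝ) :
    MeasurableSet {θ : Fin k → ℝ | ∀ j, l j ≤ θ j} := by
  rw [ofPred_forall]
  exact MeasurableSet.iInter fun j => measurableSet_le measurable_const (measurable_pi_apply j)

/-- The Dirichlet prior gives mass at least `exp (-B k log n)` to the vectors that are not much
smaller than a given vector with coordinates of the order `1 / k`. -/
theorem exists_le_symmDirichlet {α : ℕ → ℝ} {A a H c : ℝ} (ha : 0 < a)
    (hα : ∀ k : ℕ, 1 ≤ k → a * (k : ℝ) ^ (-H) ≤ α k ∧ α k ≤ A) (hc : 0 < c) :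
    ∃ (B : ℝ) (N : ℕ), 0 < B ∧ ∀ n k : ℕ, N ≤ n → 1 ≤ k → k ≤ n →
      ∀ p ∈ stdSimplex ℝ (Fin k), (∀ j, c / k ≤ p j) →
        Real.exp (-(B * k * Real.log n)) ≤
          (symmDirichlet k (α k)).real {θ | ∀ j, (1 - 1 / n) * p j ≤ θ j} := by
  have hA : 0 < A := by
    have := hα 1 le_rfl
    simp only [Nat.cast_one, Real.one_rpow, mul_one] at this
    linarith
  obtain ⟨_, G, _, hG, hGa⟩ := exists_bounds_Gamma_add_one A
  set κ := c * (a / G) * (c / 2) ^ A * Real.exp (-1)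
  refine ⟨3 + |H| + A, max 2 ⌈κ⁻¹⌉₊, by positivity, fun n k hn hk hkn p hp hpc => ?_⟩
  have hk0 : (0 : ℝ) < k := by exact_mod_cast hk
  have hn2 : 2 ≤ n := (le_max_left _ _).trans hn
  have hn2' : (2 : ℝ) ≤ n := by exact_mod_cast hn2
  have hn0 : (0 : ℝ) < n := by positivity
  have hκn : κ⁻¹ ≤ n := (Nat.le_ceil _).trans (by exact_mod_cast (le_max_right _ _).trans hn)
  have hαpos : 0 < α k := (mul_pos ha (Real.rpow_pos_of_pos hk0 _)).trans_le (hα k hk).1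
  have := isProbabilityMeasure_gammaMeasure hαpos one_pos
  have := isProbabilityMeasure_symmDirichlet k hαpos
  have hp1 : ∀ j, p j ≤ 1 := fun j => by
    rw [← hp.2]
    exact Finset.single_le_sum (fun i _ => hp.1 i) (Finset.mem_univ j)
  have hδ : (1 : ℝ) / n < 1 := by rw [div_lt_one hn0]; linarith
  have hpp : ∀ j, 0 < (1 - 1 / n) * p j := fun j =>
    mul_pos (by linarith) ((div_pos hc hk0).trans_le (hpc j))
  -- Gamma variables in these intervals have a sum at most one, so that normalization only increases
  -- them. Independence then gives a product bound.
  have hsub : Set.pi univ (fun j => Icc ((1 - 1 / n) * p j) (p j)) ⊆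
      {γ | (fun j => γ j / ∑ i, γ i) ∈ {θ : Fin k → ℝ | ∀ j, (1 - 1 / n) * p j ≤ θ j}} := by
    intro γ hγ j
    have hγ' : ∀ i, 0 < γ i := fun i => (hpp i).trans_le (hγ i (mem_univ i)).1
    have hS : ∑ i, γ i ≤ 1 := by
      rw [← hp.2]
      exact Finset.sum_le_sum fun i _ => (hγ i (mem_univ i)).2
    have hS0 : 0 < ∑ i, γ i := Finset.sum_pos (fun i _ => hγ' i) ⟨j, Finset.mem_univ _⟩
    refine (hγ j (mem_univ j)).1.trans ?_
    rw [le_div_iff₀ hS0]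
    nlinarith [hγ' j]
  rw [measureReal_def, ← ENNReal.ofReal_le_iff_le_toReal (measure_ne_top _ _),
    symmDirichlet_apply (measurableSet_le_coord _)]
  refine le_trans ?_ (measure_mono hsub)
  rw [gammaProd, Measure.pi_pi]
  calc ENNReal.ofReal (Real.exp (-((3 + |H| + A) * k * Real.log n)))
      = ∏ _j : Fin k, ENNReal.ofReal ((n : ℝ) ^ (-(3 + |H| + A))) := by
        rw [Finset.prod_const, Finset.card_univ, Fintype.card_fin, ← ENNReal.ofReal_pow
          (by positivity), ← Real.rpow_natCast, ← Real.rpow_mul hn0.le, Real.rpow_def_of_pos hn0]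
        ring_nf
    _ ≤ _ := Finset.prod_le_prod' fun j _ => le_gammaMeasure_rpow ha hA hG hc hk hkn hn2 hκn
        (hα k hk).1 (hα k hk).2 (hGa _ hαpos (hα k hk).2).2 (hpc j) (hp1 j)

/-! ### Upper bounds for the prior mass of Hellinger balls -/

/-- The independent variables are proportional to given numbers up to a relative error, on a set
`J` of coordinates, with small probability. -/
theorem gammaProd_ratio_le {a G : ℝ} (ha : 0 < a) (hG : 0 < G)
    (h : ∀ y, 0 < y → gammaPDFReal a 1 y ≤ G / y) {k : ℕ} (J : Finset (Fin k)) {j₀ : Fin k}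
    (hj₀ : j₀ ∈ J) {l u : Fin k → ℝ} (hl : ∀ j, 0 < l j) {q : ℝ}
    (hq : ∀ j, G * (u j / l j - 1) ≤ q) :
    gammaProd k a {γ | 0 < γ j₀ ∧ ∀ j ∈ J.erase j₀, γ j ∈ Icc (γ j₀ * l j) (γ j₀ * u j)} ≤
      ENNReal.ofReal q ^ (J.card - 1) := by
  obtain ⟨n, rfl⟩ : ∃ n, k = n + 1 := ⟨k - 1, by have := j₀.pos; omega⟩
  have := isProbabilityMeasure_gammaMeasure ha one_pos
  set E : Set (Fin (n + 1) → ℝ) :=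
    {γ | 0 < γ j₀ ∧ ∀ j ∈ J.erase j₀, γ j ∈ Icc (γ j₀ * l j) (γ j₀ * u j)}
  have hE : MeasurableSet E := by
    have h0 : MeasurableSet {γ : Fin (n + 1) → ℝ | 0 < γ j₀} :=
      measurableSet_lt measurable_const (measurable_pi_apply _)
    have h1 : MeasurableSet {γ : Fin (n + 1) → ℝ |
        ∀ j, j ∈ J.erase j₀ → γ j ∈ Icc (γ j₀ * l j) (γ j₀ * u j)} := by
      rw [ofPred_forall]
      refine MeasurableSet.iInter fun j => ?_
      rw [ofPred_forall]
      refine MeasurableSet.iInter fun _ => ?_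
      exact (measurableSet_le (f := fun γ : Fin (n + 1) → ℝ => γ j₀ * l j) (by fun_prop)
        (measurable_pi_apply j)).inter
        (measurableSet_le (g := fun γ : Fin (n + 1) → ℝ => γ j₀ * u j)
          (measurable_pi_apply j) (by fun_prop))
    exact h0.inter h1
  have hmp := measurePreserving_piFinSuccAbove (fun _ : Fin (n + 1) => gammaMeasure a 1) j₀
  set e := MeasurableEquiv.piFinSuccAbove (fun _ : Fin (n + 1) => ℝ) j₀
  have hE' : MeasurableSet (e.symm ⁻¹' E) := e.symm.measurable hE
  have h1 := hmp.measure_preimage hE'.nullMeasurableSet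
  have h2 : e ⁻¹' (e.symm ⁻¹' E) = E := by ext; simp
  have he0 : ∀ x y, e.symm (x, y) j₀ = x := fun x y =>
    Fin.insertNth_apply_same (α := fun _ => ℝ) j₀ x y
  have he1 : ∀ x y i, e.symm (x, y) (j₀.succAbove i) = y i := fun x y i =>
    Fin.insertNth_apply_succAbove (α := fun _ => ℝ) j₀ x y i
  -- Conditioning on γ_{j₀} = x leaves independent coordinates, and the bound for the window [x l_j,
  -- x u_j] does not depend on x.
  rw [gammaProd, ← h2, h1, Measure.prod_apply hE']
  refine (lintegral_mono (g := fun _ => ENNReal.ofReal q ^ (J.card - 1)) fun x => ?_).trans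
    (by simp)
  rcases le_or_gt x 0 with hx | hx
  · have : Prod.mk x ⁻¹' (e.symm ⁻¹' E) = ∅ := by
      refine eq_empty_of_forall_notMem fun y hy => hx.not_gt ?_
      have := hy.1
      rwa [he0] at this
    simp [this]
  have hsub : Prod.mk x ⁻¹' (e.symm ⁻¹' E) ⊆ Set.pi univ fun i =>
      if j₀.succAbove i ∈ J.erase j₀ then
        Icc (x * l (j₀.succAbove i)) (x * u (j₀.succAbove i)) else univ := by
    intro y hy i _
    simp only
    split_ifs with hi
    · have := hy.2 _ hi
      rwa [he0, he1] at this
    · trivial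
  refine (measure_mono hsub).trans ?_
  rw [Measure.pi_pi]
  calc _ ≤ ∏ i, (if j₀.succAbove i ∈ J.erase j₀ then ENNReal.ofReal q else 1) := by
        refine Finset.prod_le_prod' fun i _ => ?_
        split_ifs with hi
        · refine (gammaMeasure_Icc_le hG h (mul_pos hx (hl _))).trans
            (ENNReal.ofReal_le_ofReal ?_)
          rw [mul_div_mul_left _ _ hx.ne']
          exact hq _
        · exact prob_le_one
    _ = ∏ j, (if j ∈ J.erase j₀ then ENNReal.ofReal q else 1) := by
        rw [Fin.prod_univ_succAbove _ j₀]; simp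
    _ = ENNReal.ofReal q ^ (J.card - 1) := by
        rw [Finset.prod_ite_mem, Finset.univ_inter, Finset.prod_const,
          Finset.card_erase_of_mem hj₀]

theorem ratio_pow_four_le {s : ℝ} (h0 : 0 ≤ s) (h1 : s ≤ 1 / 2) :
    ((1 + s) / (1 - s)) ^ 4 - 1 ≤ 160 * s := by
  have h2 : (1 + s) / (1 - s) ≤ 1 + 4 * s := by
    rw [div_le_iff₀ (by linarith)]; nlinarith
  have h3 : ((1 + s) / (1 - s)) ^ 4 ≤ (1 + 4 * s) ^ 4 := by
    have : 0 ≤ (1 + s) / (1 - s) := div_nonneg (by linarith) (by linarith)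
    gcongr
  -- The expansion is 1 + 16s + 96s² + 256s³ + 256s⁴, and for s ≤ 1/2 the coefficients add up to 16
  -- + 48 + 64 + 32.
  have h4 : (1 + 4 * s) ^ 4 ≤ 1 + 160 * s := by
    have : s ^ 2 ≤ s / 2 := by nlinarith
    have : s ^ 3 ≤ s / 4 := by nlinarith
    have : s ^ 4 ≤ s / 8 := by nlinarith [pow_nonneg h0 3]
    nlinarith
  linarith

/-- A Dirichlet vector is, on a set `J` of coordinates, within a relative error of a given vector
with small probability. -/
theorem gammaProd_close_le {a G : ℝ} (ha : 0 < a) (hG : 0 < G)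
    (h : ∀ y, 0 < y → gammaPDFReal a 1 y ≤ G / y) {k : ℕ} (J : Finset (Fin k))
    (hJ : J.Nonempty) {v : Fin k → ℝ} (hv : ∀ j, 0 < v j) {s : ℝ} (hs0 : 0 ≤ s)
    (hs : s ≤ 1 / 2) :
    gammaProd k a {γ | (∀ j, 0 < γ j) ∧
        ∀ j ∈ J, |√(γ j / ∑ i, γ i) - v j| ≤ s * v j} ≤
      ENNReal.ofReal (160 * G * s) ^ (J.card - 1) := by
  obtain ⟨j₀, hj₀⟩ := hJ
  have hs1 : 0 < 1 - s := by linarith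
  have hs2 : 0 < 1 + s := by linarith
  -- Dividing by the reference coordinate cancels the random sum. The windows are squared because
  -- closeness is measured on square roots; with two factors (1 + s)/(1 - s) from each quotient,
  -- u_j/l_j is their fourth power.
  set l : Fin k → ℝ := fun j => ((1 - s) * v j / ((1 + s) * v j₀)) ^ 2
  set u : Fin k → ℝ := fun j => ((1 + s) * v j / ((1 - s) * v j₀)) ^ 2
  have hl : ∀ j, 0 < l j := fun j => by
    have := hv j; have := hv j₀; positivity
  refine le_trans (measure_mono ?_) (gammaProd_ratio_le ha hG h J hj₀ (l := l) (u := u) hl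
    (q := 160 * G * s) fun j => ?_)
  · rintro γ ⟨hγ, hclose⟩
    refine ⟨hγ j₀, fun j hj => ?_⟩
    have hS : 0 < ∑ i, γ i := Finset.sum_pos (fun i _ => hγ i) ⟨j₀, Finset.mem_univ _⟩
    have hb : ∀ j ∈ J, ((1 - s) * v j) ^ 2 ≤ γ j / ∑ i, γ i ∧
        γ j / ∑ i, γ i ≤ ((1 + s) * v j) ^ 2 := fun j hj => by
      have h1 := abs_le.1 (hclose j hj)
      have h2 : 0 ≤ γ j / ∑ i, γ i := (div_pos (hγ j) hS).le
      have h3 := hv j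
      rw [← Real.sq_sqrt h2]
      constructor
      · gcongr; linarith [h1.1]
      · gcongr; linarith [h1.2]
    have h0 := hb j₀ hj₀
    have hj' := hb j (Finset.mem_of_mem_erase hj)
    have hvj := hv j
    have hv0 := hv j₀
    simp only [l, u, div_pow]
    rw [le_div_iff₀ hS, div_le_iff₀ hS] at h0 hj'
    constructor
    · rw [mul_div_assoc', div_le_iff₀ (by positivity)]
      calc γ j₀ * ((1 - s) * v j) ^ 2
          ≤ (((1 + s) * v j₀) ^ 2 * ∑ i, γ i) * ((1 - s) * v j) ^ 2 := by gcongr; exact h0.2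
        _ = ((1 + s) * v j₀) ^ 2 * (((1 - s) * v j) ^ 2 * ∑ i, γ i) := by ring
        _ ≤ ((1 + s) * v j₀) ^ 2 * γ j := by gcongr; exact hj'.1
        _ = _ := by ring
    · rw [mul_div_assoc', le_div_iff₀ (by positivity)]
      calc γ j * ((1 - s) * v j₀) ^ 2
          ≤ (((1 + s) * v j) ^ 2 * ∑ i, γ i) * ((1 - s) * v j₀) ^ 2 := by gcongr; exact hj'.2
        _ = ((1 + s) * v j) ^ 2 * (((1 - s) * v j₀) ^ 2 * ∑ i, γ i) := by ring
        _ ≤ ((1 + s) * v j) ^ 2 * γ j₀ := by gcongr; exact h0.1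
        _ = _ := by ring
  · have h1 : u j / l j = ((1 + s) / (1 - s)) ^ 4 := by
      have := hv j; have := hv j₀
      simp only [u, l]
      field_simp
    rw [h1]
    have := ratio_pow_four_le hs0 hs
    nlinarith

/-- The prior mass of a Hellinger ball of radius `r` is at most `2 ^ k (G r) ^ (k / 4)`. -/
theorem exists_symmDirichlet_hellingerBall_le {f : ℝ → ℝ} {c C : ℝ} (hf : BoundedDensity f c C)
    (A : ℝ) :
    ∃ G : ℝ, 0 < G ∧ ∀ k : ℕ, 2 ≤ k → ∀ a, 0 < a → a ≤ A → ∀ r, 0 < r →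
      (symmDirichlet k a).real (hellingerBall f k r) ≤ 2 ^ k * (G * r) ^ ((k : ℝ) / 4) := by
  obtain ⟨G₁, hG₁, hG⟩ := exists_gammaPDFReal_le A
  have hsc : 0 < √c := Real.sqrt_pos.2 hf.pos
  refine ⟨(320 * G₁ + 4) / √c, by positivity, fun k hk a ha haA r hr => ?_⟩
  have hk1 : 1 ≤ k := by omega
  have hk0 : (0 : ℝ) < k := by exact_mod_cast hk1
  have := isProbabilityMeasure_symmDirichlet k ha
  have := isProbabilityMeasure_gammaProd k ha
  -- If G r ≥ 1 the bound is trivial. Otherwise the choice of G makes s ≤ 1/2.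
  rcases le_or_gt 1 ((320 * G₁ + 4) / √c * r) with h1 | h1
  · refine measureReal_le_one.trans ?_
    have h2 : (1 : ℝ) ≤ 2 ^ k := one_le_pow₀ (by norm_num)
    have h3 := Real.one_le_rpow h1 (by positivity : (0 : ℝ) ≤ (k : ℝ) / 4)
    nlinarith
  -- A coordinate with relative error above s contributes more than s²c/k = 4r²/k to the squared
  -- distance, so at most k/4 coordinates do. The factor 2^k below counts the possible sets of the
  -- others.
  set s := 2 * r / √c
  have hs0 : 0 < s := by positivity
  have hGs : 160 * G₁ * s + 2 * s < 1 := by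
    calc 160 * G₁ * s + 2 * s = (320 * G₁ + 4) / √c * r := by simp only [s]; ring
      _ < 1 := h1
  have hG1s : 0 < G₁ * s := by positivity
  have hs : s ≤ 1 / 2 := by linarith
  set v := rootMass f k
  have hv : ∀ j, 0 < v j := hf.rootMass_pos
  set E : Finset (Fin k) → Set (Fin k → ℝ) := fun J =>
    {γ | (∀ j, 0 < γ j) ∧ ∀ j ∈ J, |√(γ j / ∑ i, γ i) - v j| ≤ s * v j}
  set 𝒥 := (Finset.univ : Finset (Finset (Fin k))).filter fun J => 3 * k ≤ 4 * J.card
  have hsub : ∀ᵐ γ ∂gammaProd k a, (fun j => γ j / ∑ i, γ i) ∈ hellingerBall f k r →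
      γ ∈ ⋃ J ∈ 𝒥, E J := by
    filter_upwards [ae_pos_gammaProd k ha] with γ hγ hball
    set θ : Fin k → ℝ := fun j => γ j / ∑ i, γ i
    have hθ := normalize_mem_stdSimplex hk1 hγ
    have h2 : ∑ j, (√(θ j) - v j) ^ 2 ≤ r ^ 2 := by
      have h3 := hf.hellinger_sq_eq_biasSq_add hk1 hθ
      have h4 : hellinger f (hist θ) ^ 2 ≤ r ^ 2 :=
        pow_le_pow_left₀ (BoundedDensity.hellinger_nonneg _ _) hball 2
      have h5 := biasSq_nonneg f k
      linarith
    set J := (Finset.univ : Finset (Fin k)).filter fun j => |√(θ j) - v j| ≤ s * v j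
    refine mem_iUnion₂.2 ⟨J, ?_, hγ, fun j hj => (Finset.mem_filter.1 hj).2⟩
    refine Finset.mem_filter.2 ⟨Finset.mem_univ _, ?_⟩
    set J' := (Finset.univ : Finset (Fin k)).filter fun j => ¬ |√(θ j) - v j| ≤ s * v j
    have hcard : J.card + J'.card = k := by
      have := Finset.card_filter_add_card_filter_not (s := (Finset.univ : Finset (Fin k)))
        fun j => |√(θ j) - v j| ≤ s * v j
      rwa [Finset.card_univ, Fintype.card_fin] at this
    have h6 : J'.card * (4 * r ^ 2 / k) ≤ r ^ 2 := by
      refine le_trans ?_ h2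
      rw [← nsmul_eq_mul, ← Finset.sum_const]
      refine le_trans (Finset.sum_le_sum fun j hj => ?_)
        (Finset.sum_le_univ_sum_of_nonneg (s := J') fun j => sq_nonneg _)
      have h7 : s * v j < |√(θ j) - v j| := not_le.1 (Finset.mem_filter.1 hj).2
      rw [← sq_abs (√(θ j) - v j)]
      have h8 := hv j
      calc 4 * r ^ 2 / k = s ^ 2 * (c / k) := by
            simp only [s]
            rw [div_pow, Real.sq_sqrt hf.pos.le]
            have := hf.pos
            field_simp
            ring
        _ ≤ s ^ 2 * v j ^ 2 := by gcongr; exact hf.rootMass_sq_ge j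
        _ = (s * v j) ^ 2 := by ring
        _ ≤ _ := by gcongr
    have h9 : (4 * J'.card : ℝ) ≤ k := by
      rw [← mul_div_assoc, div_le_iff₀ hk0] at h6
      have : 0 < r ^ 2 := by positivity
      nlinarith
    have h10 : 4 * J'.card ≤ k := by exact_mod_cast h9
    omega
  have hE : ∀ J ∈ 𝒥, (gammaProd k a).real (E J) ≤ ((320 * G₁ + 4) / √c * r) ^ ((k : ℝ) / 4) := by
    intro J hJ
    have hJc : 3 * k ≤ 4 * J.card := (Finset.mem_filter.1 hJ).2
    have hne : J.Nonempty := Finset.card_pos.1 (by omega)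
    have h2 := gammaProd_close_le ha hG₁ (hG a ha haA) J hne hv hs0.le hs
    rw [← ENNReal.ofReal_pow (by positivity)] at h2
    refine (ENNReal.toReal_le_of_le_ofReal (by positivity) h2).trans ?_
    rw [← Real.rpow_natCast]
    -- One coordinate of J is spent as the reference; 3k/4 - 1 ≥ k/4 because k ≥ 2.
    have h3 : (k : ℝ) / 4 ≤ (J.card - 1 : ℕ) := by
      have : k ≤ (J.card - 1) * 4 := by omega
      rw [div_le_iff₀ (by norm_num)]
      exact_mod_cast this
    refine (Real.rpow_le_rpow_of_exponent_ge (by positivity) (by linarith) h3).trans ?_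
    refine Real.rpow_le_rpow (by positivity) ?_ (by positivity)
    calc 160 * G₁ * s ≤ 160 * G₁ * s + 2 * s := by linarith
      _ = _ := by simp only [s]; ring
  calc (symmDirichlet k a).real (hellingerBall f k r)
      = (gammaProd k a).real {γ | (fun j => γ j / ∑ i, γ i) ∈ hellingerBall f k r} := by
        rw [measureReal_def, symmDirichlet_apply (hf.measurableSet_hellingerBall hk1 r),
          measureReal_def]
    _ ≤ (gammaProd k a).real (⋃ J ∈ 𝒥, E J) :=
        ENNReal.toReal_mono (measure_ne_top _ _) (measure_mono_ae hsub)
    _ ≤ ∑ J ∈ 𝒥, (gammaProd k a).real (E J) := measureReal_biUnion_finset_le _ _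
    _ ≤ ∑ _J ∈ 𝒥, ((320 * G₁ + 4) / √c * r) ^ ((k : ℝ) / 4) := Finset.sum_le_sum hE
    _ ≤ 2 ^ k * ((320 * G₁ + 4) / √c * r) ^ ((k : ℝ) / 4) := by
        rw [Finset.sum_const, nsmul_eq_mul]
        have h2 : 𝒥.card ≤ 2 ^ k := by
          refine (Finset.card_le_univ _).trans ?_
          simp
        have h3 : (𝒥.card : ℝ) ≤ 2 ^ k := by exact_mod_cast h2
        gcongr

/-- The prior mass of Hellinger balls of squared radius of the order `k log (n / k) / n`. -/
theorem exists_symmDirichlet_hellingerBall_le_exp {f : ℝ → ℝ} {c C : ℝ}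
    (hf : BoundedDensity f c C) (A : ℝ) {R : ℝ} (hR : 0 < R) :
    ∃ T : ℝ, 1 < T ∧ ∀ n k : ℕ, 2 ≤ k → T * k ≤ n → ∀ a, 0 < a → a ≤ A →
      (symmDirichlet k a).real (hellingerBall f k √(R * (k * Real.log (n / k)) / n)) ≤
        Real.exp (-(k * Real.log (n / k) / 32)) := by
  obtain ⟨G, hG, h⟩ := exists_symmDirichlet_hellingerBall_le hf A
  -- With y = n/k, log(Gr)/4 is at most a constant minus log y / 16. Half of this remains in the
  -- result, and log y ≥ t makes the other half absorb the constants.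
  set t := 32 * (Real.log 2 + |Real.log (2 * G ^ 2 * R)| / 8)
  have hlog2 : 0 < Real.log 2 := Real.log_pos (by norm_num)
  have ht : 0 < t := by positivity
  refine ⟨Real.exp t, Real.one_lt_exp_iff.2 ht, fun n k hk hTk a ha haA => ?_⟩
  have hk0 : (0 : ℝ) < k := by exact_mod_cast (by omega : 0 < k)
  have hn0 : (0 : ℝ) < n := (mul_pos (Real.exp_pos _) hk0).trans_le hTk
  set y : ℝ := n / k
  have hy : Real.exp t ≤ y := (le_div_iff₀ hk0).2 hTk
  have hy0 : 0 < y := (Real.exp_pos _).trans_le hy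
  have hly : t ≤ Real.log y := (Real.le_log_iff_exp_le hy0).2 hy
  have hlypos : 0 < Real.log y := ht.trans_le hly
  have hr2 : R * (k * Real.log y) / n = R * (Real.log y / y) := by
    simp only [y]; field_simp
  have hr : 0 < √(R * (k * Real.log y) / n) := by
    rw [hr2]; positivity
  refine (h k hk a ha haA _ hr).trans ?_
  rw [hr2]
  set r := √(R * (Real.log y / y))
  have hr0 : 0 < r := Real.sqrt_pos.2 (by positivity)
  -- The logarithm in r² = R log y / y costs at most half of the power of y.
  have hll : Real.log (Real.log y) ≤ Real.log 2 + Real.log y / 2 := by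
    have h1 : Real.log y ≤ 2 * √y := by
      have := Real.log_le_sub_one_of_pos (Real.sqrt_pos.2 hy0)
      rw [Real.log_sqrt hy0.le] at this
      linarith
    have h2 := Real.log_le_log hlypos h1
    rwa [Real.log_mul two_ne_zero (Real.sqrt_pos.2 hy0).ne', Real.log_sqrt hy0.le] at h2
  have hlr : Real.log (G * r) ≤ |Real.log (2 * G ^ 2 * R)| / 2 - Real.log y / 4 := by
    have h1 : Real.log (2 * G ^ 2 * R) = Real.log 2 + 2 * Real.log G + Real.log R := by
      rw [Real.log_mul (by positivity) hR.ne', Real.log_mul two_ne_zero (by positivity),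
        Real.log_pow]
      norm_num
    have h2 : Real.log (G * r) = Real.log G + (Real.log R +
        (Real.log (Real.log y) - Real.log y)) / 2 := by
      rw [Real.log_mul hG.ne' hr0.ne', Real.log_sqrt (by positivity),
        Real.log_mul hR.ne' (by positivity), Real.log_div hlypos.ne' hy0.ne']
    have h3 := le_abs_self (Real.log (2 * G ^ 2 * R))
    linarith
  rw [Real.rpow_def_of_pos (by positivity), ← Real.exp_log (by positivity : (0 : ℝ) < 2 ^ k),
    Real.log_pow, ← Real.exp_add]
  refine Real.exp_le_exp.2 ?_
  have h4 : Real.log 2 + Real.log (G * r) / 4 + Real.log y / 32 ≤ 0 := by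
    simp only [t] at hly
    linarith
  nlinarith

/-! ### The radius `ε_n(k)` -/

theorem pos_of_rpow_le {α : ℕ → ℝ} {A a H : ℝ} (ha : 0 < a)
    (hα : ∀ k : ℕ, 1 ≤ k → a * (k : ℝ) ^ (-H) ≤ α k ∧ α k ≤ A) {k : ℕ} (hk : 1 ≤ k) :
    0 < α k :=
  (mul_pos ha (Real.rpow_pos_of_pos (by exact_mod_cast hk) _)).trans_le (hα k hk).1

theorem hellingerBall_mono (f : ℝ → ℝ) (k : ℕ) {r s : ℝ} (h : r ≤ s) :
    hellingerBall f k r ⊆ hellingerBall f k s := fun _ hθ => le_trans hθ h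

theorem symmDirichlet_hellingerBall_of_two_le (hf : BoundedDensity f c C) {k : ℕ} (hk : 1 ≤ k)
    {a : ℝ} (ha : 0 < a) {r : ℝ} (hr : 2 ≤ r) :
    (symmDirichlet k a).real (hellingerBall f k r) = 1 := by
  have := isProbabilityMeasure_symmDirichlet k ha
  have : symmDirichlet k a (hellingerBall f k r) = 1 := by
    rw [prob_compl_eq_zero_iff (hf.measurableSet_hellingerBall hk r) |>.symm]
    refine measure_mono_null_ae ?_ (measure_empty (μ := symmDirichlet k a))
    filter_upwards [ae_mem_stdSimplex hk ha] with θ hθ hθ'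
    have h1 := hf.hellinger_sq_le_two hk hθ
    have h2 : r < hellinger f (hist θ) := not_le.1 hθ'
    nlinarith
  rw [measureReal_def, this, ENNReal.toReal_one]

theorem continuous_cdf_of_null {μ : Measure ℝ} [IsProbabilityMeasure μ] (h : ∀ x, μ {x} = 0) :
    Continuous (cdf μ) := by
  rw [continuous_iff_continuousAt]
  intro x
  rw [(monotone_cdf μ).continuousAt_iff_leftLim_eq_rightLim, (cdf μ).rightLim_eq]
  have h1 := (cdf μ).measure_singleton x
  rw [measure_cdf, h x] at h1
  have h2 := ENNReal.ofReal_eq_zero.1 h1.symm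
  exact le_antisymm ((monotone_cdf μ).leftLim_le le_rfl) (by linarith)

theorem continuous_symmDirichlet_hellingerBall (hf : BoundedDensity f c C) {k : ℕ} (hk : 2 ≤ k)
    {a : ℝ} (ha : 0 < a) :
    Continuous fun r => (symmDirichlet k a).real (hellingerBall f k r) := by
  have := isProbabilityMeasure_symmDirichlet k ha
  have hm := hf.measurable_hellinger_hist (k := k) (by omega)
  have : IsProbabilityMeasure ((symmDirichlet k a).map fun θ => hellinger f (hist θ)) :=
    Measure.isProbabilityMeasure_map hm.aemeasurable
  have h1 : (fun r => (symmDirichlet k a).real (hellingerBall f k r)) =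
      cdf ((symmDirichlet k a).map fun θ => hellinger f (hist θ)) := by
    funext r
    rw [cdf_eq_real, measureReal_def, measureReal_def, Measure.map_apply hm measurableSet_Iic]
    rfl
  rw [h1]
  refine continuous_cdf_of_null fun x => ?_
  rw [Measure.map_apply hm (measurableSet_singleton x)]
  exact symmDirichlet_hellinger_level_null hf hk ha x

theorem exp_neg_mul_sq_lt {n : ℕ} (hn : 1 ≤ n) {x y : ℝ} (hx : 0 ≤ x) (hxy : x < y) :
    Real.exp (-(n * y ^ 2)) < Real.exp (-(n * x ^ 2)) := by
  have hn' : (0 : ℝ) < n := by exact_mod_cast hn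
  have : x ^ 2 < y ^ 2 := by gcongr
  refine Real.exp_lt_exp.2 ?_
  nlinarith

section Radius

variable {α : ℕ → ℝ} {K : ℝ} {n k : ℕ}

theorem epsRadius_nonneg (f : ℝ → ℝ) (α : ℕ → ℝ) (K : ℝ) (n k : ℕ) : 0 ≤ epsRadius f α K n k :=
  Real.sInf_nonneg fun _ h => h.1

theorem epsRadius_le {ε : ℝ} (h0 : 0 ≤ ε)
    (h : Real.exp (-(n * ε ^ 2)) ≤ (symmDirichlet k (α k)).real (hellingerBall f k (K * ε))) :
    epsRadius f α K n k ≤ ε :=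
  csInf_le ⟨0, fun _ h => h.1⟩ ⟨h0, h⟩

/-- The set in the definition of the radius contains 2/K, so its infimum is not the default value
for the empty set. -/
theorem le_epsRadius (hf : BoundedDensity f c C) (hK : 0 < K) (hk : 1 ≤ k) (hα : 0 < α k) {ε : ℝ}
    (h : ∀ δ, 0 ≤ δ → Real.exp (-(n * δ ^ 2)) ≤
      (symmDirichlet k (α k)).real (hellingerBall f k (K * δ)) → ε ≤ δ) :
    ε ≤ epsRadius f α K n k := by
  refine le_csInf ⟨2 / K, by positivity, ?_⟩ fun δ hδ => h δ hδ.1 hδ.2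
  rw [symmDirichlet_hellingerBall_of_two_le hf hk hα (by field_simp; rfl)]
  refine Real.exp_le_one_iff.2 ?_
  have : 0 ≤ (n : ℝ) * (2 / K) ^ 2 := by positivity
  linarith

/-- The radius is the unique solution of its defining equation. -/
theorem eq_epsRadius_iff (hf : BoundedDensity f c C) (hK : 0 < K) (hn : 1 ≤ n) (hk : 2 ≤ k)
    (hα : 0 < α k) {ε : ℝ} (hε : 0 ≤ ε) :
    (symmDirichlet k (α k)).real (hellingerBall f k (K * ε)) = Real.exp (-(n * ε ^ 2)) ↔
      ε = epsRadius f α K n k := by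
  have hk1 : 1 ≤ k := by omega
  have := isProbabilityMeasure_symmDirichlet k hα
  set F : ℝ → ℝ := fun ε => (symmDirichlet k (α k)).real (hellingerBall f k (K * ε))
  have hmono : ∀ x y, x ≤ y → F x ≤ F y := fun x y hxy =>
    measureReal_mono (hellingerBall_mono f k (mul_le_mul_of_nonneg_left hxy hK.le))
  have hsol : ∀ ε, 0 ≤ ε → F ε = Real.exp (-(n * ε ^ 2)) → epsRadius f α K n k = ε := by
    intro ε h0 h
    refine le_antisymm (epsRadius_le h0 h.ge) ?_
    refine le_epsRadius hf hK hk1 hα fun δ hδ hle => ?_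
    by_contra! hlt
    have h1 := exp_neg_mul_sq_lt hn hδ hlt
    have h2 := hmono δ ε hlt.le
    have h3 : Real.exp (-(n * δ ^ 2)) ≤ F δ := hle
    linarith
  refine ⟨fun h => (hsol ε hε h).symm, ?_⟩
  rintro rfl
  have hcont : Continuous fun ε => F ε - Real.exp (-(n * ε ^ 2)) := by
    have h1 : Continuous F := (continuous_symmDirichlet_hellingerBall hf hk hα).comp
      (continuous_const.mul continuous_id)
    fun_prop
  have h2K : 0 ≤ 2 / K := by positivity
  have h0 : F 0 - Real.exp (-(n * (0 : ℝ) ^ 2)) ≤ 0 := by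
    simp only [ne_eq, OfNat.ofNat_ne_zero, not_false_eq_true, zero_pow, mul_zero, neg_zero,
      Real.exp_zero, sub_nonpos]
    exact measureReal_le_one
  have h1 : 0 ≤ F (2 / K) - Real.exp (-(n * (2 / K) ^ 2)) := by
    have h2 : F (2 / K) = 1 :=
      symmDirichlet_hellingerBall_of_two_le hf hk1 hα (by field_simp; rfl)
    rw [h2, sub_nonneg, Real.exp_le_one_iff]
    have : 0 ≤ (n : ℝ) * (2 / K) ^ 2 := by positivity
    linarith
  obtain ⟨x, hx, hx'⟩ := intermediate_value_Icc h2K hcont.continuousOn ⟨h0, h1⟩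
  have hx'' : F x = Real.exp (-(n * x ^ 2)) := sub_eq_zero.1 hx'
  rw [hsol x hx.1 hx'']
  exact hx''

/-- Balls of radius below b(k) contain no histogram density, hence have prior mass zero, while the
exponential is positive. -/
theorem biasSq_le_epsRadius_sq (hf : BoundedDensity f c C) (hK : 0 < K) (hk : 1 ≤ k)
    (hα : 0 < α k) : biasSq f k ≤ K ^ 2 * epsRadius f α K n k ^ 2 := by
  have h1 : √(biasSq f k) / K ≤ epsRadius f α K n k := by
    refine le_epsRadius hf hK hk hα fun δ hδ hle => ?_
    by_contra! hlt
    rw [lt_div_iff₀ hK] at hlt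
    have h2 : (symmDirichlet k (α k)).real (hellingerBall f k (K * δ)) = 0 := by
      rw [measureReal_def, measure_mono_null_ae ?_ (measure_empty (μ := symmDirichlet k (α k))),
        ENNReal.toReal_zero]
      filter_upwards [ae_mem_stdSimplex hk hα] with θ hθ hθ'
      have h3 := hf.biasSq_le_hellinger_sq hk hθ
      have h4 : hellinger f (hist θ) ≤ K * δ := hθ'
      have h5 := Real.sqrt_le_left (BoundedDensity.hellinger_nonneg _ _) |>.2 h3
      linarith
    rw [h2] at hle
    exact absurd hle (Real.exp_pos _).not_ge
  rw [div_le_iff₀ hK] at h1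
  calc biasSq f k = √(biasSq f k) ^ 2 := (Real.sq_sqrt (biasSq_nonneg f k)).symm
    _ ≤ (epsRadius f α K n k * K) ^ 2 := by gcongr
    _ = _ := by ring

end Radius

/-- With D = k log(n/k) and nε² = D/64, the ball has prior mass at most exp(-D/32) < exp(-nε²), so
the radius is not smaller than this ε. -/
theorem exists_le_epsRadius_sq (hf : BoundedDensity f c C) {α : ℕ → ℝ} {A K : ℝ} (hK : 0 < K)
    (hα : ∀ k : ℕ, 1 ≤ k → 0 < α k ∧ α k ≤ A) :
    ∃ T : ℝ, 1 < T ∧ ∀ n k : ℕ, 2 ≤ k → T * k ≤ n →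
      k * Real.log (n / k) / n ≤ 64 * epsRadius f α K n k ^ 2 := by
  obtain ⟨T, hT, h⟩ := exists_symmDirichlet_hellingerBall_le_exp hf A
    (by positivity : 0 < K ^ 2 / 64)
  refine ⟨T, hT, fun n k hk hTk => ?_⟩
  have hk1 : 1 ≤ k := by omega
  have hk0 : (0 : ℝ) < k := by exact_mod_cast hk1
  have hkn : (k : ℝ) < n := by nlinarith
  have hn0 : (0 : ℝ) < n := hk0.trans hkn
  obtain ⟨hα0, hαA⟩ := hα k hk1
  have := isProbabilityMeasure_symmDirichlet k hα0
  have hD : 0 < k * Real.log (n / k) :=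
    mul_pos hk0 (Real.log_pos ((one_lt_div hk0).2 hkn))
  set D := k * Real.log (n / k)
  set ε := √(D / (64 * n))
  have hε2 : ε ^ 2 = D / (64 * n) := Real.sq_sqrt (by positivity)
  have hball : K * ε = √(K ^ 2 / 64 * D / n) := by
    rw [show K ^ 2 / 64 * D / n = K ^ 2 * (D / (64 * n)) by field_simp,
      Real.sqrt_mul (by positivity), Real.sqrt_sq hK.le]
  have h1 := h n k hk hTk (α k) hα0 hαA
  rw [← hball] at h1
  have h2 : ε ≤ epsRadius f α K n k := by
    refine le_epsRadius hf hK hk1 hα0 fun δ hδ hle => ?_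
    by_contra! hlt
    have h3 : (symmDirichlet k (α k)).real (hellingerBall f k (K * δ)) ≤
        (symmDirichlet k (α k)).real (hellingerBall f k (K * ε)) :=
      measureReal_mono (hellingerBall_mono f k (mul_le_mul_of_nonneg_left hlt.le hK.le))
    have h4 := exp_neg_mul_sq_lt (n := n) (by exact_mod_cast hn0) hδ hlt
    have h5 : Real.exp (-(D / 32)) < Real.exp (-(n * ε ^ 2)) := by
      refine Real.exp_lt_exp.2 ?_
      rw [hε2, show n * (D / (64 * n)) = D / 64 by field_simp]
      linarith
    linarith
  have h6 : ε ^ 2 ≤ epsRadius f α K n k ^ 2 := by gcongr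
  rw [hε2] at h6
  calc D / n = 64 * (D / (64 * n)) := by field_simp
    _ ≤ _ := by gcongr

theorem exists_epsRadius_sq_le (hf : BoundedDensity f c C) {α : ℕ → ℝ} {A a H K : ℝ} (ha : 0 < a)
    (hα : ∀ k : ℕ, 1 ≤ k → a * (k : ℝ) ^ (-H) ≤ α k ∧ α k ≤ A) (hK : 0 < K) :
    ∃ (B : ℝ) (N : ℕ), 0 < B ∧ ∀ n k : ℕ, N ≤ n → 1 ≤ k → k ≤ n →
      epsRadius f α K n k ^ 2 ≤ B * (biasSq f k + k * Real.log n / n) := by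
  obtain ⟨B, N, hB, h⟩ := exists_le_symmDirichlet ha hα hf.pos
  -- The summand B pays for the prior mass, and 4/K² makes the ball large enough to contain the
  -- vectors above (1 - 1/n) times the cell masses.
  refine ⟨B + 4 / K ^ 2, max 2 N, by positivity, fun n k hn hk hkn => ?_⟩
  have hα0 := pos_of_rpow_le ha hα hk
  have := isProbabilityMeasure_symmDirichlet k hα0
  have hk1 : (1 : ℝ) ≤ k := by exact_mod_cast hk
  have hn2 : (2 : ℝ) ≤ n := by exact_mod_cast (le_max_left _ _).trans hn
  have hn0 : (0 : ℝ) < n := by linarith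
  have hlog : 1 / 2 ≤ Real.log n := by
    have := Real.log_le_log two_pos hn2
    have := Real.log_two_gt_d9
    linarith
  have hb := biasSq_nonneg f k
  have hq : 0 ≤ biasSq f k + k * Real.log n / n := by positivity
  set Q := (B + 4 / K ^ 2) * (biasSq f k + k * Real.log n / n)
  have hQ : 0 ≤ Q := by positivity
  have h1 : epsRadius f α K n k ≤ √Q := by
    refine epsRadius_le (Real.sqrt_nonneg _) ?_
    have h2 := h n k ((le_max_right _ _).trans hn) hk hkn _ (hf.cellMass_mem_stdSimplex hk)
      hf.cellMass_ge
    refine le_trans (Real.exp_le_exp.2 ?_) (h2.trans ?_)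
    · rw [Real.sq_sqrt hQ, neg_le_neg_iff]
      calc B * k * Real.log n = n * (B * (k * Real.log n / n)) := by field_simp
        _ ≤ n * ((B + 4 / K ^ 2) * (biasSq f k + k * Real.log n / n)) := by
            gcongr
            · have : 0 < 4 / K ^ 2 := by positivity
              linarith
            · linarith
    · refine ENNReal.toReal_mono (measure_ne_top _ _) (measure_mono_ae ?_)
      filter_upwards [ae_mem_stdSimplex hk hα0] with θ hθ hle
      have h3 := hf.hellinger_sq_le_of_cellMass_le hk hθ (δ := 1 / n) (by positivity)
        (by rw [div_le_one hn0]; linarith) hle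
      refine abs_le_of_sq_le_sq' (h3.trans ?_) (by positivity) |>.2
      rw [mul_pow, Real.sq_sqrt hQ]
      calc 2 * biasSq f k + 2 * (1 / n) ≤ 4 * (biasSq f k + k * Real.log n / n) := by
            have : 1 / (n : ℝ) ≤ 2 * (k * Real.log n / n) := by
              rw [← mul_div_assoc]
              gcongr
              nlinarith
            linarith
        _ = K ^ 2 * (4 / K ^ 2 * (biasSq f k + k * Real.log n / n)) := by field_simp
        _ ≤ K ^ 2 * Q := by
            simp only [Q]
            gcongr
            linarith
  calc epsRadius f α K n k ^ 2 ≤ √Q ^ 2 := by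
        have := epsRadius_nonneg f α K n k
        gcongr
    _ = Q := Real.sq_sqrt hQ

theorem eventually_mul_le_of_isBigO {kn : ℕ → ℕ}
    (hkn : (fun n : ℕ => (kn n : ℝ)) =O[atTop] fun n : ℕ => (n : ℝ) / Real.log n) {T : ℝ}
    (hT : 0 < T) : ∀ᶠ n : ℕ in atTop, T * kn n ≤ n := by
  obtain ⟨D, hD⟩ := hkn.bound
  have hlog : Tendsto (fun n : ℕ => Real.log n) atTop atTop :=
    Real.tendsto_log_atTop.comp tendsto_natCast_atTop_atTop
  filter_upwards [hD, hlog.eventually_ge_atTop (T * D), hlog.eventually_gt_atTop 0] with n h1 h2 h3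
  rw [Real.norm_of_nonneg (by positivity), Real.norm_of_nonneg (by positivity), ← mul_div_assoc,
    le_div_iff₀ h3] at h1
  have h4 : (0 : ℝ) ≤ kn n := by positivity
  have h5 : (0 : ℝ) ≤ n := by positivity
  by_contra! h6
  have h7 : n * (T * D) ≤ n * Real.log n := by gcongr
  have h8 : n * Real.log n < T * kn n * Real.log n := by gcongr
  have h9 : T * (kn n * Real.log n) ≤ T * (D * n) := by gcongr
  linarith

/-- For k = 1 the prior is a point mass and gives no term log n / n; that term is eventually
dominated by this positive bias. A vanishing bias would make f constant, by continuity, and its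
integral makes the constant 1. -/
theorem biasSq_one_pos (hf : BoundedDensity f c C) (h : ∃ x ∈ Icc (0 : ℝ) 1, f x ≠ 1) :
    0 < biasSq f 1 := by
  refine lt_of_le_of_ne (biasSq_nonneg f 1) fun h0 => ?_
  obtain ⟨x, hx, hne⟩ := h
  simp only [biasSq, Finset.univ_unique, Finset.sum_singleton] at h0
  set t := (∫ y in bin 1 default, √(f y)) * (1 : ℕ)
  have hc : Continuous fun x => (√(f x) - t) ^ 2 := (hf.sqrt_continuous.sub continuous_const).pow 2
  have hbin : bin 1 default = Ioc 0 1 := by simp [bin]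
  have h1 := (integral_eq_zero_iff_of_nonneg (fun x => sq_nonneg _)
    (integrableOn_bin hc default)).1 h0.symm
  rw [hbin, restrict_Ioc_eq_restrict_Icc] at h1
  have h2 : EqOn (fun x => (√(f x) - t) ^ 2) 0 (Icc 0 1) :=
    Measure.eqOn_Icc_of_ae_eq volume zero_ne_one h1 hc.continuousOn continuousOn_const
  have h3 : ∀ y ∈ Icc (0 : ℝ) 1, f y = t ^ 2 := fun y hy => by
    have h4 : (√(f y) - t) ^ 2 = 0 := h2 hy
    rw [← sub_eq_zero.1 (pow_eq_zero_iff two_ne_zero |>.1 h4), Real.sq_sqrt (hf.nonneg y)]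
  have h5 := hf.integral_eq_one
  rw [setIntegral_congr_fun measurableSet_Icc h3] at h5
  simp only [setIntegral_const, Real.volume_real_Icc, sub_zero, smul_eq_mul] at h5
  rw [h3 x hx] at hne
  exact hne (by simpa using h5)

/-- Two-sided bounds for the radius, uniformly over the number of bins. -/
theorem exists_epsRadius_sq_bounds (hf : BoundedDensity f c C) {α : ℕ → ℝ} {A a H K : ℝ}
    (ha : 0 < a) (hα : ∀ k : ℕ, 1 ≤ k → a * (k : ℝ) ^ (-H) ≤ α k ∧ α k ≤ A) (hK : 0 < K)
    {kn : ℕ → ℕ}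
    (hkn : (fun n : ℕ => (kn n : ℝ)) =O[atTop] fun n : ℕ => (n : ℝ) / Real.log n) :
    ∃ c C : ℝ, 0 < c ∧ 0 < C ∧ ∀ᶠ n : ℕ in atTop, ∀ k ∈ Finset.Icc 1 (kn n),
      ((2 ≤ k ∨ ∃ x ∈ Icc (0 : ℝ) 1, f x ≠ 1) →
        c * (biasSq f k + k * Real.log (n / k) / n) ≤ epsRadius f α K n k ^ 2) ∧
      epsRadius f α K n k ^ 2 ≤ C * (biasSq f k + k * Real.log n / n) := by
  obtain ⟨T, hT, hlow⟩ := exists_le_epsRadius_sq hf hK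
    fun k hk => ⟨pos_of_rpow_le ha hα hk, (hα k hk).2⟩
  obtain ⟨B, N, hB, hup⟩ := exists_epsRadius_sq_le hf ha hα hK
  have hlogn : Tendsto (fun n : ℕ => Real.log n / n) atTop (𝓝 0) :=
    (Real.tendsto_pow_log_div_mul_add_atTop 1 0 1 one_ne_zero).comp tendsto_natCast_atTop_atTop
      |>.congr fun n => by simp
  have hone : ∀ᶠ n : ℕ in atTop, (∃ x ∈ Icc (0 : ℝ) 1, f x ≠ 1) →
      Real.log n / n ≤ biasSq f 1 := by
    by_cases h : ∃ x ∈ Icc (0 : ℝ) 1, f x ≠ 1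
    · filter_upwards [hlogn.eventually_le_const (biasSq_one_pos hf h)] with n hn _ using hn
    · exact Eventually.of_forall fun n h' => absurd h' h
  -- The bias and the prior mass bound the radius separately; half of each bound is used for the
  -- sum.
  refine ⟨min (1 / K ^ 2) (1 / 64) / 2, B, by positivity, hB, ?_⟩
  filter_upwards [eventually_mul_le_of_isBigO hkn (one_pos.trans hT), hone,
    eventually_ge_atTop N] with n hTn hn1 hN k hk
  obtain ⟨hk1, hkkn⟩ := Finset.mem_Icc.1 hk
  have hk0 : (0 : ℝ) < k := by exact_mod_cast hk1
  have hTk : T * k ≤ n := le_trans (by gcongr) hTn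
  have hkn' : k ≤ n := by
    have : (k : ℝ) ≤ n := by nlinarith
    exact_mod_cast this
  refine ⟨fun hor => ?_, hup n k hN hk1 hkn'⟩
  set m := min (1 / K ^ 2) (1 / 64)
  have hm1 : m ≤ 1 / K ^ 2 := min_le_left _ _
  have hm2 : m ≤ 1 / 64 := min_le_right _ _
  have hm0 : 0 < m := by positivity
  have hbias : m * biasSq f k ≤ epsRadius f α K n k ^ 2 := by
    have h1 := biasSq_le_epsRadius_sq (n := n) hf hK hk1 (pos_of_rpow_le ha hα hk1)
    have h2 := biasSq_nonneg f k
    calc m * biasSq f k ≤ 1 / K ^ 2 * (K ^ 2 * epsRadius f α K n k ^ 2) := by gcongr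
      _ = _ := by field_simp
  have hvar : m * (k * Real.log (n / k) / n) ≤ epsRadius f α K n k ^ 2 := by
    rcases Nat.lt_or_ge k 2 with hk2 | hk2
    · obtain rfl : k = 1 := by omega
      have h1 := hn1 (hor.resolve_left (by norm_num))
      refine le_trans ?_ hbias
      gcongr
      simpa using h1
    · have h1 := hlow n k hk2 hTk
      calc m * (k * Real.log (n / k) / n) ≤ m * (64 * epsRadius f α K n k ^ 2) := by gcongr
        _ ≤ 1 / 64 * (64 * epsRadius f α K n k ^ 2) := by gcongr
        _ = _ := by ring
  linarith

/-! ### Likelihood ratios -/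

/-- The likelihood of the true density. -/
def trueLikelihood (f : ℝ → ℝ) {n : ℕ} (x : Fin n → ℝ) : ENNReal := ∏ i, ENNReal.ofReal (f (x i))

/-- The likelihood ratio of a histogram and the true density. -/
def likelihoodRatio (f : ℝ → ℝ) {n k : ℕ} (x : Fin n → ℝ) (θ : Fin k → ℝ) : ENNReal :=
  ∏ i, ENNReal.ofReal (hist θ (x i) / f (x i))

theorem measurable_hist_uncurry (k : ℕ) :
    Measurable fun p : (Fin k → ℝ) × ℝ => hist p.1 p.2 := by
  unfold hist
  refine measurable_const.mul (Finset.measurable_sum _ fun j _ => ?_)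
  have h : Measurable ((Prod.snd ⁻¹' bin k j).indicator fun p : (Fin k → ℝ) × ℝ => p.1 j) :=
    Measurable.indicator (by fun_prop) (measurable_snd (measurableSet_bin k j))
  exact h

theorem measurable_hist {k : ℕ} (θ : Fin k → ℝ) : Measurable (hist θ) :=
  (measurable_hist_uncurry k).comp measurable_prodMk_left

theorem hist_mono {k : ℕ} {θ η : Fin k → ℝ} (h : ∀ j, θ j ≤ η j) (x : ℝ) :
    hist θ x ≤ hist η x :=
  mul_le_mul_of_nonneg_left
    (Finset.sum_le_sum fun j _ => indicator_le_indicator (h j)) k.cast_nonneg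

theorem hist_const_mul {k : ℕ} (t : ℝ) (θ : Fin k → ℝ) (x : ℝ) :
    hist (fun j => t * θ j) x = t * hist θ x := by
  simp only [hist, indicator, Finset.mul_sum]
  refine Finset.sum_congr rfl fun j _ => ?_
  split_ifs <;> ring

theorem likelihood_mono {n k : ℕ} (x : Fin n → ℝ) {θ η : Fin k → ℝ} (h : ∀ j, θ j ≤ η j) :
    likelihood x θ ≤ likelihood x η :=
  Finset.prod_le_prod' fun i _ => ENNReal.ofReal_le_ofReal (hist_mono h (x i))

theorem measurable_likelihood {n k : ℕ} (x : Fin n → ℝ) :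
    Measurable fun θ : Fin k → ℝ => likelihood x θ := by
  unfold likelihood
  refine Finset.measurable_prod _ fun i _ => ENNReal.measurable_ofReal.comp ?_
  exact (measurable_hist_uncurry k).comp measurable_prodMk_right

namespace BoundedDensity

theorem trueLikelihood_ne_zero (hf : BoundedDensity f c C) {n : ℕ} (x : Fin n → ℝ) :
    trueLikelihood f x ≠ 0 :=
  Finset.prod_ne_zero_iff.2 fun i _ => (ENNReal.ofReal_pos.2 (hf.posAt (x i))).ne'

theorem likelihood_eq (hf : BoundedDensity f c C) {n k : ℕ} (x : Fin n → ℝ) (θ : Fin k → ℝ) :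
    likelihood x θ = likelihoodRatio f x θ * trueLikelihood f x := by
  rw [likelihood, likelihoodRatio, trueLikelihood, ← Finset.prod_mul_distrib]
  refine Finset.prod_congr rfl fun i _ => ?_
  rw [← ENNReal.ofReal_mul' (hf.nonneg _), div_mul_cancel₀ _ (hf.posAt _).ne']

theorem measurable_likelihoodRatio_uncurry (hf : BoundedDensity f c C) (n k : ℕ) :
    Measurable fun p : (Fin n → ℝ) × (Fin k → ℝ) => likelihoodRatio f p.1 p.2 := by
  unfold likelihoodRatio
  refine Finset.measurable_prod _ fun i _ => ENNReal.measurable_ofReal.comp ?_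
  refine Measurable.div ((measurable_hist_uncurry k).comp
    (measurable_snd.prodMk ((measurable_pi_apply i).comp measurable_fst))) ?_
  exact hf.continuous.measurable.comp ((measurable_pi_apply i).comp measurable_fst)

theorem measurable_ratio (hf : BoundedDensity f c C) {k : ℕ} (θ : Fin k → ℝ) :
    Measurable fun y => hist θ y / f y :=
  (measurable_hist θ).div hf.continuous.measurable

theorem measurable_inv_ratio (hf : BoundedDensity f c C) {k : ℕ} (θ : Fin k → ℝ) :
    Measurable fun y => f y / hist θ y :=
  hf.continuous.measurable.div (measurable_hist θ)

/-! ### Expectations under the true law -/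

theorem isProbabilityMeasure_trueLaw (hf : BoundedDensity f c C) :
    IsProbabilityMeasure (trueLaw f) := by
  constructor
  rw [trueLaw, withDensity_apply _ MeasurableSet.univ, Measure.restrict_univ,
    ← ofReal_integral_eq_lintegral_ofReal, hf.integral_eq_one, ENNReal.ofReal_one]
  · exact hf.continuous.integrableOn_Icc
  · exact Eventually.of_forall hf.nonneg

theorem isProbabilityMeasure_sampleLaw (hf : BoundedDensity f c C) (n : ℕ) :
    IsProbabilityMeasure (sampleLaw f n) := by
  have := hf.isProbabilityMeasure_trueLaw
  unfold sampleLaw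
  infer_instance

theorem lintegral_sampleLaw_prod (hf : BoundedDensity f c C) (n : ℕ) {g : ℝ → ENNReal}
    (hg : Measurable g) :
    ∫⁻ x, ∏ i, g (x i) ∂sampleLaw f n = (∫⁻ y, g y ∂trueLaw f) ^ n := by
  have := hf.isProbabilityMeasure_trueLaw
  have hind := iIndepFun_pi (μ := fun _ : Fin n => trueLaw f) (X := fun _ => g)
    fun _ => hg.aemeasurable
  rw [sampleLaw, lintegral_prod_eq_prod_lintegral_of_indepFun _ _ hind
    fun i => hg.comp (measurable_pi_apply i)]
  have h : ∀ i : Fin n, ∫⁻ x, g (x i) ∂Measure.pi (fun _ : Fin n => trueLaw f) =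
      ∫⁻ y, g y ∂trueLaw f := fun i =>
    (measurePreserving_eval (fun _ : Fin n => trueLaw f) i).lintegral_comp hg
  simp [h]

theorem lintegral_trueLaw (hf : BoundedDensity f c C) {k : ℕ} (hk : 1 ≤ k) {g : ℝ → ENNReal}
    (hg : Measurable g) :
    ∫⁻ y, g y ∂trueLaw f = ∑ j : Fin k, ∫⁻ y in bin k j, ENNReal.ofReal (f y) * g y := by
  rw [trueLaw, lintegral_withDensity_eq_lintegral_mul _
    hf.continuous.measurable.ennreal_ofReal hg, lintegral_Icc_eq_sum hk]
  rfl

theorem ae_mem_Ioc (hf : BoundedDensity f c C) (n : ℕ) :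
    ∀ᵐ x ∂sampleLaw f n, ∀ i, x i ∈ Ioc (0 : ℝ) 1 := by
  have := hf.isProbabilityMeasure_trueLaw
  have h : ∀ᵐ y ∂trueLaw f, y ∈ Ioc (0 : ℝ) 1 := by
    refine (withDensity_absolutelyContinuous _ _).ae_le ?_
    rw [← restrict_Ioc_eq_restrict_Icc]
    exact ae_restrict_mem measurableSet_Ioc
  rw [ae_all_iff]
  intro i
  exact Measure.tendsto_eval_ae_ae.eventually h

theorem lintegral_ratio (hf : BoundedDensity f c C) {k : ℕ} (hk : 1 ≤ k) {θ : Fin k → ℝ}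
    (hθ : θ ∈ stdSimplex ℝ (Fin k)) :
    ∫⁻ y, ENNReal.ofReal (hist θ y / f y) ∂trueLaw f = 1 := by
  rw [hf.lintegral_trueLaw hk (hf.measurable_ratio θ).ennreal_ofReal]
  have h : ∀ j : Fin k, ∫⁻ y in bin k j, ENNReal.ofReal (f y) * ENNReal.ofReal (hist θ y / f y) =
      ENNReal.ofReal (θ j) := fun j => by
    have hk0 := natCast_pos_of_fin j
    rw [setLIntegral_congr_fun (g := fun _ => ENNReal.ofReal (k * θ j)) (measurableSet_bin k j)]
    · rw [setLIntegral_const, volume_bin, ← ENNReal.ofReal_mul (mul_nonneg hk0.le (hθ.1 j))]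
      congr 1; field_simp
    · intro y hy
      simp only
      rw [hist_of_mem θ hy, ← ENNReal.ofReal_mul (hf.nonneg y), mul_div_cancel₀ _ (hf.posAt y).ne']
  rw [Finset.sum_congr rfl fun j _ => h j, ← ENNReal.ofReal_sum_of_nonneg fun j _ => hθ.1 j, hθ.2,
    ENNReal.ofReal_one]

theorem lintegral_sqrt_ratio (hf : BoundedDensity f c C) {k : ℕ} (hk : 1 ≤ k) (θ : Fin k → ℝ) :
    ∫⁻ y, ENNReal.ofReal √(hist θ y / f y) ∂trueLaw f =
      ENNReal.ofReal (∑ j, rootMass f k j * √(θ j)) := by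
  rw [hf.lintegral_trueLaw hk (hf.measurable_ratio θ).sqrt.ennreal_ofReal,
    ENNReal.ofReal_sum_of_nonneg fun j _ =>
      mul_nonneg (hf.rootMass_pos j).le (Real.sqrt_nonneg _)]
  refine Finset.sum_congr rfl fun j _ => ?_
  have hk0 := natCast_pos_of_fin j
  rw [setLIntegral_congr_fun (g := fun y => ENNReal.ofReal (√(k * θ j) * √(f y)))
    (measurableSet_bin k j), ← ofReal_integral_eq_lintegral_ofReal]
  · rw [integral_const_mul, rootMass, Real.sqrt_mul hk0.le]
    congr 1; ring
  · exact integrableOn_bin (continuous_const.mul hf.sqrt_continuous) j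
  · exact Eventually.of_forall fun y => by positivity
  · intro y hy
    simp only
    rw [hist_of_mem θ hy, ← ENNReal.ofReal_mul (hf.nonneg y), Real.sqrt_div' _ (hf.nonneg y)]
    congr 1
    have h1 := Real.sqrt_pos.2 (hf.posAt y)
    have h2 := Real.mul_self_sqrt (hf.nonneg y)
    rw [mul_div_assoc', div_eq_iff h1.ne', mul_assoc, h2, mul_comm]

/-- The integral of f²/f_p is one plus a chi-square distance, where f_p ≥ c and the squared L²
distance is at most 4C b(k)². Markov's inequality then takes the place of bounds on the mean and
variance of the log-likelihood ratio. -/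
theorem lintegral_inv_ratio_le (hf : BoundedDensity f c C) {k : ℕ} (hk : 1 ≤ k) :
    ∫⁻ y, ENNReal.ofReal (f y / hist (cellMass f k) y) ∂trueLaw f ≤
      ENNReal.ofReal (1 + 4 * C / c * biasSq f k) := by
  rw [hf.lintegral_trueLaw hk (hf.measurable_inv_ratio _).ennreal_ofReal]
  have h : ∀ j : Fin k,
      ∫⁻ y in bin k j, ENNReal.ofReal (f y) * ENNReal.ofReal (f y / hist (cellMass f k) y) ≤
      ENNReal.ofReal (cellMass f k j +
        1 / c * ∫ x in bin k j, (f x - cellMass f k j * k) ^ 2) := fun j => by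
    have hk0 := natCast_pos_of_fin j
    have hp := hf.cellMass_pos j
    set p := cellMass f k j
    have hcp : c ≤ p * k := (div_le_iff₀ hk0).1 (hf.cellMass_ge j)
    rw [setLIntegral_congr_fun (g := fun y => ENNReal.ofReal ((p * k)⁻¹ * f y ^ 2))
      (measurableSet_bin k j), ← ofReal_integral_eq_lintegral_ofReal]
    · refine ENNReal.ofReal_le_ofReal ?_
      have h1 := integral_sub_const_sq hf.continuous j (p * k)
      have h2 : ∫ x in bin k j, f x = p := rfl
      have h3 : 0 ≤ ∫ x in bin k j, (f x - p * k) ^ 2 := integral_nonneg fun _ => sq_nonneg _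
      rw [integral_const_mul]
      have h4 : (p * k)⁻¹ * ∫ x in bin k j, f x ^ 2 =
          p + (p * k)⁻¹ * ∫ x in bin k j, (f x - p * k) ^ 2 := by
        rw [h1, h2]; field_simp; ring
      rw [h4, one_div]
      have := hf.pos
      gcongr
    · exact integrableOn_bin (continuous_const.mul (hf.continuous.pow 2)) j
    · exact Eventually.of_forall fun y => by positivity
    · intro y hy
      simp only
      rw [hist_of_mem _ hy, ← ENNReal.ofReal_mul (hf.nonneg y)]
      congr 1
      change f y * (f y / (k * p)) = _
      field_simp
  have hnn : ∀ j : Fin k, 0 ≤ cellMass f k j +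
      1 / c * ∫ x in bin k j, (f x - cellMass f k j * k) ^ 2 := fun j =>
    add_nonneg (hf.cellMass_pos j).le (mul_nonneg (one_div_pos.2 hf.pos).le
      (integral_nonneg fun _ => sq_nonneg _))
  refine (Finset.sum_le_sum fun j _ => h j).trans ?_
  rw [← ENNReal.ofReal_sum_of_nonneg fun j _ => hnn j]
  refine ENNReal.ofReal_le_ofReal ?_
  rw [Finset.sum_add_distrib, hf.sum_cellMass hk, ← Finset.mul_sum]
  have h1 := hf.sum_integral_sub_mean_sq_le k
  have := hf.pos
  calc _ ≤ 1 + 1 / c * (4 * C * biasSq f k) := by gcongr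
    _ = _ := by ring

/-- Markov's inequality for a product of functions of the observations. -/
theorem sampleLaw_prod_ge_le (hf : BoundedDensity f c C) (n : ℕ) {g : ℝ → ENNReal}
    (hg : Measurable g) {s u : ℝ} (h : (∫⁻ y, g y ∂trueLaw f) ^ n ≤ ENNReal.ofReal (Real.exp u)) :
    sampleLaw f n {x | ENNReal.ofReal (Real.exp s) ≤ ∏ i, g (x i)} ≤
      ENNReal.ofReal (Real.exp (u - s)) := by
  have hm : Measurable fun x : Fin n → ℝ => ∏ i, g (x i) :=
    Finset.measurable_prod _ fun i _ => hg.comp (measurable_pi_apply i)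
  refine (meas_ge_le_lintegral_div hm.aemeasurable (by simp [Real.exp_pos])
    ENNReal.ofReal_ne_top).trans ?_
  rw [hf.lintegral_sampleLaw_prod n hg, Real.exp_sub, ENNReal.ofReal_div_of_pos (Real.exp_pos s)]
  gcongr

/-! ### The evidence lower bound -/

theorem exp_neg_two_le_pow {n : ℕ} (hn : 2 ≤ n) : Real.exp (-2) ≤ (1 - 1 / (n : ℝ)) ^ n := by
  have hn2 : (2 : ℝ) ≤ n := by exact_mod_cast hn
  have hn0 : (0 : ℝ) < n := by linarith
  have hu : 1 / (n : ℝ) ≤ 1 / 2 := by gcongr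
  have hu0 : 0 < 1 / (n : ℝ) := by positivity
  have h1 : Real.exp (-(2 * (1 / n))) ≤ 1 - 1 / (n : ℝ) := by
    rw [Real.exp_neg]
    refine inv_le_of_inv_le₀ (by linarith) ?_
    refine le_trans ?_ (Real.add_one_le_exp _)
    rw [inv_le_iff_one_le_mul₀ (by linarith)]
    nlinarith
  calc Real.exp (-2) = Real.exp (-(2 * (1 / n))) ^ n := by
        rw [← Real.exp_nat_mul]; congr 1; field_simp
    _ ≤ _ := by gcongr

/-- Every θ above (1 - 1/n) p has likelihood at least (1 - 1/n)^n ≥ exp(-2) times that of p,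
whatever the sample. Hence only the single ratio of f to the histogram of p has to be controlled in
probability. -/
theorem exists_marginal_lower (hf : BoundedDensity f c C) {α : ℕ → ℝ} {A a H : ℝ} (ha : 0 < a)
    (hα : ∀ k : ℕ, 1 ≤ k → a * (k : ℝ) ^ (-H) ≤ α k ∧ α k ≤ A) :
    ∃ (B : ℝ) (N : ℕ), 0 < B ∧ ∀ n k : ℕ, N ≤ n → 1 ≤ k → k ≤ n → ∀ t : ℝ,
      sampleLaw f n {x | marginal α x k <
        ENNReal.ofReal (Real.exp (-(B * (n * biasSq f k + k * Real.log n) + 2 + t))) *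
          trueLikelihood f x} ≤ ENNReal.ofReal (Real.exp (-t)) := by
  obtain ⟨B, N, hB, h⟩ := exists_le_symmDirichlet ha hα hf.pos
  have hC := hf.upper_pos
  have hc := hf.pos
  set D := 4 * C / c
  have hD : 0 < D := by positivity
  refine ⟨B + D, max 2 N, by positivity, fun n k hn hk hkn t => ?_⟩
  have hn2 : 2 ≤ n := (le_max_left _ _).trans hn
  have hn2' : (2 : ℝ) ≤ n := by exact_mod_cast hn2
  have hlog : 0 ≤ Real.log n := Real.log_natCast_nonneg n
  have hb := biasSq_nonneg f k
  have hα0 := pos_of_rpow_le ha hα hk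
  have := isProbabilityMeasure_symmDirichlet k hα0
  set p := cellMass f k
  have hprior := h n k ((le_max_right _ _).trans hn) hk hkn p (hf.cellMass_mem_stdSimplex hk)
    hf.cellMass_ge
  set S : Set (Fin k → ℝ) := {θ | ∀ j, (1 - 1 / n) * p j ≤ θ j}
  have hE : (∫⁻ y, ENNReal.ofReal (f y / hist p y) ∂trueLaw f) ^ n ≤
      ENNReal.ofReal (Real.exp (D * n * biasSq f k)) := by
    calc _ ≤ ENNReal.ofReal (1 + D * biasSq f k) ^ n := by
          gcongr; exact hf.lintegral_inv_ratio_le hk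
      _ ≤ ENNReal.ofReal (Real.exp (D * biasSq f k)) ^ n := by
          gcongr
          have := Real.add_one_le_exp (D * biasSq f k)
          linarith
      _ = _ := by
          rw [← ENNReal.ofReal_pow (Real.exp_pos _).le, ← Real.exp_nat_mul]
          congr 2; ring
  have hM := hf.sampleLaw_prod_ge_le n (s := t + D * n * biasSq f k)
    (hf.measurable_inv_ratio p).ennreal_ofReal hE
  rw [show D * n * biasSq f k - (t + D * n * biasSq f k) = -t by ring] at hM
  refine (measure_mono_ae ?_).trans hM
  filter_upwards [hf.ae_mem_Ioc n] with x hx hlt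
  by_contra hnot
  have hW : ∏ i, ENNReal.ofReal (f (x i) / hist p (x i)) <
      ENNReal.ofReal (Real.exp (t + D * n * biasSq f k)) := not_le.1 hnot
  have hpos : ∀ i, 0 < hist p (x i) := fun i => by
    have hxi := hx i
    rw [← iUnion_bin hk] at hxi
    obtain ⟨j, hj⟩ := mem_iUnion.1 hxi
    rw [hist_of_mem p hj]
    exact mul_pos (natCast_pos_of_fin j) (hf.cellMass_pos j)
  have hlikp : trueLikelihood f x ≤
      ENNReal.ofReal (Real.exp (t + D * n * biasSq f k)) * likelihood x p := by
    calc trueLikelihood f x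
        = (∏ i, ENNReal.ofReal (f (x i) / hist p (x i))) * likelihood x p := by
          rw [likelihood, trueLikelihood, ← Finset.prod_mul_distrib]
          refine Finset.prod_congr rfl fun i _ => ?_
          rw [← ENNReal.ofReal_mul' (hpos i).le, div_mul_cancel₀ _ (hpos i).ne']
      _ ≤ _ := by gcongr
  have hlik : ∀ θ ∈ S, ENNReal.ofReal (Real.exp (-2)) * likelihood x p ≤ likelihood x θ := by
    intro θ hθ
    refine le_trans ?_ (likelihood_mono x hθ)
    simp only [likelihood, hist_const_mul]
    have h1 : (0 : ℝ) ≤ 1 - 1 / n := by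
      rw [sub_nonneg, div_le_one (by linarith)]; linarith
    simp_rw [ENNReal.ofReal_mul h1]
    rw [Finset.prod_mul_distrib, Finset.prod_const, Finset.card_univ, Fintype.card_fin,
      ← ENNReal.ofReal_pow h1]
    gcongr
    exact exp_neg_two_le_pow hn2
  have hmarg : ENNReal.ofReal (Real.exp (-2)) * likelihood x p *
      ENNReal.ofReal (Real.exp (-(B * k * Real.log n))) ≤ marginal α x k := by
    calc _ ≤ ENNReal.ofReal (Real.exp (-2)) * likelihood x p * symmDirichlet k (α k) S := by
          gcongr
          rw [ENNReal.ofReal_le_iff_le_toReal (measure_ne_top _ _)]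
          exact hprior
      _ = ∫⁻ _ in S, ENNReal.ofReal (Real.exp (-2)) * likelihood x p ∂symmDirichlet k (α k) := by
          rw [setLIntegral_const]
      _ ≤ ∫⁻ θ in S, likelihood x θ ∂symmDirichlet k (α k) :=
          setLIntegral_mono (measurable_likelihood x) hlik
      _ ≤ _ := setLIntegral_le_lintegral _ _
  refine absurd hlt (not_lt.2 (le_trans ?_ hmarg))
  calc _ ≤ ENNReal.ofReal (Real.exp (-((B + D) * (n * biasSq f k + k * Real.log n) + 2 + t))) *
        (ENNReal.ofReal (Real.exp (t + D * n * biasSq f k)) * likelihood x p) := by gcongr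
    _ = ENNReal.ofReal (Real.exp (-2 - B * k * Real.log n -
          (B * (n * biasSq f k) + D * (k * Real.log n)))) * likelihood x p := by
        rw [← mul_assoc, ← ENNReal.ofReal_mul (Real.exp_pos _).le, ← Real.exp_add]
        congr 3; ring
    _ ≤ ENNReal.ofReal (Real.exp (-2 - B * k * Real.log n)) * likelihood x p := by
        have : 0 ≤ B * (n * biasSq f k) + D * (k * Real.log n) := by positivity
        gcongr ENNReal.ofReal (Real.exp ?_) * _
        linarith
    _ = _ := by
        rw [mul_right_comm (ENNReal.ofReal _), ← ENNReal.ofReal_mul (Real.exp_pos _).le, ← Real.exp_add]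
        congr 3

end BoundedDensity

/-! ### Upper brackets for the simplex -/

theorem ofReal_sqrt_sq (z : ℝ) : ENNReal.ofReal √z ^ 2 = ENNReal.ofReal z := by
  rcases le_total 0 z with h | h
  · rw [← ENNReal.ofReal_pow (Real.sqrt_nonneg z), Real.sq_sqrt h]
  · rw [Real.sqrt_eq_zero_of_nonpos h, ENNReal.ofReal_of_nonpos h]; simp

/-- The number of integer vectors with a bounded sum, by the exponential Markov inequality. -/
theorem card_filter_sum_le (k m M : ℕ) {t : ℝ} (ht : 0 < t) :
    (((Fintype.piFinset fun _ : Fin k => Finset.range m).filter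
      fun N => ∑ j, N j ≤ M).card : ℝ) ≤ Real.exp (t * M) * (1 - Real.exp (-t))⁻¹ ^ k := by
  have hq1 : Real.exp (-t) < 1 := Real.exp_lt_one_iff.2 (by linarith)
  have hq0 : 0 ≤ Real.exp (-t) := (Real.exp_pos _).le
  set S := Fintype.piFinset fun _ : Fin k => Finset.range m
  calc ((S.filter fun N => ∑ j, N j ≤ M).card : ℝ)
      = ∑ _N ∈ S.filter fun N => ∑ j, N j ≤ M, (1 : ℝ) := by simp
    _ ≤ ∑ N ∈ S.filter fun N => ∑ j, N j ≤ M,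
          Real.exp (t * M) * ∏ j, Real.exp (-t) ^ N j := by
        refine Finset.sum_le_sum fun N hN => ?_
        have h1 : ∑ j, N j ≤ M := (Finset.mem_filter.1 hN).2
        have h2 : ((∑ j, N j : ℕ) : ℝ) ≤ M := by exact_mod_cast h1
        rw [Finset.prod_pow_eq_pow_sum, ← Real.exp_nat_mul, ← Real.exp_add]
        refine Real.one_le_exp ?_
        nlinarith
    _ ≤ ∑ N ∈ S, Real.exp (t * M) * ∏ j, Real.exp (-t) ^ N j :=
        Finset.sum_le_sum_of_subset_of_nonneg (Finset.filter_subset _ _)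
          fun N _ _ => by positivity
    _ = Real.exp (t * M) * (∑ i ∈ Finset.range m, Real.exp (-t) ^ i) ^ k := by
        rw [← Finset.mul_sum, ← Finset.prod_univ_sum (κ := fun _ : Fin k => ℕ)
          (fun _ : Fin k => Finset.range m) fun _ i => Real.exp (-t) ^ i, Finset.prod_const,
          Finset.card_univ, Fintype.card_fin]
    _ ≤ _ := by
        gcongr
        rw [← tsum_geometric_of_lt_one hq0 hq1]
        exact (summable_geometric_of_lt_one hq0 hq1).sum_le_tsum _ fun i _ => by positivity

theorem card_filter_sum_le_exp {n k m : ℕ} (hk : 1 ≤ k) (hkn : k ≤ n) :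
    (((Fintype.piFinset fun _ : Fin k => Finset.range m).filter
      fun N => ∑ j, N j ≤ n + k).card : ℝ) ≤ Real.exp (3 * k + k * Real.log (n / k)) := by
  have hk0 : (0 : ℝ) < k := by exact_mod_cast hk
  have hkn' : (k : ℝ) ≤ n := by exact_mod_cast hkn
  have hn0 : (0 : ℝ) < n := hk0.trans_le hkn'
  -- This t gives exp(t(n + k)) ≤ exp(2k), while the geometric sum is at most 2n/k.
  set t : ℝ := k / n
  have ht : 0 < t := by positivity
  have ht1 : t ≤ 1 := (div_le_one hn0).2 hkn'
  refine (card_filter_sum_le k m (n + k) ht).trans ?_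
  have h1 : t * ((n + k : ℕ) : ℝ) ≤ 2 * k := by
    push_cast
    have : t * (n + k) = k + t * k := by simp only [t]; field_simp
    nlinarith
  have h2 : t / 2 ≤ 1 - Real.exp (-t) := by
    have h3 : Real.exp (-t) ≤ (1 + t)⁻¹ := by
      rw [Real.exp_neg]
      have := Real.add_one_le_exp t
      gcongr
      linarith
    have h4 : (1 + t)⁻¹ ≤ 1 - t / 2 := by
      rw [inv_le_iff_one_le_mul₀ (by linarith)]
      nlinarith
    linarith
  have h3 : (1 - Real.exp (-t))⁻¹ ≤ Real.exp (1 + Real.log (n / k)) := by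
    rw [Real.exp_add, Real.exp_log (by positivity)]
    calc (1 - Real.exp (-t))⁻¹ ≤ (t / 2)⁻¹ := by gcongr
      _ = 2 * (n / k) := by simp only [t]; field_simp
      _ ≤ _ := by
          gcongr
          have := Real.add_one_le_exp (1 : ℝ)
          linarith
  have h4 : 0 ≤ (1 - Real.exp (-t))⁻¹ := inv_nonneg.2 (by linarith)
  calc _ ≤ Real.exp (2 * k) * Real.exp (1 + Real.log (n / k)) ^ k := by gcongr
    _ = _ := by
        rw [← Real.exp_nat_mul, ← Real.exp_add]
        congr 1; ring

namespace BoundedDensity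

/-- The Hellinger affinity of an upper bracket. -/
theorem affinity_bracket_le (hf : BoundedDensity f c C) {k : ℕ} (hk : 1 ≤ k)
    {θ η : Fin k → ℝ} (hθ : θ ∈ stdSimplex ℝ (Fin k)) (hle : ∀ j, θ j ≤ η j) {δ : ℝ}
    (hη : ∑ j, η j ≤ 1 + δ) :
    ∑ j, rootMass f k j * √(η j) ≤ 1 - hellinger f (hist θ) ^ 2 / 4 + δ := by
  -- Equivalently (√η - v)² ≥ (√θ - v)²/2 - (η - θ), which follows from (a + b)² ≤ 2a² + 2b² and (√η
  -- - √θ)² ≤ η - θ.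
  have h1 : ∀ j, 2 * (rootMass f k j * √(η j)) ≤ rootMass f k j ^ 2 + η j -
      (rootMass f k j ^ 2 + θ j - 2 * (rootMass f k j * √(θ j))) / 2 + (η j - θ j) := fun j => by
    have hθj := hθ.1 j
    have h2 := Real.sq_sqrt hθj
    have h3 := Real.sq_sqrt (hθj.trans (hle j))
    have h4 : √(θ j) ≤ √(η j) := Real.sqrt_le_sqrt (hle j)
    have h5 := Real.sqrt_nonneg (θ j)
    have h6 : (√(η j) - √(θ j)) ^ 2 ≤ η j - θ j := by nlinarith
    nlinarith [sq_nonneg ((√(η j) - rootMass f k j) + (√(η j) - √(θ j)))]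
  have h2 := Finset.sum_le_sum fun j (_ : j ∈ Finset.univ) => h1 j
  simp only [Finset.sum_add_distrib, Finset.sum_sub_distrib, ← Finset.sum_div,
    ← Finset.mul_sum, hθ.2] at h2
  have h3 := hf.sum_rootMass_sq_le hk
  rw [hf.hellinger_sq hk hθ]
  linarith

/-- Markov's inequality for the square root of the likelihood ratio, whose mean is the n-th power of
the affinity; hence the exponent 2s. -/
theorem sampleLaw_likelihood_gt_le (hf : BoundedDensity f c C) {n k : ℕ} (hk : 1 ≤ k)
    (η : Fin k → ℝ) {s u : ℝ} (h : ∑ j, rootMass f k j * √(η j) ≤ Real.exp u) :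
    sampleLaw f n {x | ENNReal.ofReal (Real.exp (-(2 * s))) * trueLikelihood f x <
      likelihood x η} ≤ ENNReal.ofReal (Real.exp (n * u + s)) := by
  have hE : (∫⁻ y, ENNReal.ofReal √(hist η y / f y) ∂trueLaw f) ^ n ≤
      ENNReal.ofReal (Real.exp (n * u)) := by
    rw [hf.lintegral_sqrt_ratio hk, Real.exp_nat_mul, ENNReal.ofReal_pow (Real.exp_pos u).le]
    gcongr
  have hM := hf.sampleLaw_prod_ge_le n (s := -s) (hf.measurable_ratio η).sqrt.ennreal_ofReal hE
  rw [sub_neg_eq_add] at hM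
  refine (measure_mono fun x hx => ?_).trans hM
  have hx' : ENNReal.ofReal (Real.exp (-(2 * s))) * trueLikelihood f x < likelihood x η := hx
  rw [hf.likelihood_eq] at hx'
  have h1 := lt_of_mul_lt_mul_right' hx'
  change ENNReal.ofReal (Real.exp (-s)) ≤ ∏ i, ENNReal.ofReal √(hist η (x i) / f (x i))
  by_contra! hlt
  have h2 : likelihoodRatio f x η = (∏ i, ENNReal.ofReal √(hist η (x i) / f (x i))) ^ 2 := by
    rw [likelihoodRatio, ← Finset.prod_pow]
    exact Finset.prod_congr rfl fun i _ => (ofReal_sqrt_sq _).symm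
  have h3 : ENNReal.ofReal (Real.exp (-(2 * s))) = ENNReal.ofReal (Real.exp (-s)) ^ 2 := by
    rw [← ENNReal.ofReal_pow (Real.exp_pos _).le, ← Real.exp_nat_mul]
    congr 2; push_cast; ring
  rw [h2, h3] at h1
  exact absurd (pow_le_pow_left' hlt.le 2) h1.not_ge

/-- Outside a Hellinger ball the likelihood is uniformly small. -/
theorem sampleLaw_exists_likelihood_gt_le (hf : BoundedDensity f c C) {n k : ℕ} (hk : 1 ≤ k)
    (hkn : Real.exp 4 * k ≤ n) {r : ℝ} (hr : 0 ≤ r)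
    (hnr : 32 * (k * Real.log (n / k)) ≤ n * r ^ 2) :
    sampleLaw f n {x | ∃ θ ∈ stdSimplex ℝ (Fin k), r < hellinger f (hist θ) ∧
      ENNReal.ofReal (Real.exp (-(n * r ^ 2 / 4))) * trueLikelihood f x < likelihood x θ} ≤
    ENNReal.ofReal (Real.exp (-(n * r ^ 2 / 16))) := by
  have hk0 : (0 : ℝ) < k := by exact_mod_cast hk
  have hkn1 : (k : ℝ) ≤ n := by
    have : (1 : ℝ) ≤ Real.exp 4 := Real.one_le_exp (by norm_num)
    nlinarith
  have hn0 : (0 : ℝ) < n := hk0.trans_le hkn1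
  have hlog : 4 ≤ Real.log (n / k) :=
    (Real.le_log_iff_exp_le (by positivity)).2 ((le_div_iff₀ hk0).2 hkn)
  set D := k * Real.log (n / k)
  have hD : 4 * k ≤ D := by simp only [D]; nlinarith
  -- The brackets: θ is rounded up to multiples of 1/n, which raises the total mass to at most 1 +
  -- k/n. Only brackets of small affinity are kept; those of distant histograms are among them.
  set G := ((Fintype.piFinset fun _ : Fin k => Finset.range (n + 2)).filter
    fun N => ∑ j, N j ≤ n + k).filter
    fun N => ∑ j, rootMass f k j * √((N j : ℝ) / n) ≤ 1 - r ^ 2 / 4 + k / n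
  have hsub : {x : Fin n → ℝ | ∃ θ ∈ stdSimplex ℝ (Fin k), r < hellinger f (hist θ) ∧
      ENNReal.ofReal (Real.exp (-(n * r ^ 2 / 4))) * trueLikelihood f x < likelihood x θ} ⊆
      ⋃ N ∈ G, {x | ENNReal.ofReal (Real.exp (-(2 * (n * r ^ 2 / 8)))) * trueLikelihood f x <
        likelihood x fun j => (N j : ℝ) / n} := by
    rintro x ⟨θ, hθ, hrθ, hlt⟩
    set N : Fin k → ℕ := fun j => ⌈n * θ j⌉₊
    have hle : ∀ j, θ j ≤ (N j : ℝ) / n := fun j => by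
      rw [le_div_iff₀ hn0, mul_comm]
      exact Nat.le_ceil _
    have hceil : ∀ j, (N j : ℝ) ≤ n * θ j + 1 := fun j =>
      (Nat.ceil_lt_add_one (mul_nonneg hn0.le (hθ.1 j))).le
    have hsumN : (∑ j, (N j : ℝ)) ≤ n + k := by
      refine (Finset.sum_le_sum fun j _ => hceil j).trans ?_
      rw [Finset.sum_add_distrib, ← Finset.mul_sum, hθ.2]
      simp
    have hsum : ∑ j, (N j : ℝ) / n ≤ 1 + k / n := by
      rw [← Finset.sum_div, div_le_iff₀ hn0]
      refine hsumN.trans_eq ?_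
      field_simp
    have haff := hf.affinity_bracket_le hk hθ hle hsum
    refine mem_iUnion₂.2 ⟨N, Finset.mem_filter.2 ⟨Finset.mem_filter.2 ⟨?_, ?_⟩, ?_⟩, ?_⟩
    · refine Fintype.mem_piFinset.2 fun j => Finset.mem_range.2 ?_
      have h1 : θ j ≤ 1 := by
        rw [← hθ.2]
        exact Finset.single_le_sum (fun i _ => hθ.1 i) (Finset.mem_univ j)
      have h2 : (N j : ℝ) ≤ n + 1 := (hceil j).trans (by nlinarith)
      have h3 : N j ≤ n + 1 := by exact_mod_cast h2
      omega
    · exact_mod_cast hsumN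
    · refine haff.trans ?_
      have : r ^ 2 ≤ hellinger f (hist θ) ^ 2 := by gcongr
      linarith
    · change ENNReal.ofReal (Real.exp (-(2 * (n * r ^ 2 / 8)))) * trueLikelihood f x <
        likelihood x fun j => (N j : ℝ) / n
      rw [show 2 * (n * r ^ 2 / 8) = n * r ^ 2 / 4 by ring]
      exact hlt.trans_le (likelihood_mono x hle)
  refine (measure_mono hsub).trans ((measure_biUnion_finset_le _ _).trans ?_)
  have hterm : ∀ N ∈ G, sampleLaw f n {x | ENNReal.ofReal (Real.exp (-(2 * (n * r ^ 2 / 8)))) *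
      trueLikelihood f x < likelihood x fun j => (N j : ℝ) / n} ≤
      ENNReal.ofReal (Real.exp (k - n * r ^ 2 / 8)) := fun N hN => by
    have h1 : ∑ j, rootMass f k j * √((N j : ℝ) / n) ≤ Real.exp (k / n - r ^ 2 / 4) := by
      have h2 := (Finset.mem_filter.1 hN).2
      have h3 := Real.add_one_le_exp (k / n - r ^ 2 / 4)
      linarith
    refine (hf.sampleLaw_likelihood_gt_le hk _ h1).trans_eq ?_
    congr 2
    field_simp
    ring
  refine (Finset.sum_le_sum hterm).trans ?_
  rw [Finset.sum_const, nsmul_eq_mul, ← ENNReal.ofReal_natCast, ← ENNReal.ofReal_mul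
    (Nat.cast_nonneg _)]
  refine ENNReal.ofReal_le_ofReal ?_
  -- The exponents add up to 4k + D - nr²/8, where 4k ≤ D and 2D ≤ nr²/16.
  have hcard : (G.card : ℝ) ≤ Real.exp (3 * k + D) := by
    refine le_trans ?_ (card_filter_sum_le_exp (m := n + 2) hk (by exact_mod_cast hkn1))
    exact_mod_cast Finset.card_filter_le _ _
  calc (G.card : ℝ) * Real.exp (k - n * r ^ 2 / 8)
      ≤ Real.exp (3 * k + D) * Real.exp (k - n * r ^ 2 / 8) := by gcongr
    _ = Real.exp (4 * k + D - n * r ^ 2 / 8) := by rw [← Real.exp_add]; congr 1; ring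
    _ ≤ _ := Real.exp_le_exp.2 (by linarith)

/-! ### Small prior mass -/

theorem lintegral_likelihoodRatio (hf : BoundedDensity f c C) {n k : ℕ} (hk : 1 ≤ k)
    {θ : Fin k → ℝ} (hθ : θ ∈ stdSimplex ℝ (Fin k)) :
    ∫⁻ x, likelihoodRatio f x θ ∂sampleLaw f n = 1 := by
  have h := hf.lintegral_sampleLaw_prod n (hf.measurable_ratio θ).ennreal_ofReal
  rw [hf.lintegral_ratio hk hθ, one_pow] at h
  exact h

theorem measurable_likelihoodRatio (hf : BoundedDensity f c C) {n k : ℕ} (x : Fin n → ℝ) :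
    Measurable fun θ : Fin k → ℝ => likelihoodRatio f x θ :=
  (hf.measurable_likelihoodRatio_uncurry n k).of_uncurry_left

/-- The part of the marginal likelihood that comes from a set is of the order of its prior mass. -/
theorem sampleLaw_setLIntegral_likelihood_gt_le (hf : BoundedDensity f c C) {n k : ℕ} (hk : 1 ≤ k)
    {a : ℝ} (ha : 0 < a) {S : Set (Fin k → ℝ)} {w : ℝ}
    (hS : (symmDirichlet k a).real S ≤ Real.exp (-(2 * w))) :
    sampleLaw f n {x | ENNReal.ofReal (Real.exp (-w)) * trueLikelihood f x <
      ∫⁻ θ in S, likelihood x θ ∂symmDirichlet k a} ≤ ENNReal.ofReal (Real.exp (-w)) := by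
  have := isProbabilityMeasure_symmDirichlet k ha
  have := hf.isProbabilityMeasure_sampleLaw n
  have hmeas := hf.measurable_likelihoodRatio_uncurry n k
  have hZm : Measurable fun x : Fin n → ℝ =>
      ∫⁻ θ in S, likelihoodRatio f x θ ∂symmDirichlet k a := hmeas.lintegral_prod_right'
  -- By Tonelli the mean of this integral is the prior mass of S, each likelihood ratio having mean
  -- one.
  have hZ : ∫⁻ x, ∫⁻ θ in S, likelihoodRatio f x θ ∂symmDirichlet k a ∂sampleLaw f n ≤
      ENNReal.ofReal (Real.exp (-(2 * w))) := by
    rw [lintegral_lintegral_swap hmeas.aemeasurable]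
    have h1 : ∀ᵐ θ ∂(symmDirichlet k a).restrict S,
        ∫⁻ x, likelihoodRatio f x θ ∂sampleLaw f n = 1 := by
      filter_upwards [ae_restrict_of_ae (ae_mem_stdSimplex hk ha)] with θ hθ
      exact hf.lintegral_likelihoodRatio hk hθ
    rw [lintegral_congr_ae h1, setLIntegral_one]
    exact ENNReal.le_ofReal_iff_toReal_le (measure_ne_top _ _) (Real.exp_pos _).le |>.2 hS
  have hM := meas_ge_le_lintegral_div (μ := sampleLaw f n) hZm.aemeasurable
    (ε := ENNReal.ofReal (Real.exp (-w))) (by simp [Real.exp_pos]) ENNReal.ofReal_ne_top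
  refine (measure_mono fun x hx => ?_).trans (hM.trans ?_)
  · have hx' : ENNReal.ofReal (Real.exp (-w)) * trueLikelihood f x <
      ∫⁻ θ in S, likelihood x θ ∂symmDirichlet k a := hx
    simp_rw [hf.likelihood_eq] at hx'
    rw [lintegral_mul_const _ (hf.measurable_likelihoodRatio x)] at hx'
    have h1 := lt_of_mul_lt_mul_right' hx'
    change ENNReal.ofReal (Real.exp (-w)) ≤ ∫⁻ θ in S, likelihoodRatio f x θ ∂symmDirichlet k a
    exact h1.le
  · refine (ENNReal.div_le_div_right hZ _).trans_eq ?_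
    rw [← ENNReal.ofReal_div_of_pos (Real.exp_pos _), ← Real.exp_sub]
    congr 2; ring

/-- The part of the marginal likelihood that comes from outside a Hellinger ball is uniformly
small, whatever the number of bins. -/
theorem exists_sampleLaw_compl_ball_le (hf : BoundedDensity f c C) (A : ℝ) :
    ∃ T : ℝ, 1 < T ∧ ∀ n k : ℕ, 1 ≤ k → T * k ≤ n → ∀ a, 0 < a → a ≤ A → ∀ r, 0 ≤ r →
      32 * Real.log n ≤ n * r ^ 2 →
      sampleLaw f n {x | ENNReal.ofReal (2 * Real.exp (-(n * r ^ 2 / 2048))) *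
          trueLikelihood f x < ∫⁻ θ in (hellingerBall f k r)ᶜ, likelihood x θ ∂symmDirichlet k a} ≤
        ENNReal.ofReal (2 * Real.exp (-(n * r ^ 2 / 2048))) := by
  obtain ⟨T, hT, hprior⟩ :=
    exists_symmDirichlet_hellingerBall_le_exp hf A (by norm_num : (0 : ℝ) < 32)
  refine ⟨max T (Real.exp 4), lt_max_of_lt_left hT, fun n k hk hTk a ha haA r hr hlog => ?_⟩
  have hk0 : (0 : ℝ) < k := by exact_mod_cast hk
  have hTk' : T * k ≤ n := le_trans (by gcongr; exact le_max_left _ _) hTk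
  have he : Real.exp 4 * k ≤ n := le_trans (by gcongr; exact le_max_right _ _) hTk
  have hkn : (k : ℝ) < n := by nlinarith
  have hn0 : (0 : ℝ) < n := hk0.trans hkn
  have := isProbabilityMeasure_symmDirichlet k ha
  have hbracket : ∀ ρ, 0 ≤ ρ → ∀ x : Fin n → ℝ,
      (¬ ∃ θ ∈ stdSimplex ℝ (Fin k), ρ < hellinger f (hist θ) ∧
        ENNReal.ofReal (Real.exp (-(n * ρ ^ 2 / 4))) * trueLikelihood f x < likelihood x θ) →
      ∫⁻ θ in (hellingerBall f k ρ)ᶜ, likelihood x θ ∂symmDirichlet k a ≤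
        ENNReal.ofReal (Real.exp (-(n * ρ ^ 2 / 4))) * trueLikelihood f x := by
    intro ρ _ x hx
    push Not at hx
    have hm : MeasurableSet (hellingerBall f k ρ)ᶜ := (hf.measurableSet_hellingerBall hk ρ).compl
    calc _ ≤ ∫⁻ _ in (hellingerBall f k ρ)ᶜ,
          ENNReal.ofReal (Real.exp (-(n * ρ ^ 2 / 4))) * trueLikelihood f x ∂symmDirichlet k a := by
          refine lintegral_mono_ae ?_
          filter_upwards [ae_restrict_of_ae (ae_mem_stdSimplex hk ha), ae_restrict_mem hm]
            with θ hθ hθ'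
          exact hx θ hθ (not_le.1 hθ')
      _ ≤ _ := by
          rw [setLIntegral_const]
          exact mul_le_of_le_one_right' prob_le_one
  have hexp : ∀ {u v : ℝ}, v ≤ u → ENNReal.ofReal (Real.exp (-u)) ≤
      ENNReal.ofReal (Real.exp (-v)) := fun h =>
    ENNReal.ofReal_le_ofReal (Real.exp_le_exp.2 (by linarith))
  have hnr : 0 ≤ n * r ^ 2 := by positivity
  set E := Real.exp (-(n * r ^ 2 / 2048))
  have hE : 0 < E := Real.exp_pos _
  have htwo : ENNReal.ofReal (2 * E) = ENNReal.ofReal E + ENNReal.ofReal E := by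
    rw [two_mul, ENNReal.ofReal_add hE.le hE.le]
  have hone : ENNReal.ofReal E ≤ ENNReal.ofReal (2 * E) := by rw [htwo]; exact le_self_add
  -- In the second case r is too small for the brackets. They work outside the ball of radius ρ with
  -- nρ² = 32D, and that ball is dismissed by its prior mass, at most exp(-D/32). Markov's
  -- inequality leaves exp(-D/64), and D > nr²/32 gives the constant 2048.
  rcases le_or_gt (32 * (k * Real.log (n / k))) (n * r ^ 2) with hcase | hcase
  · have h1 := hf.sampleLaw_exists_likelihood_gt_le hk he hr hcase
    refine (measure_mono fun x hx => ?_).trans (h1.trans ((hexp (by linarith)).trans hone))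
    by_contra hnot
    refine absurd (hbracket r hr x hnot) (not_le.2 (lt_of_le_of_lt ?_ hx))
    have h2 : ENNReal.ofReal (Real.exp (-(n * r ^ 2 / 4))) ≤ ENNReal.ofReal (2 * E) :=
      (hexp (by linarith)).trans hone
    gcongr
  · have hk2 : 2 ≤ k := by
      by_contra h
      obtain rfl : k = 1 := by omega
      simp only [Nat.cast_one, div_one, one_mul] at hcase
      linarith
    set D := k * Real.log (n / k)
    set ρ := √(32 * D / n)
    have hD : 0 < D := by linarith
    have hρ2 : n * ρ ^ 2 = 32 * D := by
      rw [Real.sq_sqrt (by positivity)]; field_simp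
    have h1 := hf.sampleLaw_exists_likelihood_gt_le hk he (Real.sqrt_nonneg (32 * D / n))
      hρ2.ge
    have h2 := hf.sampleLaw_setLIntegral_likelihood_gt_le (n := n) hk ha (w := D / 64)
      ((hprior n k hk2 hTk' a ha haA).trans_eq (by congr 2; ring))
    have hDE : ENNReal.ofReal (Real.exp (-(D / 64))) ≤ ENNReal.ofReal E := hexp (by linarith)
    have hDE' : ENNReal.ofReal (Real.exp (-(n * ρ ^ 2 / 16))) ≤ ENNReal.ofReal E :=
      hexp (by linarith)
    have hDE'' : ENNReal.ofReal (Real.exp (-(n * ρ ^ 2 / 4))) ≤ ENNReal.ofReal E :=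
      hexp (by linarith)
    rw [htwo]
    refine (measure_mono fun x hx => ?_).trans ((measure_union_le _ _).trans
      (add_le_add (h1.trans hDE') (h2.trans hDE)))
    by_contra hnot
    rw [mem_union, not_or] at hnot
    have hx' : (ENNReal.ofReal E + ENNReal.ofReal E) * trueLikelihood f x <
      ∫⁻ θ in (hellingerBall f k r)ᶜ, likelihood x θ ∂symmDirichlet k a := hx
    refine absurd ?_ hx'.not_ge
    calc ∫⁻ θ in (hellingerBall f k r)ᶜ, likelihood x θ ∂symmDirichlet k a
        ≤ ∫⁻ θ in (hellingerBall f k ρ)ᶜ ∪ hellingerBall f k ρ,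
            likelihood x θ ∂symmDirichlet k a := by
          rw [compl_union_self]
          exact lintegral_mono_set (subset_univ _)
      _ ≤ (∫⁻ θ in (hellingerBall f k ρ)ᶜ, likelihood x θ ∂symmDirichlet k a) +
            ∫⁻ θ in hellingerBall f k ρ, likelihood x θ ∂symmDirichlet k a :=
          lintegral_union_le _ _ _
      _ ≤ ENNReal.ofReal E * trueLikelihood f x + ENNReal.ofReal E * trueLikelihood f x := by
          refine add_le_add ((hbracket ρ (Real.sqrt_nonneg _) x hnot.1).trans (by gcongr)) ?_
          exact (not_lt.1 hnot.2).trans (by gcongr)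
      _ = _ := by rw [add_mul]

end BoundedDensity

/-! ### Posterior probabilities -/

theorem marginal_ne_top {α : ℕ → ℝ} {n k : ℕ} (hk : 1 ≤ k) (hα : 0 < α k) (x : Fin n → ℝ) :
    marginal α x k ≠ ⊤ := by
  have := isProbabilityMeasure_symmDirichlet k hα
  have h : ∀ᵐ θ ∂symmDirichlet k (α k), likelihood x θ ≤ ENNReal.ofReal k ^ n := by
    filter_upwards [ae_mem_stdSimplex hk hα] with θ hθ
    have hprod : ENNReal.ofReal k ^ n = ∏ _i : Fin n, ENNReal.ofReal k := by simp
    rw [hprod]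
    refine Finset.prod_le_prod' fun i _ => ENNReal.ofReal_le_ofReal ?_
    rw [hist]
    refine mul_le_of_le_one_right k.cast_nonneg ?_
    rw [← hθ.2]
    exact Finset.sum_le_sum fun j _ => indicator_le_self' (fun _ _ => hθ.1 j) _
  have h2 : marginal α x k ≤ ENNReal.ofReal k ^ n := by
    refine (lintegral_mono_ae h).trans ?_
    simp
  exact ne_top_of_le_ne_top (ENNReal.pow_ne_top ENNReal.ofReal_ne_top) h2

theorem posterior_apply {α : ℕ → ℝ} {n k : ℕ} (x : Fin n → ℝ) {S : Set (Fin k → ℝ)}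
    (hS : MeasurableSet S) :
    posterior α x k S = (marginal α x k)⁻¹ * ∫⁻ θ in S, likelihood x θ ∂symmDirichlet k (α k) := by
  rw [posterior, Measure.smul_apply, withDensity_apply _ hS, smul_eq_mul]

/-- A sample with a point outside (0, 1] has evidence zero and posterior zero, so only this
inequality holds for all samples. -/
theorem posterior_univ_le_one {α : ℕ → ℝ} {n : ℕ} (x : Fin n → ℝ) (k : ℕ) :
    posterior α x k univ ≤ 1 := by
  rw [posterior_apply x MeasurableSet.univ, Measure.restrict_univ]
  exact ENNReal.inv_mul_le_one _

theorem abs_posterior_sub_one_le {α : ℕ → ℝ} {n k : ℕ} (hk : 1 ≤ k) (hα : 0 < α k)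
    {x : Fin n → ℝ} {S : Set (Fin k → ℝ)} (hS : MeasurableSet S) {b : ℝ} (hb : 0 ≤ b)
    (h0 : marginal α x k ≠ 0)
    (h : ∫⁻ θ in Sᶜ, likelihood x θ ∂symmDirichlet k (α k) ≤ ENNReal.ofReal b * marginal α x k) :
    |(posterior α x k).real S - 1| ≤ b := by
  have htop := marginal_ne_top hk hα x
  have hprob : IsProbabilityMeasure (posterior α x k) := by
    constructor
    rw [posterior_apply x MeasurableSet.univ, Measure.restrict_univ]
    exact ENNReal.inv_mul_cancel h0 htop
  have h1 := probReal_compl_eq_one_sub (μ := posterior α x k) hS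
  have h2 : (posterior α x k).real Sᶜ ≤ b := by
    refine ENNReal.toReal_le_of_le_ofReal hb ?_
    rw [posterior_apply x hS.compl]
    calc _ ≤ (marginal α x k)⁻¹ * (ENNReal.ofReal b * marginal α x k) := by gcongr
      _ = ENNReal.ofReal b := by
          rw [mul_comm, mul_assoc, ENNReal.mul_inv_cancel h0 htop, mul_one]
  have h3 : 0 ≤ (posterior α x k).real Sᶜ := measureReal_nonneg
  rw [abs_sub_comm, abs_of_nonneg (by linarith)]
  linarith

theorem ContractsAt.mono {α : ℕ → ℝ} {khat : ∀ n : ℕ, (Fin n → ℝ) → ℕ} {r s : ℕ → ℝ}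
    (h : ContractsAt f α khat r) (hrs : ∀ᶠ n in atTop, r n ≤ s n) : ContractsAt f α khat s := by
  intro δ hδ
  refine tendsto_of_tendsto_of_tendsto_of_le_of_le' tendsto_const_nhds (h δ hδ)
    (Eventually.of_forall fun _ => zero_le) ?_
  filter_upwards [hrs] with n hn
  refine measure_mono fun x hx => ?_
  have hx' : δ ≤ |(posterior α x (khat n x)).real (hellingerBall f (khat n x) (s n)) - 1| := hx
  refine hx'.trans ?_
  set ν := posterior α x (khat n x)
  have h1 : ν univ ≤ 1 := posterior_univ_le_one x _
  have : IsFiniteMeasure ν := ⟨h1.trans_lt ENNReal.one_lt_top⟩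
  have h2 : ν.real (hellingerBall f (khat n x) (r n)) ≤ ν.real (hellingerBall f (khat n x) (s n)) :=
    measureReal_mono (hellingerBall_mono f _ hn)
  have h3 : ν.real (hellingerBall f (khat n x) (s n)) ≤ 1 :=
    (measureReal_mono (subset_univ _)).trans
      (ENNReal.toReal_le_of_le_ofReal zero_le_one (by simpa using h1))
  rw [abs_sub_comm, abs_of_nonneg (by linarith), abs_sub_comm, abs_of_nonneg (by linarith)]
  linarith

/-! ### The oracle rate -/

theorem epsOracle_sq (f : ℝ → ℝ) (α : ℕ → ℝ) (K : ℝ) (kn : ℕ → ℕ) (m : ℕ → ℝ) (n : ℕ) :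
    epsOracle f α K kn m n ^ 2 = max
      (sInf ((fun k => epsRadius f α K n k ^ 2) ''
        {k | k ∈ Finset.Icc 1 (kn n) ∧ m n * Real.log n / n ≤ epsRadius f α K n k ^ 2}))
      (m n * Real.log n / n) := by
  refine Real.sq_sqrt (le_max_of_le_left (Real.sInf_nonneg ?_))
  rintro _ ⟨k, -, rfl⟩
  exact sq_nonneg _

theorem le_epsOracle_sq (f : ℝ → ℝ) (α : ℕ → ℝ) (K : ℝ) (kn : ℕ → ℕ) (m : ℕ → ℝ) (n : ℕ) :
    m n * Real.log n / n ≤ epsOracle f α K kn m n ^ 2 := by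
  rw [epsOracle_sq]
  exact le_max_right _ _

/-- If no k satisfies the constraint, every radius, for instance that of k = 1, lies below the
threshold. Otherwise the infimum is over a finite set and is attained. -/
theorem exists_epsRadius_sq_le_epsOracle_sq (f : ℝ → ℝ) (α : ℕ → ℝ) (K : ℝ) {kn : ℕ → ℕ}
    (hkn : ∀ n, 1 ≤ kn n) (m : ℕ → ℝ) (n : ℕ) :
    ∃ k ∈ Finset.Icc 1 (kn n), epsRadius f α K n k ^ 2 ≤ epsOracle f α K kn m n ^ 2 := by
  rw [epsOracle_sq]
  set S := {k | k ∈ Finset.Icc 1 (kn n) ∧ m n * Real.log n / n ≤ epsRadius f α K n k ^ 2}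
  rcases S.eq_empty_or_nonempty with hS | hS
  · have h1 : 1 ∈ Finset.Icc 1 (kn n) := Finset.mem_Icc.2 ⟨le_rfl, hkn n⟩
    refine ⟨1, h1, le_max_of_le_right ?_⟩
    by_contra! h
    exact eq_empty_iff_forall_notMem.1 hS 1 ⟨h1, h.le⟩
  · have hfin : S.Finite := (Finset.Icc 1 (kn n)).finite_toSet.subset fun k hk => hk.1
    obtain ⟨k, hk, hk'⟩ := (hS.image fun k => epsRadius f α K n k ^ 2).csInf_mem (hfin.image _)
    exact ⟨k, hk.1, le_max_of_le_left hk'.le⟩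

theorem epsOracle_sq_le_max {f : ℝ → ℝ} {α : ℕ → ℝ} {K : ℝ} {kn : ℕ → ℕ} {m : ℕ → ℝ} {n k : ℕ}
    (hk : k ∈ Finset.Icc 1 (kn n)) (h : m n * Real.log n / n ≤ epsRadius f α K n k ^ 2) :
    epsOracle f α K kn m n ^ 2 ≤ max (epsRadius f α K n k ^ 2) (m n * Real.log n / n) := by
  rw [epsOracle_sq]
  refine max_le_max_right _ (csInf_le ⟨0, ?_⟩ ⟨k, ⟨hk, h⟩, rfl⟩)
  rintro _ ⟨k, -, rfl⟩
  exact sq_nonneg _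

/-- With y = n/k the quantity is n log y / y, and log y / y decreases for y ≥ e. -/
theorem mul_log_div_mono {n k l : ℝ} (hk : 0 < k) (hkl : k ≤ l) (hln : Real.exp 1 * l ≤ n) :
    k * Real.log (n / k) ≤ l * Real.log (n / l) := by
  have hl : 0 < l := hk.trans_le hkl
  have hn : 0 < n := (mul_pos (Real.exp_pos 1) hl).trans_le hln
  have h1 : Real.exp 1 ≤ n / l := (le_div_iff₀ hl).2 hln
  have h2 : n / l ≤ n / k := by gcongr
  have h3 := Real.log_div_self_antitoneOn h1 (h1.trans h2) h2
  simp only at h3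
  have h4 : ∀ y : ℝ, 0 < y → y * Real.log (n / y) = n * (Real.log (n / y) / (n / y)) :=
    fun y hy => by field_simp
  rw [h4 k hk, h4 l hl]
  gcongr

theorem tendsto_natCast_div_log : Tendsto (fun n : ℕ => (n : ℝ) / Real.log n) atTop atTop := by
  have h1 : Tendsto (fun n : ℕ => Real.log n / n) atTop (𝓝 0) :=
    (Real.tendsto_pow_log_div_mul_add_atTop 1 0 1 one_ne_zero).comp tendsto_natCast_atTop_atTop
      |>.congr fun n => by simp
  have h2 : Tendsto (fun n : ℕ => Real.log n / n) atTop (𝓝[>] 0) := by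
    refine tendsto_nhdsWithin_iff.2 ⟨h1, ?_⟩
    filter_upwards [eventually_gt_atTop 1] with n hn
    have h3 : (1 : ℝ) < n := by exact_mod_cast hn
    exact div_pos (Real.log_pos h3) (by linarith)
  exact h2.inv_tendsto_nhdsGT_zero.congr fun n => by simp

theorem tendsto_log_natCast : Tendsto (fun n : ℕ => Real.log n) atTop atTop :=
  Real.tendsto_log_atTop.comp tendsto_natCast_atTop_atTop

/-- In this range of k the two bounds for the radius agree up to a constant. Half of 1 - p is given
up to absorb log 2. -/
theorem eventually_log_div_ge {p : ℝ} (hp : p < 1) :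
    ∀ᶠ n : ℕ in atTop, ∀ k : ℕ, 1 ≤ k → (k : ℝ) ≤ 2 * (n : ℝ) ^ p →
      (1 - p) / 2 * Real.log n ≤ Real.log (n / k) := by
  have hq : 0 < (1 - p) / 2 := by linarith
  have h1 := (tendsto_log_natCast.const_mul_atTop hq).eventually_ge_atTop (Real.log 2)
  filter_upwards [h1, eventually_gt_atTop 0] with n hn hn0 k hk hkn
  have hn0' : (0 : ℝ) < n := by exact_mod_cast hn0
  have hk0 : (0 : ℝ) < k := by exact_mod_cast hk
  rw [Real.log_div hn0'.ne' hk0.ne']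
  have h2 := Real.log_le_log hk0 hkn
  rw [Real.log_mul two_ne_zero (Real.rpow_pos_of_pos hn0' _).ne', Real.log_rpow hn0'] at h2
  linarith

/-- For Hölder densities, some number of bins not larger than a given one balances bias and
prior mass at a level that is bounded by the radius of the given number of bins. -/
theorem exists_bins_le_epsRadius_sq (hf : BoundedDensity f c C) {α : ℕ → ℝ} {A K : ℝ}
    (hK : 0 < K) (hα : ∀ k : ℕ, 1 ≤ k → 0 < α k ∧ α k ≤ A)
    {kn : ℕ → ℕ}
    (hkn : (fun n : ℕ => (kn n : ℝ)) =O[atTop] fun n : ℕ => (n : ℝ) / Real.log n)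
    {β L : ℝ} (hβ : 0 < β) (hL : 0 < L)
    (hH : ∀ x ∈ Icc (0 : ℝ) 1, ∀ y ∈ Icc (0 : ℝ) 1, |f x - f y| ≤ L * |x - y| ^ β) :
    ∃ Q : ℝ, 0 < Q ∧ ∀ᶠ n : ℕ in atTop, ∀ k ∈ Finset.Icc 1 (kn n), ∀ E : ℝ,
      epsRadius f α K n k ^ 2 ≤ E → Real.log n / n ≤ E →
      ∃ l ∈ Finset.Icc 1 (kn n), biasSq f l + l * Real.log n / n ≤ Q * E := by
  obtain ⟨T, hT, hlow⟩ := exists_le_epsRadius_sq hf hK hα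
  have hc := hf.pos
  set p := 1 / (2 * β + 1)
  have hp0 : 0 < p := by positivity
  have hp1 : p < 1 := by
    simp only [p]; rw [div_lt_one (by positivity)]; linarith
  have hpβ : p * (2 * β) = 1 - p := by
    simp only [p]; field_simp; ring
  set W := 128 / (1 - p)
  have hW : 0 < W := div_pos (by norm_num) (by linarith)
  refine ⟨K ^ 2 + 1 + (1 + L ^ 2 / c) * W, by positivity, ?_⟩
  have hnp : ∀ᶠ n : ℕ in atTop, (1 : ℝ) ≤ (n : ℝ) ^ p :=
    ((tendsto_rpow_atTop hp0).comp tendsto_natCast_atTop_atTop).eventually_ge_atTop 1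
  filter_upwards [eventually_mul_le_of_isBigO hkn (one_pos.trans hT),
    eventually_mul_le_of_isBigO hkn (Real.exp_pos 1), eventually_log_div_ge hp1, hnp,
    tendsto_log_natCast.eventually_ge_atTop 1, eventually_gt_atTop 0]
    with n hTn hen hlogk hnp1 hlog1 hn0 k hk E hE hlogE
  obtain ⟨hk1, hkkn⟩ := Finset.mem_Icc.1 hk
  have hn0' : (0 : ℝ) < n := by exact_mod_cast hn0
  have hk0 : (0 : ℝ) < k := by exact_mod_cast hk1
  have hkkn' : (k : ℝ) ≤ kn n := by exact_mod_cast hkkn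
  have hTk : T * k ≤ n := le_trans (by gcongr) hTn
  have hek : Real.exp 1 * k ≤ n := le_trans (by gcongr) hen
  have hE0 : 0 ≤ E := le_trans (by positivity) hE
  have hbias : biasSq f k ≤ K ^ 2 * E :=
    (biasSq_le_epsRadius_sq hf hK hk1 (hα k hk1).1).trans (by gcongr)
  have hWl : ∀ l : ℕ, 1 ≤ l → (l : ℝ) ≤ 2 * (n : ℝ) ^ p → l * Real.log (n / l) / n ≤ 64 * E →
      l * Real.log n / n ≤ W * E := fun l hl hln h => by
    have h1 := hlogk l hl hln
    have h1p : 0 < 1 - p := by linarith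
    have h2 : (l * ((1 - p) / 2 * Real.log n)) / n ≤ 64 * E := le_trans (by gcongr) h
    have h3 : l * Real.log n / n = 2 / (1 - p) * ((l * ((1 - p) / 2 * Real.log n)) / n) := by
      field_simp
    rw [h3]
    calc _ ≤ 2 / (1 - p) * (64 * E) := by gcongr
      _ = W * E := by simp only [W]; ring
  have hLc : 0 ≤ L ^ 2 / c * (W * E) := by positivity
  have hWE : 0 ≤ W * E := by positivity
  have hKE : 0 ≤ K ^ 2 * E := by positivity
  -- For one bin the prior gives no lower bound for the radius; the assumption log n / n ≤ E
  -- replaces it.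
  rcases Nat.lt_or_ge k 2 with hk2 | hk2
  · obtain rfl : k = 1 := by omega
    refine ⟨1, hk, ?_⟩
    rw [Nat.cast_one, one_mul]
    linarith
  have hvar : k * Real.log (n / k) / n ≤ 64 * E := (hlow n k hk2 hTk).trans (by gcongr)
  -- For k above k₁, log(n/k) may be much smaller than log n, and k itself would not do. The
  -- quantity k₁ log(n/k₁) is still at most k log(n/k), and the bias at k₁ is of the order n^(p-1),
  -- at most a constant times k₁ log n / n.
  set k₁ := ⌈(n : ℝ) ^ p⌉₊
  have hk₁ : 1 ≤ k₁ := Nat.one_le_ceil_iff.2 (by linarith)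
  have hk₁' : (k₁ : ℝ) ≤ 2 * (n : ℝ) ^ p := by
    have := Nat.ceil_lt_add_one (zero_le_one.trans hnp1)
    linarith
  rcases le_total k k₁ with hle | hle
  · refine ⟨k, hk, ?_⟩
    have := hWl k hk1 (le_trans (by exact_mod_cast hle) hk₁') hvar
    linarith
  · refine ⟨k₁, Finset.mem_Icc.2 ⟨hk₁, hle.trans hkkn⟩, ?_⟩
    have hk₁0 : (0 : ℝ) < k₁ := by exact_mod_cast hk₁
    have h1 := mul_log_div_mono hk₁0 (by exact_mod_cast hle : (k₁ : ℝ) ≤ k) hek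
    have h2 := hWl k₁ hk₁ hk₁' (le_trans (by gcongr) hvar)
    have h3 : biasSq f k₁ ≤ L ^ 2 / c * (W * E) := by
      refine (hf.biasSq_le_of_holder hβ hL hH hk₁).trans ?_
      gcongr
      refine le_trans ?_ h2
      calc (k₁ : ℝ) ^ (-(2 * β)) ≤ ((n : ℝ) ^ p) ^ (-(2 * β)) :=
            Real.rpow_le_rpow_of_nonpos (by positivity) (Nat.le_ceil _) (by linarith)
        _ = (n : ℝ) ^ p * 1 / n := by
            rw [← Real.rpow_mul hn0'.le, mul_neg, hpβ, mul_one, neg_sub, Real.rpow_sub hn0',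
              Real.rpow_one]
        _ ≤ k₁ * Real.log n / n := by
            gcongr
            exact Nat.le_ceil _
    linarith

/-- The empirical Bayes posterior contracts at the oracle rate. -/
theorem contractsAt_epsOracle (hf : BoundedDensity f c C) {α : ℕ → ℝ} {A a H K : ℝ} (ha : 0 < a)
    (hα : ∀ k : ℕ, 1 ≤ k → a * (k : ℝ) ^ (-H) ≤ α k ∧ α k ≤ A) (hK : 0 < K)
    {kn : ℕ → ℕ} (hkn_pos : ∀ n, 1 ≤ kn n)
    (hkn : (fun n : ℕ => (kn n : ℝ)) =O[atTop] fun n : ℕ => (n : ℝ) / Real.log n)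
    {β L : ℝ} (hβ : 0 < β) (hL : 0 < L)
    (hH : ∀ x ∈ Icc (0 : ℝ) 1, ∀ y ∈ Icc (0 : ℝ) 1, |f x - f y| ≤ L * |x - y| ^ β)
    {m : ℕ → ℝ} (hm : Tendsto m atTop atTop) {khat : ∀ n : ℕ, (Fin n → ℝ) → ℕ}
    (hkhat : IsMMLE α kn khat) {M : ℕ → ℝ} (hM : Tendsto M atTop atTop) :
    ContractsAt f α khat fun n => M n * epsOracle f α K kn m n := by
  obtain ⟨B, N, hB, hmarg⟩ := hf.exists_marginal_lower ha hα
  obtain ⟨T, hT, hcompl⟩ := hf.exists_sampleLaw_compl_ball_le A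
  obtain ⟨Q, hQ, hbins⟩ := exists_bins_le_epsRadius_sq hf hK
    (fun k hk => ⟨pos_of_rpow_le ha hα hk, (hα k hk).2⟩) hkn hβ hL hH
  intro δ hδ
  have hinv : Tendsto (fun n : ℕ => 3 * (n : ℝ)⁻¹) atTop (𝓝 0) := by
    simpa using (tendsto_inv_atTop_nhds_zero_nat (𝕜 := ℝ)).const_mul 3
  have hlim : Tendsto (fun n : ℕ => ENNReal.ofReal (3 * (n : ℝ)⁻¹)) atTop (𝓝 0) := by
    simpa using ENNReal.tendsto_ofReal hinv
  refine tendsto_of_tendsto_of_tendsto_of_le_of_le' tendsto_const_nhds hlim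
    (Eventually.of_forall fun _ => zero_le) ?_
  filter_upwards [hbins, eventually_mul_le_of_isBigO hkn (one_pos.trans hT),
    hm.eventually_ge_atTop 1, hM.eventually_ge_atTop (2048 * (B * Q + 6)),
    tendsto_log_natCast.eventually_ge_atTop 2, eventually_ge_atTop N, eventually_gt_atTop 0,
    hinv.eventually_lt_const hδ] with n hbn hTn hmn hMn hlog2 hN hn0 hδn
  have hn0' : (0 : ℝ) < n := by exact_mod_cast hn0
  have := hf.isProbabilityMeasure_sampleLaw n
  set ε := epsOracle f α K kn m n
  have hε0 : 0 ≤ ε := Real.sqrt_nonneg _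
  set τ := n * ε ^ 2
  have hτlog : Real.log n ≤ τ := by
    have h1 := le_epsOracle_sq f α K kn m n
    rw [div_le_iff₀ hn0'] at h1
    nlinarith
  have hlogE : Real.log n / n ≤ ε ^ 2 := by
    rw [div_le_iff₀ hn0']; linarith
  have hτ2 : 2 ≤ τ := hlog2.trans hτlog
  obtain ⟨k₀, hk₀, hk₀ε⟩ := exists_epsRadius_sq_le_epsOracle_sq f α K hkn_pos m n
  obtain ⟨l, hl, hlε⟩ := hbn k₀ hk₀ (ε ^ 2) hk₀ε hlogE
  have hbin_le : ∀ k ∈ Finset.Icc 1 (kn n), T * k ≤ n := fun k hk => by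
    have h1 : (k : ℝ) ≤ kn n := by exact_mod_cast (Finset.mem_Icc.1 hk).2
    exact le_trans (by gcongr) hTn
  have hle_n : ∀ k ∈ Finset.Icc 1 (kn n), k ≤ n := fun k hk => by
    have h1 := hbin_le k hk
    have h2 : (0 : ℝ) ≤ k := by positivity
    have : (k : ℝ) ≤ n := by nlinarith
    exact_mod_cast this
  have hBQ : 0 < B * Q := by positivity
  have hM1 : 1 ≤ M n := by linarith
  have hMM : M n ≤ M n ^ 2 := by nlinarith
  have hMτ : (B * Q + 6) * τ ≤ n * (M n * ε) ^ 2 / 2048 := by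
    have : n * (M n * ε) ^ 2 = M n ^ 2 * τ := by simp only [τ]; ring
    rw [this]
    have h1 : 2048 * (B * Q + 6) * τ ≤ M n ^ 2 * τ := by gcongr; linarith
    linarith
  set bad₁ := {x : Fin n → ℝ | marginal α x l <
    ENNReal.ofReal (Real.exp (-(B * (n * biasSq f l + l * Real.log n) + 2 + τ))) *
      trueLikelihood f x}
  set bad₂ : ℕ → Set (Fin n → ℝ) := fun k =>
    {x | ENNReal.ofReal (2 * Real.exp (-(n * (M n * ε) ^ 2 / 2048))) * trueLikelihood f x <
      ∫⁻ θ in (hellingerBall f k (M n * ε))ᶜ, likelihood x θ ∂symmDirichlet k (α k)}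
  have hbad₁ : sampleLaw f n bad₁ ≤ ENNReal.ofReal (Real.exp (-τ)) :=
    hmarg n l hN (Finset.mem_Icc.1 hl).1 (hle_n l hl) τ
  have hbad₂ : ∀ k ∈ Finset.Icc 1 (kn n), sampleLaw f n (bad₂ k) ≤
      -- Of the two factors exp(-τ) ≤ 1/n, one pays for the union over at most n values of k.
      ENNReal.ofReal (2 * Real.exp (-(2 * τ))) := fun k hk => by
    have hk1 := (Finset.mem_Icc.1 hk).1
    refine (hcompl n k hk1 (hbin_le k hk) (α k) (pos_of_rpow_le ha hα hk1) (hα k hk1).2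
      (M n * ε) (by positivity) ?_).trans ?_
    · have : 32 * τ ≤ n * (M n * ε) ^ 2 := by nlinarith
      linarith
    · gcongr
      nlinarith
  have hsub : {x : Fin n → ℝ | δ ≤ |(posterior α x (khat n x)).real
      (hellingerBall f (khat n x) (M n * ε)) - 1|} ⊆
      bad₁ ∪ ⋃ k ∈ Finset.Icc 1 (kn n), bad₂ k := by
    intro x hx
    by_contra hnot
    rw [mem_union, not_or, mem_iUnion₂, not_exists] at hnot
    obtain ⟨hn1, hn2⟩ := hnot
    obtain ⟨hkm, hmax⟩ := hkhat n x
    have hk1 := (Finset.mem_Icc.1 hkm).1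
    -- The only use of maximality: the evidence of the selected number of bins is at least that of
    -- l. The posterior mass outside the ball is then at most 2 exp(-(BQ + 6)τ + (BQ + 3)τ).
    have hlow : ENNReal.ofReal (Real.exp (-((B * Q + 3) * τ))) * trueLikelihood f x ≤
        marginal α x (khat n x) := by
      refine le_trans ?_ ((not_lt.1 hn1).trans (hmax l hl))
      gcongr
      have h1 : n * biasSq f l + l * Real.log n ≤ Q * τ := by
        calc _ = n * (biasSq f l + l * Real.log n / n) := by field_simp
          _ ≤ n * (Q * ε ^ 2) := by gcongr
          _ = Q * τ := by simp only [τ]; ring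
      have h2 : B * (n * biasSq f l + l * Real.log n) ≤ B * (Q * τ) := by gcongr
      linarith
    have hup : ∫⁻ θ in (hellingerBall f (khat n x) (M n * ε))ᶜ, likelihood x θ
        ∂symmDirichlet (khat n x) (α (khat n x)) ≤
        ENNReal.ofReal (2 * Real.exp (-(n * (M n * ε) ^ 2 / 2048))) * trueLikelihood f x :=
      not_lt.1 fun h => hn2 _ ⟨hkm, h⟩
    have hpos : marginal α x (khat n x) ≠ 0 := by
      refine (lt_of_lt_of_le ?_ hlow).ne'
      exact ENNReal.mul_pos (ENNReal.ofReal_pos.2 (Real.exp_pos _)).ne'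
        (hf.trueLikelihood_ne_zero x)
    have hpost := abs_posterior_sub_one_le hk1 (pos_of_rpow_le ha hα hk1)
      (hf.measurableSet_hellingerBall hk1 (M n * ε)) (b := 2 * Real.exp (-τ)) (by positivity)
      hpos (by
        refine hup.trans (le_trans ?_ (mul_le_mul_right hlow _))
        rw [← mul_assoc, ← ENNReal.ofReal_mul (by positivity), mul_assoc, ← Real.exp_add]
        gcongr
        nlinarith)
    have hx' : δ ≤ |(posterior α x (khat n x)).real
      (hellingerBall f (khat n x) (M n * ε)) - 1| := hx
    have h3 : Real.exp (-τ) ≤ (n : ℝ)⁻¹ := by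
      rw [← Real.exp_log hn0', ← Real.exp_neg]
      exact Real.exp_le_exp.2 (by linarith)
    have h4 : (0 : ℝ) < (n : ℝ)⁻¹ := by positivity
    linarith
  have hexp : Real.exp (-τ) ≤ (n : ℝ)⁻¹ := by
    rw [← Real.exp_log hn0', ← Real.exp_neg]
    exact Real.exp_le_exp.2 (by linarith)
  refine (measure_mono hsub).trans ((measure_union_le _ _).trans ?_)
  have hunion : sampleLaw f n (⋃ k ∈ Finset.Icc 1 (kn n), bad₂ k) ≤
      ENNReal.ofReal (2 * (n : ℝ)⁻¹) := by
    refine (measure_biUnion_finset_le _ _).trans ((Finset.sum_le_sum hbad₂).trans ?_)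
    rw [Finset.sum_const, Nat.card_Icc, Nat.add_sub_cancel, nsmul_eq_mul,
      ← ENNReal.ofReal_natCast, ← ENNReal.ofReal_mul (Nat.cast_nonneg _)]
    refine ENNReal.ofReal_le_ofReal ?_
    have h1 : (kn n : ℝ) ≤ n := by
      exact_mod_cast hle_n _ (Finset.mem_Icc.2 ⟨hkn_pos n, le_rfl⟩)
    have h2 : Real.exp (-(2 * τ)) = Real.exp (-τ) * Real.exp (-τ) := by
      rw [← Real.exp_add]; congr 1; ring
    calc (kn n : ℝ) * (2 * Real.exp (-(2 * τ))) ≤ n * (2 * ((n : ℝ)⁻¹ * (n : ℝ)⁻¹)) := by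
          rw [h2]; gcongr
      _ = _ := by field_simp
  calc _ ≤ ENNReal.ofReal ((n : ℝ)⁻¹) + ENNReal.ofReal (2 * (n : ℝ)⁻¹) :=
        add_le_add (hbad₁.trans (ENNReal.ofReal_le_ofReal hexp)) hunion
    _ = _ := by
        rw [← ENNReal.ofReal_add (by positivity) (by positivity)]
        congr 1; ring

/-- The oracle rate is at most the minimax rate up to a logarithm. -/
theorem exists_epsOracle_le (hf : BoundedDensity f c C) {α : ℕ → ℝ} {A a H K : ℝ} (ha : 0 < a)
    (hα : ∀ k : ℕ, 1 ≤ k → a * (k : ℝ) ^ (-H) ≤ α k ∧ α k ≤ A) (hK : 0 < K)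
    {kn : ℕ → ℕ} (hkn_pos : ∀ n, 1 ≤ kn n)
    (hkn : (fun n : ℕ => (kn n : ℝ)) =O[atTop] fun n : ℕ => (n : ℝ) / Real.log n)
    {β L : ℝ} (hβ : 0 < β) (hL : 0 < L)
    (hH : ∀ x ∈ Icc (0 : ℝ) 1, ∀ y ∈ Icc (0 : ℝ) 1, |f x - f y| ≤ L * |x - y| ^ β)
    (hbig : (fun n : ℕ => ((n : ℝ) / Real.log n) ^ (1 / (2 * β + 1))) =O[atTop]
      fun n : ℕ => (kn n : ℝ))
    {m : ℕ → ℝ} (hm : m =o[atTop] fun n : ℕ => ((n : ℝ) / Real.log n) ^ (1 / (2 * β + 1))) :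
    ∃ D : ℝ, 0 < D ∧ ∀ᶠ n : ℕ in atTop,
      epsOracle f α K kn m n ≤ D * ((n : ℝ) / Real.log n) ^ (-β / (2 * β + 1)) := by
  obtain ⟨T, hT, hlow⟩ := exists_le_epsRadius_sq hf hK
    fun k hk => ⟨pos_of_rpow_le ha hα hk, (hα k hk).2⟩
  obtain ⟨B, N, hB, hup⟩ := exists_epsRadius_sq_le hf ha hα hK
  obtain ⟨D₀, hD₀⟩ := hbig.bound
  have hc := hf.pos
  set p := 1 / (2 * β + 1)
  have hp0 : 0 < p := by positivity
  have hp1 : p < 1 := by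
    simp only [p]; rw [div_lt_one (by positivity)]; linarith
  have hp1' : 0 < 1 - p := by linarith
  have hpβ : p * (2 * β) = 1 - p := by
    simp only [p]; field_simp; ring
  set D := max D₀ 1
  have hD1 : 1 ≤ D := le_max_right _ _
  set R := B * (L ^ 2 / c * D ^ (2 * β) + 2) + 1
  have hR : 0 < R := by positivity
  refine ⟨√R, Real.sqrt_pos.2 hR, ?_⟩
  have hspos := (tendsto_rpow_atTop hp0).comp tendsto_natCast_div_log
  -- With s = n / log n and y = s^p, the lower bound gives ε_n(k)² ≥ (1 - p)/(128D) · y/s at the k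
  -- chosen below. So the slow growth of m makes this k admissible for the oracle.
  have hκ : 0 < min 1 ((1 - p) / (128 * D)) := by positivity
  filter_upwards [hD₀, hm.bound hκ, hspos.eventually_ge_atTop (2 * D),
    eventually_mul_le_of_isBigO hkn (one_pos.trans hT), eventually_log_div_ge hp1,
    tendsto_log_natCast.eventually_ge_atTop 1, eventually_ge_atTop N, eventually_gt_atTop 0]
    with n hDn hmn hsn hTn hlogk hlog1 hN hn0
  have hn0' : (0 : ℝ) < n := by exact_mod_cast hn0
  set s : ℝ := n / Real.log n
  have hs0 : 0 < s := by positivity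
  have hsn' : s ≤ n := div_le_self hn0'.le hlog1
  have hlogs : Real.log n / n = s⁻¹ := by simp only [s]; rw [inv_div]
  set y := s ^ p
  have hy0 : 0 < y := Real.rpow_pos_of_pos hs0 p
  have hy2 : 2 * D ≤ y := hsn
  have hy1 : 1 ≤ y := by linarith
  have hynp : y ≤ (n : ℝ) ^ p := Real.rpow_le_rpow hs0.le hsn' hp0.le
  rw [Real.norm_of_nonneg hy0.le, Real.norm_of_nonneg (Nat.cast_nonneg _)] at hDn
  rw [Real.norm_of_nonneg hy0.le, Real.norm_eq_abs] at hmn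
  have hrate : y / s = s ^ (-(2 * (p * β))) := by
    rw [show -(2 * (p * β)) = p - 1 by linarith, Real.rpow_sub hs0, Real.rpow_one]
  -- About y bins balance bias and prior mass. Capping at `kn n` costs a constant only, since y ≤ D
  -- · `kn n`.
  set k := min (kn n) ⌈y⌉₊
  have hk1 : 1 ≤ k := le_min (hkn_pos n) (Nat.one_le_ceil_iff.2 hy0)
  have hkmem : k ∈ Finset.Icc 1 (kn n) := Finset.mem_Icc.2 ⟨hk1, min_le_left _ _⟩
  have hkle : (k : ℝ) ≤ 2 * y := by
    have h1 : (k : ℝ) ≤ ⌈y⌉₊ := by exact_mod_cast min_le_right _ _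
    have := Nat.ceil_lt_add_one hy0.le
    linarith
  have hkge : y / D ≤ k := by
    rw [div_le_iff₀ (by linarith), mul_comm]
    rcases min_choice (kn n) ⌈y⌉₊ with h | h
    · simp only [k]
      rw [h]
      refine hDn.trans ?_
      gcongr
      exact le_max_left _ _
    · simp only [k]
      rw [h]
      have := Nat.le_ceil y
      nlinarith
  have hk2 : 2 ≤ k := by
    have h1 : 2 ≤ y / D := (le_div_iff₀ (by linarith)).2 hy2
    exact_mod_cast h1.trans hkge
  have hk0 : (0 : ℝ) < k := by exact_mod_cast hk1
  have hTk : T * k ≤ n := by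
    have : (k : ℝ) ≤ kn n := by exact_mod_cast (Finset.mem_Icc.1 hkmem).2
    exact le_trans (by gcongr) hTn
  have hkn' : k ≤ n := by
    have : (k : ℝ) ≤ n := by nlinarith
    exact_mod_cast this
  have hmy : |m n| * Real.log n / n ≤ min 1 ((1 - p) / (128 * D)) * (y / s) := by
    rw [mul_div_assoc, hlogs, div_eq_mul_inv y s, ← mul_assoc]
    gcongr
  have hmabs : m n * Real.log n / n ≤ |m n| * Real.log n / n := by
    gcongr
    exact le_abs_self _
  have hys : 0 < y / s := by positivity
  have hm1 : m n * Real.log n / n ≤ y / s := by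
    refine hmabs.trans (hmy.trans ?_)
    exact mul_le_of_le_one_left hys.le (min_le_left _ _)
  have hm2 : m n * Real.log n / n ≤ epsRadius f α K n k ^ 2 := by
    have h1 := hlow n k hk2 hTk
    have h2 := hlogk k hk1 (hkle.trans (by gcongr))
    have h3 : (y / D * ((1 - p) / 2 * Real.log n)) / n ≤ 64 * epsRadius f α K n k ^ 2 :=
      le_trans (by gcongr) h1
    have h4 : (y / D * ((1 - p) / 2 * Real.log n)) / n = 64 * ((1 - p) / (128 * D) * (y / s)) := by
      simp only [s]; field_simp; ring
    rw [h4] at h3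
    refine hmabs.trans (hmy.trans ?_)
    refine le_trans (mul_le_mul_of_nonneg_right (min_le_right _ _) hys.le) ?_
    linarith
  have hup' : epsRadius f α K n k ^ 2 ≤ B * (L ^ 2 / c * D ^ (2 * β) + 2) * (y / s) := by
    refine (hup n k hN hk1 hkn').trans ?_
    rw [mul_assoc B]
    gcongr B * ?_
    have h1 := hf.biasSq_le_of_holder hβ hL hH hk1
    have h2 : (k : ℝ) ^ (-(2 * β)) ≤ D ^ (2 * β) * (y / s) := by
      calc (k : ℝ) ^ (-(2 * β)) ≤ (y / D) ^ (-(2 * β)) :=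
            Real.rpow_le_rpow_of_nonpos (by positivity) hkge (by linarith)
        _ = D ^ (2 * β) * (y / s) := by
            rw [Real.div_rpow hy0.le (by linarith), Real.rpow_neg (by linarith : 0 ≤ D),
              div_inv_eq_mul, hrate, ← Real.rpow_mul hs0.le, mul_comm]
            congr 2; ring
    have h3 : k * Real.log n / n ≤ 2 * (y / s) := by
      rw [mul_div_assoc, hlogs, ← div_eq_mul_inv, ← mul_div_assoc]
      gcongr
    have h4 : L ^ 2 / c * (k : ℝ) ^ (-(2 * β)) ≤ L ^ 2 / c * (D ^ (2 * β) * (y / s)) := by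
      gcongr
    linarith
  have hfin : epsOracle f α K kn m n ^ 2 ≤ R * (y / s) := by
    refine (epsOracle_sq_le_max hkmem hm2).trans (max_le ?_ ?_)
    · refine hup'.trans ?_
      gcongr
      simp only [R]; linarith
    · refine hm1.trans ?_
      have : 1 ≤ R := by
        have : 0 ≤ B * (L ^ 2 / c * D ^ (2 * β) + 2) := by positivity
        simp only [R]; linarith
      nlinarith
  have hexp : -β / (2 * β + 1) = -(p * β) := by simp only [p]; ring
  have hsq : (√R * s ^ (-β / (2 * β + 1))) ^ 2 = R * (y / s) := by
    rw [mul_pow, Real.sq_sqrt hR.le, hrate, hexp, ← Real.rpow_natCast, ← Real.rpow_mul hs0.le]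
    congr 2; push_cast; ring
  refine abs_le_of_sq_le_sq' (hfin.trans_eq hsq.symm) (by positivity) |>.2

/-- The empirical Bayes posterior contracts at the minimax rate up to a logarithm. -/
theorem contractsAt_minimax (hf : BoundedDensity f c C) {α : ℕ → ℝ} {A a H K : ℝ} (ha : 0 < a)
    (hα : ∀ k : ℕ, 1 ≤ k → a * (k : ℝ) ^ (-H) ≤ α k ∧ α k ≤ A) (hK : 0 < K)
    {kn : ℕ → ℕ} (hkn_pos : ∀ n, 1 ≤ kn n)
    (hkn : (fun n : ℕ => (kn n : ℝ)) =O[atTop] fun n : ℕ => (n : ℝ) / Real.log n)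
    {β L : ℝ} (hβ : 0 < β) (hL : 0 < L)
    (hH : ∀ x ∈ Icc (0 : ℝ) 1, ∀ y ∈ Icc (0 : ℝ) 1, |f x - f y| ≤ L * |x - y| ^ β)
    (hbig : (fun n : ℕ => ((n : ℝ) / Real.log n) ^ (1 / (2 * β + 1))) =O[atTop]
      fun n : ℕ => (kn n : ℝ))
    {khat : ∀ n : ℕ, (Fin n → ℝ) → ℕ} (hkhat : IsMMLE α kn khat)
    {M : ℕ → ℝ} (hM : Tendsto M atTop atTop) :
    ContractsAt f α khat fun n => M n * ((n : ℝ) / Real.log n) ^ (-β / (2 * β + 1)) := by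
  have hp0 : 0 < 1 / (2 * β + 1) := by positivity
  have hy : Tendsto (fun n : ℕ => ((n : ℝ) / Real.log n) ^ (1 / (2 * β + 1))) atTop atTop :=
    (tendsto_rpow_atTop hp0).comp tendsto_natCast_div_log
  -- The claim does not involve m, so any sequence that tends to infinity more slowly than y will
  -- do; √y is one.
  have hm := Real.tendsto_sqrt_atTop.comp hy
  have hmo : (Real.sqrt ∘ fun n : ℕ => ((n : ℝ) / Real.log n) ^ (1 / (2 * β + 1))) =o[atTop]
      fun n : ℕ => ((n : ℝ) / Real.log n) ^ (1 / (2 * β + 1)) := by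
    refine isLittleO_iff.2 fun {e} he => ?_
    filter_upwards [hm.eventually_ge_atTop (1 / e), hy.eventually_ge_atTop 0] with n h1 h2
    simp only [Function.comp_apply] at h1 ⊢
    set z := ((n : ℝ) / Real.log n) ^ (1 / (2 * β + 1))
    rw [Real.norm_of_nonneg (Real.sqrt_nonneg z), Real.norm_of_nonneg h2]
    rw [div_le_iff₀ he] at h1
    have h3 := Real.mul_self_sqrt h2
    nlinarith [Real.sqrt_nonneg z]
  obtain ⟨D, hD, hle⟩ := exists_epsOracle_le hf ha hα hK hkn_pos hkn hβ hL hH hbig hmo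
  refine (contractsAt_epsOracle hf ha hα hK hkn_pos hkn hβ hL hH hm hkhat
    (hM.atTop_div_const hD)).mono ?_
  filter_upwards [hle, hM.eventually_ge_atTop 0] with n h1 h2
  calc M n / D * _ ≤ M n / D * (D * ((n : ℝ) / Real.log n) ^ (-β / (2 * β + 1))) := by gcongr
    _ = _ := by field_simp

/-! ### Densities that are given on `[0,1]` only -/

theorem hellinger_congr {f g : ℝ → ℝ} (h : EqOn f g (Icc 0 1)) : hellinger f = hellinger g := by
  funext u
  rw [hellinger, hellinger]
  congr 1
  exact setIntegral_congr_fun measurableSet_Icc fun x hx => by simp only [h hx]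

theorem biasSq_congr {f g : ℝ → ℝ} (h : EqOn f g (Icc 0 1)) : biasSq f = biasSq g := by
  funext k
  have hbin : ∀ j : Fin k, EqOn f g (bin k j) := fun j =>
    h.mono ((bin_subset j).trans Ioc_subset_Icc_self)
  refine Finset.sum_congr rfl fun j _ => ?_
  rw [setIntegral_congr_fun (f := fun y => √(f y)) (g := fun y => √(g y)) (measurableSet_bin k j)
    fun x hx => by simp only [hbin j hx]]
  exact setIntegral_congr_fun (measurableSet_bin k j) fun x hx => by simp only [hbin j hx]

theorem hellingerBall_congr {f g : ℝ → ℝ} (h : EqOn f g (Icc 0 1)) :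
    hellingerBall f = hellingerBall g := by
  funext k r
  rw [hellingerBall, hellingerBall, hellinger_congr h]

theorem epsRadius_congr {f g : ℝ → ℝ} (h : EqOn f g (Icc 0 1)) : epsRadius f = epsRadius g := by
  funext α K n k
  rw [epsRadius, epsRadius, hellingerBall_congr h]

theorem epsOracle_congr {f g : ℝ → ℝ} (h : EqOn f g (Icc 0 1)) : epsOracle f = epsOracle g := by
  funext α K kn m n
  rw [epsOracle, epsOracle, epsRadius_congr h]

theorem trueLaw_congr {f g : ℝ → ℝ} (h : EqOn f g (Icc 0 1)) : trueLaw f = trueLaw g := by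
  refine withDensity_congr_ae ?_
  filter_upwards [ae_restrict_mem measurableSet_Icc] with x hx
  rw [h hx]

theorem contractsAt_congr {f g : ℝ → ℝ} (h : EqOn f g (Icc 0 1)) :
    ContractsAt f = ContractsAt g := by
  funext α khat r
  simp only [ContractsAt, sampleLaw, trueLaw_congr h, hellingerBall_congr h]

/-- Clamping the argument to [0,1] gives continuity and the bounds on the whole line, which the
preceding proofs use freely. All quantities depend on the values on [0,1] only. -/
theorem exists_boundedDensity {f₀ : ℝ → ℝ} {c₀ C₀ : ℝ} (hc₀ : 0 < c₀)
    (hcont : ContinuousOn f₀ (Icc 0 1))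
    (hbdd : ∀ x ∈ Icc (0 : ℝ) 1, c₀ ≤ f₀ x ∧ f₀ x ≤ C₀)
    (hint : ∫ x in Icc (0 : ℝ) 1, f₀ x = 1) :
    ∃ f, EqOn f₀ f (Icc 0 1) ∧ BoundedDensity f c₀ C₀ := by
  have hmem : ∀ x : ℝ, max 0 (min 1 x) ∈ Icc (0 : ℝ) 1 := fun x =>
    ⟨le_max_left _ _, max_le zero_le_one (min_le_left _ _)⟩
  have heq : EqOn f₀ (fun x => f₀ (max 0 (min 1 x))) (Icc 0 1) := fun x hx => by
    simp only [min_eq_right hx.2, max_eq_right hx.1]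
  refine ⟨fun x => f₀ (max 0 (min 1 x)), heq, hcont.comp_continuous (by fun_prop) hmem, hc₀,
    fun x => (hbdd _ (hmem x)).1, fun x => (hbdd _ (hmem x)).2, ?_⟩
  exact (setIntegral_congr_fun measurableSet_Icc heq).symm.trans hint

end

end RandomHistogram

/-! ### The proposition for a density given on [0,1]. -/

theorem proposition3p6
    (f₀ : ℝ → ℝ) (c₀ C₀ : ℝ) (hc₀ : 0 < c₀)
    (hf₀_cont : ContinuousOn f₀ (Icc 0 1))
    (hf₀_bdd : ∀ x ∈ Icc (0 : ℝ) 1, c₀ ≤ f₀ x ∧ f₀ x ≤ C₀)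
    (hf₀_int : ∫ x in Icc (0 : ℝ) 1, f₀ x = 1)
    (α : ℕ → ℝ) (A a H : ℝ) (ha : 0 < a)
    (hα : ∀ k : ℕ, 1 ≤ k → a * (k : ℝ) ^ (-H) ≤ α k ∧ α k ≤ A)
    (K : ℝ) (hK : 0 < K)
    (kn : ℕ → ℕ) (hkn_pos : ∀ n, 1 ≤ kn n)
    (hkn : (fun n : ℕ => (kn n : ℝ)) =O[atTop] fun n : ℕ => (n : ℝ) / Real.log n) :
    -- for `k ≥ 2` the radius is the unique solution of its defining equation
    (∀ n k : ℕ, 1 ≤ n → 2 ≤ k → ∀ ε : ℝ, 0 ≤ ε →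
      ((RandomHistogram.symmDirichlet k (α k)).real (RandomHistogram.hellingerBall f₀ k (K * ε)) =
          Real.exp (-(n * ε ^ 2)) ↔
        ε = RandomHistogram.epsRadius f₀ α K n k)) ∧
    -- two-sided bound on the radii, uniformly over the number of bins
    (∃ c C : ℝ, 0 < c ∧ 0 < C ∧ ∀ᶠ n : ℕ in atTop, ∀ k ∈ Finset.Icc 1 (kn n),
      ((2 ≤ k ∨ ∃ x ∈ Icc (0 : ℝ) 1, f₀ x ≠ 1) →
        c * (RandomHistogram.biasSq f₀ k + k * Real.log (n / k) / n) ≤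
          RandomHistogram.epsRadius f₀ α K n k ^ 2) ∧
      RandomHistogram.epsRadius f₀ α K n k ^ 2 ≤
        C * (RandomHistogram.biasSq f₀ k + k * Real.log n / n)) ∧
    -- Hölder densities
    (∀ β L : ℝ, 0 < β → β ≤ 1 → 0 < L →
      (∀ x ∈ Icc (0 : ℝ) 1, ∀ y ∈ Icc (0 : ℝ) 1, |f₀ x - f₀ y| ≤ L * |x - y| ^ β) →
      -- the oracle rate is at most the minimax rate up to a logarithm
      ((fun n : ℕ => ((n : ℝ) / Real.log n) ^ (1 / (2 * β + 1))) =O[atTop]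
          (fun n : ℕ => (kn n : ℝ)) →
        ∀ m : ℕ → ℝ, Tendsto m atTop atTop →
          (m =o[atTop] fun n : ℕ => ((n : ℝ) / Real.log n) ^ (1 / (2 * β + 1))) →
          ∃ C : ℝ, 0 < C ∧ ∀ᶠ n : ℕ in atTop,
            RandomHistogram.epsOracle f₀ α K kn m n ≤
              C * ((n : ℝ) / Real.log n) ^ (-β / (2 * β + 1))) ∧
      -- the empirical Bayes posterior contracts at the oracle rate
      (∀ m : ℕ → ℝ, Tendsto m atTop atTop →
        ∀ khat : ∀ n : ℕ, (Fin n → ℝ) → ℕ, RandomHistogram.IsMMLE α kn khat →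
          ∀ M : ℕ → ℝ, Tendsto M atTop atTop →
            RandomHistogram.ContractsAt f₀ α khat
              (fun n => M n * RandomHistogram.epsOracle f₀ α K kn m n)) ∧
      -- hence it contracts at the minimax rate up to a logarithm
      ((fun n : ℕ => ((n : ℝ) / Real.log n) ^ (1 / (2 * β + 1))) =O[atTop]
          (fun n : ℕ => (kn n : ℝ)) →
        ∀ khat : ∀ n : ℕ, (Fin n → ℝ) → ℕ, RandomHistogram.IsMMLE α kn khat →
          ∀ M : ℕ → ℝ, Tendsto M atTop atTop →
            RandomHistogram.ContractsAt f₀ α khat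
              (fun n => M n * ((n : ℝ) / Real.log n) ^ (-β / (2 * β + 1))))) := by
  obtain ⟨f, hff, hf⟩ :=
    RandomHistogram.exists_boundedDensity hc₀ hf₀_cont hf₀_bdd hf₀_int
  rw [RandomHistogram.hellingerBall_congr hff, RandomHistogram.epsRadius_congr hff,
    RandomHistogram.biasSq_congr hff, RandomHistogram.epsOracle_congr hff,
    RandomHistogram.contractsAt_congr hff]
  refine ⟨fun n k hn hk ε hε => ?_, ?_, fun β L hβ _ hL hH₀ => ?_⟩
  · exact RandomHistogram.eq_epsRadius_iff hf hK hn hk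
      (RandomHistogram.pos_of_rpow_le ha hα (by omega)) hε
  · obtain ⟨c, C, hc, hC, h⟩ := RandomHistogram.exists_epsRadius_sq_bounds hf ha hα hK hkn
    refine ⟨c, C, hc, hC, ?_⟩
    filter_upwards [h] with n hn k hk
    refine ⟨fun hor => (hn k hk).1 (hor.imp_right ?_), (hn k hk).2⟩
    rintro ⟨x, hx, hne⟩
    exact ⟨x, hx, by rwa [← hff hx]⟩
  · have hH : ∀ x ∈ Icc (0 : ℝ) 1, ∀ y ∈ Icc (0 : ℝ) 1, |f x - f y| ≤ L * |x - y| ^ β :=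
      fun x hx y hy => by
        rw [← hff hx, ← hff hy]
        exact hH₀ x hx y hy
    exact ⟨fun hbig m _ hm => RandomHistogram.exists_epsOracle_le hf ha hα hK hkn_pos hkn hβ hL hH
        hbig hm,
      fun m hm khat hkhat M hM => RandomHistogram.contractsAt_epsOracle hf ha hα hK hkn_pos hkn
        hβ hL hH hm hkhat hM,
      fun hbig khat hkhat M hM => RandomHistogram.contractsAt_minimax hf ha hα hK hkn_pos hkn
        hβ hL hH hbig hkhat hM⟩
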